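/- \textbf{Setting.} Let $k$ be a commutative topological ring which is separated, complete and linearly topologized, with a countable basis of open ideals, such that every open ideal contains a finitely generated open ideal and the product of two open ideals is open; $\mathcal P(k)$ is the set of open ideals. Let $X$ be a \emph{td-space}: a Hausdorff, locally compact, paracompact space with a basis of clopen sets. $\Sigma(X)$ is the set of clopen subsets and $\mathcal K(X)$ the set of compact open subsets of $X$. $\mathcal Q(X)$ is the set of discrete quotients $\pi_D:X\to D$ with compact fibres, i.e. of the partitions of $X$ into compact open sets. A \emph{neat td-uniformity} $\mathcal J$ on $X$ is a non-empty subset of $\mathcal Q(X)$ in which any two members have a common refinement, and such that the fibres of its members form a basis of the topology of $X$. For $D\in\mathcal J$ let $\Sigma_D(X)=\{\pi_D^{-1}(V):V\subset D\}$ and $\Sigma_{\mathcal J}(X)=\bigcup_{D\in\mathcal J}\Sigma_D(X)$. $\mathscr C(X,k)$ is the space of continuous functions $X\to k$ with the compact-open topology; $\mathscr C_{\rm acs}(X,k)$ is the space of continuous $f$ such that for every $I\in\mathcal P(k)$ one has $f(x)\in I$ outside some compact set; $\mathscr C_{\rm unif}((X,\mathcal J),k)$ is the space of continuous $f$ such that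 for every $I\in\mathcal P(k)$ there is $D\in\mathcal J$ with $f$ constant modulo $I$ on the fibres of $\pi_D$. The last two carry the topology of uniform convergence. For a linearly topologized $k$-module $M$, let $P$ run over the open submodules of $M$ and $Q$ over $\mathcal P(k)$, and put $H_Q=\mathrm{colim}_P\,\mathrm{Hom}_k(M/P,k/Q)$. The weak dual is $M'_{\rm weak}=\lim_Q \widehat{H_Q}$, where $\widehat{H_Q}$ is the completion of $H_Q$ for the linear topology in which a submodule $W$ is open if it contains $IH_Q$ for some $I\in\mathcal P(k)$ and if, for every $P$, there is a finite $F\subset M$ such that $W$ contains every element of $\mathrm{Hom}_k(M/P,k/Q)$ vanishing on $F$. The strong dual $M'_{\rm strong}$ is $\lim_Q H_Q$ with the linear topology whose basic open submodules are the traces of the products $\prod_Q U_Q$, where $U_Q\supset IH_Q$ for some $I\in\mathcal P(k)$ independent of $Q$. Both receive a canonical map from the module of continuous $k$-linear functionals on $M$. The \emph{naive canonical topology} of a $k$-module $L$ has the submodules $IL$, $I\in\mathcal P(k)$, as a basis of open submodules. $M\widehat\otimes N=\lim_{P,Q}M/P\otimes_kN/Q$, over the open submodules $P\subset M$, $Q\subset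 N$. Set $$\mathscr D_{\rm acs}(X,k)=\mathscr C(X,k)'_{\rm weak},\quad \mathscr D^\circ_{\rm acs}(X,k)=\mathscr C(X,k)'_{\rm strong},\quad \mathscr D(X,k)=\mathscr C_{\rm acs}(X,k)'_{\rm weak},\quad \mathscr D^\circ(X,k)=\mathscr C_{\rm acs}(X,k)'_{\rm strong},$$ $$\mathscr D_{\rm unif}((X,\mathcal J),k)=\lim_{D\in\mathcal J}\mathscr C(D,k)'_{\rm weak}\quad\text{(along push-forward).}$$ \textbf{Proposition 5.1.} \begin{enumerate} \item The image of the algebra $k[\Sigma(X)]$ of the monoid $(\Sigma(X),\cap)$ in $\mathscr C(X,k)$, under $U\mapsto\chi_U$, is dense. \item Let $\mathcal J$ be a neat td-uniformity on $X$. For each $D\in\mathcal J$, $\mathscr C(D,k)'_{\rm weak}$ is, as a module, the module of continuous functionals on $\mathscr C(D,k)$. There is a unique bilinear pairing $(f,\mu)\mapsto\int_Xf\mu$ of $\mathscr C_{\rm unif}((X,\mathcal J),k)$ and $\mathscr D_{\rm unif}((X,\mathcal J),k)$ with values in $k$ which is continuous in $f$ and such that $\int_X(g\circ\pi_D)\mu=\mu_D(g)$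 for $D\in\mathcal J$, $g\in\mathscr C(D,k)$. The map $\mu\mapsto(U\mapsto\mu(U):=\int_X\chi_U\mu)$ is a bijection of $\mathscr D_{\rm unif}((X,\mathcal J),k)$ onto the set of maps $\mu:\Sigma_{\mathcal J}(X)\to k$ such that \textbf{(UNIFMEAS)} for every $D\in\mathcal J$ and every disjoint family $(U_\alpha)_{\alpha\in A}$ in $\Sigma_D(X)$, $\sum_\alpha\mu(U_\alpha)$ converges unconditionally to $\mu(\bigcup_\alpha U_\alpha)$. There is a unique continuous $k$-linear $\mathbb P:\mathscr D_{\rm unif}\to\mathscr D_{\rm unif}\widehat\otimes\mathscr D_{\rm unif}$ with $\langle f\otimes g,\mathbb P(\mu)\rangle=\int_Xfg\,\mu$ for all $f,g\in\mathscr C_{\rm unif}$ (the coproduct); it satisfies $\mathbb P(\mu)(U\times V)=\mu(U\cap V)$ for $U,V\in\Sigma_{\mathcal J}(X)$, and is the only $k$-linear map that does. The submodules $\mathscr U_{D,J}=\{\mu:\mu(U)\in J\ \forall U\in\Sigma_D(X)\}$, $D\in\mathcal J$, $J\in\mathcal P(k)$, form a basis of open submodules of $\mathscr D_{\rm unif}((X,\mathcal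 J),k)$. \item As modules, $\mathscr D_{\rm acs}(X,k)$ and $\mathscr D^\circ_{\rm acs}(X,k)$ are the module of continuous functionals on $\mathscr C(X,k)$, and $\mu\mapsto(U\mapsto\mu(U):=\mu(\chi_U))$ identifies each of them with the $k$-module of the maps $\mu:\Sigma(X)\to k$ such that \textbf{(ACSMEAS)} for every disjoint family $(U_\alpha)_{\alpha\in A}$ in $\Sigma(X)$ with $U:=\bigcup_\alpha U_\alpha\in\Sigma(X)$, $\sum_\alpha\mu(U_\alpha)$ converges unconditionally to $\mu(U)$. The topology of $\mathscr D^\circ_{\rm acs}(X,k)$ is the naive canonical one. The submodules $V_{\mathscr P,J}=\{\mu:\mu(C)\in J\ \forall C\in\mathscr P\}$, $\mathscr P\in\mathcal Q(X)$, $J\in\mathcal P(k)$, form a basis of open submodules of $\mathscr D_{\rm acs}(X,k)$. There is a unique continuous $k$-linear $\mathbb P:\mathscr D_{\rm acs}\to\mathscr D_{\rm acs}\widehat\otimes\mathscr D_{\rm acs}$ which is transposed to the product of $\mathscr C(X,k)$; it satisfies $\mathbb P(\mu)(U\times V)=\mu(U\cap V)$ for $U,V\in\Sigma(X)$, and is the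 only $k$-linear map that does. In the strong case, the transpose $\mathscr D^\circ_{\rm acs}(X,k)\to\mathscr D^\circ_{\rm acs}(X\times X,k)$ of the restriction to the diagonal is continuous, and the image of $\mu$ is the only measure $\nu$ with $\nu(U\times V)=\mu(U\cap V)$ for all $U,V\in\Sigma(X)$; and every continuous $k$-linear map $\mathscr D^\circ_{\rm acs}\to\mathscr D^\circ_{\rm acs}\widehat\otimes\mathscr D^\circ_{\rm acs}$ transposed to the product satisfies the same formula. \item As modules, $\mathscr D(X,k)$ and $\mathscr D^\circ(X,k)$ are the module of continuous functionals on $\mathscr C_{\rm acs}(X,k)$, and $\mu\mapsto(C\mapsto\mu(C):=\mu(\chi_C))$ identifies each of them with the module of the maps $\mu:\mathcal K(X)\to k$ such that \textbf{(MEAS)} $\mu(\bigcup_{C\in\mathscr F}C)=\sum_{C\in\mathscr F}\mu(C)$ for every finite disjoint $\mathscr F\subset\mathcal K(X)$. There is a unique continuous $k$-linear $\mathbb P:\mathscr D\to\mathscr D\widehat\otimes\mathscr D$ which is transposed to the product of $\mathscr C_{\rm acs}(X,k)$; it satisfies $\mathbb P(\mu)(U\times V)=\mu(U\cap V)$ for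 $U,V\in\mathcal K(X)$, and is the only $k$-linear map that does. The submodules $U_{\mathscr F,I}=\{\mu:\mu(C)\in I\ \forall C\in\mathscr F\}$, $\mathscr F\subset\mathcal K(X)$ finite, $I\in\mathcal P(k)$, form a basis of open submodules of $\mathscr D(X,k)$. The topology of $\mathscr D^\circ(X,k)$ is the naive canonical one. \item Let $\mathcal J$ be a neat td-uniformity on $X$. The map $\mathscr D_{\rm acs}(X,k)\to\mathscr D_{\rm unif}((X,\mathcal J),k)$ given by the push-forwards to the $D\in\mathcal J$ is continuous, it is transposed to the inclusion $\mathscr C_{\rm unif}\subset\mathscr C$, and on set functions it is the restriction from $\Sigma(X)$ to $\Sigma_{\mathcal J}(X)$. One has $\mathscr C_{\rm acs}(X,k)\subset\mathscr C_{\rm unif}((X,\mathcal J),k)$, and there is a continuous $k$-linear map $\mathscr D_{\rm unif}((X,\mathcal J),k)\to\mathscr D(X,k)$ transposed to this inclusion, which takes $\mu$ to $\widehat\mu$, $\widehat\mu(C)=\int_X\chi_C\,\mu$ for $C\in\mathcal K(X)$. \end{enumerate} -/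

import Mathlib

open Topology TopologicalSpace
open scoped TensorProduct

noncomputable section

namespace TDMeasure

/-! ### Linear topologies -/

/-- The standing hypotheses on the base ring: separated, complete, linearly topologized, with a
countable basis of open ideals, such that every open ideal contains a finitely generated open
ideal and products of open ideals are open. -/
class BaseRing (k : Type*) [CommRing k] [UniformSpace k] [IsUniformAddGroup k]
    [IsTopologicalRing k] : Prop where
  separated : T2Space k
  complete : CompleteSpace k
  linear : (𝓝 (0 : k)).HasBasis (fun I : Ideal k => IsOpen (I : Set k)) (fun I => (I : Set k))
  countable : (𝓝 (0 : k)).IsCountablyGenerated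
  finite : ∀ I : Ideal k, IsOpen (I : Set k) →
    ∃ J : Ideal k, J ≤ I ∧ J.FG ∧ IsOpen (J : Set k)
  op : ∀ I J : Ideal k, IsOpen (I : Set k) → IsOpen (J : Set k) →
    IsOpen ((I * J : Ideal k) : Set k)

section Linear

variable {k : Type*} [CommRing k]

/-- The linear topology for which the submodules in `S` (and their finite intersections) form a
fundamental system of open submodules: the coarsest topology for which all the maps `L → L / N`,
`N ∈ S`, with `L / N` discrete, are continuous. -/
@[reducible]
def linearTopology {L : Type*} [AddCommGroup L] [Module k L] (S : Set (Submodule k L)) :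
    TopologicalSpace L :=
  ⨅ N ∈ S, TopologicalSpace.induced (fun x : L => N.mkQ x) ⊥

variable (k) in
/-- The open submodules of a topological module. -/
def OpenSub (M : Type*) [AddCommGroup M] [Module k M] [TopologicalSpace M] : Type _ :=
  {P : Submodule k M // IsOpen (P : Set M)}

/-- The submodules `B i`, for `i` with `p i`, form a basis of open submodules of the linearly
topologized module `L`. -/
def IsBasisOfOpenSubmodules {L : Type*} [AddCommGroup L] [Module k L]
    [TopologicalSpace L] {ι : Type*} (p : ι → Prop) (B : ι → Submodule k L) : Prop :=
  (∀ i, p i → IsOpen (B i : Set L)) ∧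
    ∀ μ : L, (𝓝 μ).HasBasis p (fun i => {ν | ν - μ ∈ B i})

variable (k) in
/-- The topology of `L` is the naive canonical one, with basis of open submodules the `I L`, for
`I` an open ideal of `k`. -/
def HasNaiveCanonicalTopology [TopologicalSpace k] (L : Type*) [AddCommGroup L] [Module k L]
    [TopologicalSpace L] : Prop :=
  IsBasisOfOpenSubmodules (fun I : Ideal k => IsOpen (I : Set k))
    (fun I => I • (⊤ : Submodule k L))

end Linear

/-! ### Weak and strong duals -/

section Hom

variable (k : Type*) [CommRing k] [TopologicalSpace k]
variable (M : Type*) [AddCommGroup M] [Module k M] [TopologicalSpace M]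
variable (N : Type*) [AddCommGroup N] [Module k N] [TopologicalSpace N]

section Target

variable (T : Type*) [AddCommGroup T] [Module k T]

/-- `colim_P Hom_k (M / P, T)`, the colimit being over the open submodules `P` of `M`: the
linear maps `M → T` that vanish on some open submodule. -/
def homSubmodule : Submodule k (M →ₗ[k] T) where
  carrier := {φ | ∃ P : Submodule k M, IsOpen (P : Set M) ∧ P ≤ LinearMap.ker φ}
  zero_mem' := ⟨⊤, by simp, by simp⟩
  add_mem' := by
    rintro φ ψ ⟨P, hP, h⟩ ⟨P', hP', h'⟩
    refine ⟨P ⊓ P', hP.inter hP', fun x hx => ?_⟩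
    have h1 := h hx.1
    have h2 := h' hx.2
    rw [LinearMap.mem_ker] at *
    simp [h1, h2]
  smul_mem' := by
    rintro c φ ⟨P, hP, h⟩
    refine ⟨P, hP, fun x hx => ?_⟩
    have h1 := h hx
    rw [LinearMap.mem_ker] at *
    simp [h1]

/-- The module `colim_P Hom_k (M / P, T)`. -/
def HomMod : Type _ := homSubmodule k M T

instance : AddCommGroup (HomMod k M T) := inferInstanceAs (AddCommGroup (homSubmodule k M T))
instance : Module k (HomMod k M T) := inferInstanceAs (Module k (homSubmodule k M T))

/-- The open submodules of `colim^u_P Hom_k (M / P, T)^pfg`: the intersection with each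
`Hom_k (M / P, T)` has to contain all the maps that vanish on a suitable finite set, and the
submodule has to contain a multiple of the whole by an open ideal. -/
def weakOpen : Set (Submodule k (HomMod k M T)) :=
  {W | (∀ P : Submodule k M, IsOpen (P : Set M) → ∃ F : Finset M, ∀ φ : HomMod k M T,
      P ≤ LinearMap.ker φ.1 → (∀ m ∈ F, φ.1 m = 0) → φ ∈ W) ∧
    ∃ I : Ideal k, IsOpen (I : Set k) ∧ I • (⊤ : Submodule k (HomMod k M T)) ≤ W}

/-- The discrete quotient of `colim^u_P Hom_k (M / P, T)^pfg` by an open submodule. -/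
def WeakQuot (W : weakOpen k M T) : Type _ := HomMod k M T ⧸ W.1

instance (W : weakOpen k M T) : AddCommGroup (WeakQuot k M T W) :=
  inferInstanceAs (AddCommGroup (HomMod k M T ⧸ W.1))
instance (W : weakOpen k M T) : Module k (WeakQuot k M T W) :=
  inferInstanceAs (Module k (HomMod k M T ⧸ W.1))

variable {T} in
/-- The projection to a discrete quotient. -/
def WeakQuot.mk (W : weakOpen k M T) : HomMod k M T →ₗ[k] WeakQuot k M T W := W.1.mkQ

variable {k T} {T' : Type*} [AddCommGroup T'] [Module k T']

/-- The map `colim_P Hom_k (M / P, T) → colim_P Hom_k (M / P, T')` given by `T → T'`. -/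
def HomMod.map (u : T →ₗ[k] T') : HomMod k M T →ₗ[k] HomMod k M T' where
  toFun φ := ⟨u ∘ₗ φ.1, by
    obtain ⟨P, hP, hφ⟩ := φ.2
    refine ⟨P, hP, fun x hx => ?_⟩
    have h1 := hφ hx
    rw [LinearMap.mem_ker] at *
    simp [h1]⟩
  map_add' φ ψ := by
    apply Subtype.ext
    exact LinearMap.comp_add _ _ _
  map_smul' c φ := by
    apply Subtype.ext
    exact LinearMap.comp_smul _ _ _

/-- The map of discrete quotients given by `T → T'`. -/
def WeakQuot.map (u : T →ₗ[k] T') (W : weakOpen k M T) (W' : weakOpen k M T')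
    (h : W.1 ≤ W'.1.comap (HomMod.map M u)) : WeakQuot k M T W →ₗ[k] WeakQuot k M T' W' :=
  Submodule.mapQ W.1 W'.1 (HomMod.map M u) h

end Target

/-- `lim_Q colim^u_P Hom_k (M / P, N / Q)^pfg`, where the completion of a linearly topologized
module `L` in the definition of `colim^u` is written as the limit of the discrete modules `L / W`,
for `W` an open submodule. -/
def WeakHomLim :
    Submodule k ((Q : OpenSub k N) → (W : weakOpen k M (N ⧸ Q.1)) → WeakQuot k M (N ⧸ Q.1) W) where
  carrier := {x | ∀ (Q Q' : OpenSub k N) (h : Q.1 ≤ Q'.1) (W : weakOpen k M (N ⧸ Q.1))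
    (W' : weakOpen k M (N ⧸ Q'.1)) (hW : W.1 ≤ W'.1.comap (HomMod.map M (Submodule.factor h))),
    WeakQuot.map M (Submodule.factor h) W W' hW (x Q W) = x Q' W'}
  zero_mem' := fun Q Q' h W W' hW => by simp
  add_mem' := fun {x y} hx hy Q Q' h W W' hW => by
    simp only [Pi.add_apply, map_add, hx Q Q' h W W' hW, hy Q Q' h W W' hW]
  smul_mem' := fun c x hx Q Q' h W W' hW => by
    simp only [Pi.smul_apply, map_smul, hx Q Q' h W W' hW]

instance : TopologicalSpace (WeakHomLim k M N) :=
  ⨅ (Q : OpenSub k N) (W : weakOpen k M (N ⧸ Q.1)),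
    TopologicalSpace.induced (fun x : WeakHomLim k M N => x.1 Q W) ⊥

/-- `lim_Q colim_P Hom_k (M / P, N / Q)`. -/
def StrongHomLim : Submodule k ((Q : OpenSub k N) → HomMod k M (N ⧸ Q.1)) where
  carrier := {x | ∀ (Q Q' : OpenSub k N) (h : Q.1 ≤ Q'.1), HomMod.map M (Submodule.factor h) (x Q) = x Q'}
  zero_mem' := fun Q Q' h => by simp
  add_mem' := fun {x y} hx hy Q Q' h => by
    simp only [Pi.add_apply, map_add, hx Q Q' h, hy Q Q' h]
  smul_mem' := fun c x hx Q Q' h => by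
    simp only [Pi.smul_apply, map_smul, hx Q Q' h]

/-- The topology of the uniform box limit `lim^{□,u}_Q colim^u_P Hom_k (M / P, N / Q)^dis`: the
basic open submodules are the products of open submodules `U Q` of the terms that contain
`I • (term)` for an open ideal `I` independent of `Q` (such `U Q` are open in the terms). -/
instance : TopologicalSpace (StrongHomLim k M N) :=
  linearTopology {W | ∃ U : (Q : OpenSub k N) → Submodule k (HomMod k M (N ⧸ Q.1)),
    (∃ I : Ideal k, IsOpen (I : Set k) ∧ ∀ Q, I • (⊤ : Submodule k (HomMod k M (N ⧸ Q.1))) ≤ U Q) ∧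
    W = (Submodule.pi Set.univ U).comap (StrongHomLim k M N).subtype}

variable [IsTopologicalAddGroup N] [ContinuousConstSMul k N]

variable {k M N} in
/-- Reduction of a continuous linear map modulo an open submodule. -/
def reduceMod (Q : OpenSub k N) : (M →L[k] N) →ₗ[k] HomMod k M (N ⧸ Q.1) where
  toFun φ := ⟨Q.1.mkQ ∘ₗ (φ : M →ₗ[k] N), Q.1.comap (φ : M →ₗ[k] N),
    Q.2.preimage φ.continuous, fun x hx => by
      rw [LinearMap.mem_ker]
      simpa using hx⟩
  map_add' φ ψ := by
    apply Subtype.ext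
    rfl
  map_smul' c φ := by
    apply Subtype.ext
    rfl

/-- The canonical map from continuous linear maps to the weak `Hom`. -/
def toWeakHomLim : (M →L[k] N) →ₗ[k] WeakHomLim k M N where
  toFun φ := ⟨fun Q W => WeakQuot.mk k M W (reduceMod Q φ), fun _ _ _ _ _ _ => rfl⟩
  map_add' φ ψ := by
    apply Subtype.ext
    funext Q W
    exact map_add (WeakQuot.mk k M W ∘ₗ reduceMod Q) φ ψ
  map_smul' c φ := by
    apply Subtype.ext
    funext Q W
    exact map_smul (WeakQuot.mk k M W ∘ₗ reduceMod Q) c φ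

/-- The canonical map from continuous linear maps to the strong `Hom`. -/
def toStrongHomLim : (M →L[k] N) →ₗ[k] StrongHomLim k M N where
  toFun φ := ⟨fun Q => reduceMod Q φ, fun _ _ _ => rfl⟩
  map_add' φ ψ := by
    apply Subtype.ext
    funext Q
    exact map_add (reduceMod Q) φ ψ
  map_smul' c φ := by
    apply Subtype.ext
    funext Q
    exact map_smul (reduceMod Q) c φ

end Hom

section Dual

variable (k : Type*) [CommRing k] [TopologicalSpace k] [IsTopologicalRing k]
variable (M : Type*) [AddCommGroup M] [Module k M] [TopologicalSpace M]

/-- The continuous functionals on `M` with the weak topology, i.e. the one induced by the weak dual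
`lim_Q colim^u_P Hom_k (M / P, k / Q)^pfg`. -/
def WkDual : Type _ := M →L[k] k

/-- The continuous functionals on `M` with the strong topology, i.e. the one induced by the strong
dual `lim^{□,u}_Q colim^u_P Hom_k (M / P, k / Q)^dis`. -/
def StDual : Type _ := M →L[k] k

instance : AddCommGroup (WkDual k M) := inferInstanceAs (AddCommGroup (M →L[k] k))
instance : Module k (WkDual k M) := inferInstanceAs (Module k (M →L[k] k))
instance : AddCommGroup (StDual k M) := inferInstanceAs (AddCommGroup (M →L[k] k))
instance : Module k (StDual k M) := inferInstanceAs (Module k (M →L[k] k))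

/-- The canonical map to the weak dual `lim_Q colim^u_P Hom_k (M / P, k / Q)^pfg`. -/
def WkDual.toLim : WkDual k M →ₗ[k] WeakHomLim k M k := toWeakHomLim k M k

/-- The canonical map to the strong dual `lim^{□,u}_Q colim^u_P Hom_k (M / P, k / Q)^dis`. -/
def StDual.toLim : StDual k M →ₗ[k] StrongHomLim k M k := toStrongHomLim k M k

instance : TopologicalSpace (WkDual k M) :=
  TopologicalSpace.induced (WkDual.toLim k M) inferInstance

instance : TopologicalSpace (StDual k M) :=
  TopologicalSpace.induced (StDual.toLim k M) inferInstance

variable {k M}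

/-- The value of a functional. -/
def WkDual.eval (m : M) : WkDual k M →ₗ[k] k where
  toFun φ := (show M →L[k] k from φ) m
  map_add' _ _ := rfl
  map_smul' _ _ := rfl

/-- The value of a functional. -/
def StDual.eval (m : M) : StDual k M →ₗ[k] k where
  toFun φ := (show M →L[k] k from φ) m
  map_add' _ _ := rfl
  map_smul' _ _ := rfl

variable {N : Type*} [AddCommGroup N] [Module k N] [TopologicalSpace N]

/-- The weak transpose of a continuous linear map. -/
def WkDual.transpose (T : M →L[k] N) : WkDual k N →ₗ[k] WkDual k M where
  toFun φ := (show N →L[k] k from φ).comp T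
  map_add' _ _ := rfl
  map_smul' _ _ := rfl

/-- The strong transpose of a continuous linear map. -/
def StDual.transpose (T : M →L[k] N) : StDual k N →ₗ[k] StDual k M where
  toFun φ := (show N →L[k] k from φ).comp T
  map_add' _ _ := rfl
  map_smul' _ _ := rfl

end Dual

/-! ### Completed tensor products and coproducts -/

section Tensor

variable (k : Type*) [CommRing k]
variable (M N : Type*) [AddCommGroup M] [Module k M] [TopologicalSpace M]
  [AddCommGroup N] [Module k N] [TopologicalSpace N]

/-- The completed tensor product `lim_{P, Q} M / P ⊗ N / Q`, over the open submodules. -/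
def CompletedTensor :
    Submodule k ((P : OpenSub k M) → (Q : OpenSub k N) → (M ⧸ P.1) ⊗[k] (N ⧸ Q.1)) where
  carrier := {z | ∀ (P P' : OpenSub k M) (Q Q' : OpenSub k N) (hP : P.1 ≤ P'.1) (hQ : Q.1 ≤ Q'.1),
    TensorProduct.map (Submodule.factor hP) (Submodule.factor hQ) (z P Q) = z P' Q'}
  zero_mem' := fun P P' Q Q' hP hQ => by simp
  add_mem' := fun {x y} hx hy P P' Q Q' hP hQ => by
    simp only [Pi.add_apply, map_add, hx P P' Q Q' hP hQ, hy P P' Q Q' hP hQ]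
  smul_mem' := fun c x hx P P' Q Q' hP hQ => by
    simp only [Pi.smul_apply, map_smul, hx P P' Q Q' hP hQ]

instance : TopologicalSpace (CompletedTensor k M N) :=
  ⨅ (P : OpenSub k M) (Q : OpenSub k N), TopologicalSpace.induced (fun z => z.1 P Q) ⊥

variable {k M N}

/-- The map `M / P ⊗ N / Q → k / I` induced by `m ⊗ n ↦ α m * β n`. -/
def tensorValueMod (α : M →ₗ[k] k) (β : N →ₗ[k] k) (I : Ideal k) (P : Submodule k M)
    (Q : Submodule k N) (hP : P ≤ Submodule.comap α I) (hQ : Q ≤ Submodule.comap β I) :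
    (M ⧸ P) ⊗[k] (N ⧸ Q) →ₗ[k] k ⧸ I :=
  TensorProduct.lift
    ((LinearMap.mul k (k ⧸ I)).compl₁₂ (P.mapQ I α hP) (Q.mapQ I β hQ))

/-- `(α ⊗ β) z = a`, for the continuous extension of `m ⊗ n ↦ α m * β n` to the completed tensor
product. -/
def IsTensorValue [TopologicalSpace k] (α : M →ₗ[k] k) (β : N →ₗ[k] k)
    (z : CompletedTensor k M N) (a : k) : Prop :=
  ∀ I : Ideal k, IsOpen (I : Set k) → ∃ (P : OpenSub k M) (Q : OpenSub k N)
    (hP : P.1 ≤ Submodule.comap α I) (hQ : Q.1 ≤ Submodule.comap β I),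
    tensorValueMod α β I P.1 Q.1 hP hQ (z.1 P Q) = Ideal.Quotient.mk I a

/-- `Δ` is a continuous coproduct on the space `M` of measures which is the transpose of the
product of functions: `⟨f ⊗ g, Δ μ⟩ = ⟨f g, μ⟩`; here `ev f μ = ⟨f, μ⟩`. -/
def IsCoproduct [TopologicalSpace k] {A : Type*} [Mul A] (ev : A → M →ₗ[k] k)
    (Δ : M →ₗ[k] CompletedTensor k M M) : Prop :=
  Continuous Δ ∧ ∀ (μ : M) (f g : A), IsTensorValue (ev f) (ev g) (Δ μ) (ev (f * g) μ)

/-- `Δ μ (U × V) = μ (U ∩ V)`; here `ev U μ = μ U`. -/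
def CoproductFormula [TopologicalSpace k] {S : Type*} [Min S] (ev : S → M →ₗ[k] k)
    (Δ : M →ₗ[k] CompletedTensor k M M) : Prop :=
  ∀ (μ : M) (U V : S), IsTensorValue (ev U) (ev V) (Δ μ) (ev (U ⊓ V) μ)

end Tensor

/-! ### Spaces -/

/-- Locally compact paracompact zero-dimensional (Hausdorff) spaces. -/
class TDSpace (X : Type*) [TopologicalSpace X] : Prop extends
    T2Space X, LocallyCompactSpace X, ParacompactSpace X where
  clopen_basis : IsTopologicalBasis {U : Set X | IsClopen U}

section Spaces

variable {X : Type*} [TopologicalSpace X]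

/-- A discrete quotient is proper if its fibres are compact; the fibres then form a partition into
compact open subsets. -/
def IsProperQuotient (D : DiscreteQuotient X) : Prop :=
  ∀ d : D, IsCompact (D.proj ⁻¹' {d})

variable (X) in
/-- A neat uniformity given by partitions into compact open subsets: a cofiltered system of proper
discrete quotients whose fibres form a basis of the topology. -/
structure TDUniformity where
  radii : Set (DiscreteQuotient X)
  nonempty : radii.Nonempty
  cofiltered : ∀ D ∈ radii, ∀ D' ∈ radii, ∃ E ∈ radii, E ≤ D ∧ E ≤ D'
  proper : ∀ D ∈ radii, IsProperQuotient D
  neat : IsTopologicalBasis {U : Set X | ∃ D ∈ radii, ∃ d : D, U = D.proj ⁻¹' {d}}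

/-- The uniformly measurable subsets of radius `D`. -/
def IsMeasurableOfRadius (D : DiscreteQuotient X) (U : Set X) : Prop :=
  ∃ V : Set D, U = D.proj ⁻¹' V

/-- The uniformly measurable subsets. -/
def UnifSets (Θ : TDUniformity X) : Type _ :=
  {U : Set X // ∃ D ∈ Θ.radii, IsMeasurableOfRadius D U}

theorem IsMeasurableOfRadius.mono {D E : DiscreteQuotient X} (h : E ≤ D) {U : Set X}
    (hU : IsMeasurableOfRadius D U) : IsMeasurableOfRadius E U := by
  obtain ⟨V, rfl⟩ := hU
  exact ⟨DiscreteQuotient.ofLE h ⁻¹' V, by ext x; simp⟩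

instance (Θ : TDUniformity X) : Min (UnifSets Θ) where
  min U V := ⟨U.1 ∩ V.1, by
    obtain ⟨D, hD, hU⟩ := U.2
    obtain ⟨D', hD', hV⟩ := V.2
    obtain ⟨E, hE, h, h'⟩ := Θ.cofiltered D hD D' hD'
    obtain ⟨A, hA⟩ := hU.mono h
    obtain ⟨B, hB⟩ := hV.mono h'
    exact ⟨E, hE, A ∩ B, by rw [hA, hB]; rfl⟩⟩

theorem UnifSets.isClopen {Θ : TDUniformity X} (U : UnifSets Θ) : IsClopen U.1 := by
  obtain ⟨D, _, V, hV⟩ := U.2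
  rw [hV]
  exact D.isClopen_preimage V

/-- The fibre of a discrete quotient, as a clopen subset. -/
def fibre (D : DiscreteQuotient X) (d : D) : Clopens X :=
  ⟨D.proj ⁻¹' {d}, D.isClopen_preimage {d}⟩

/-- A compact open subset, as a clopen subset. -/
def compactOpenClopen [T2Space X] (C : CompactOpens X) : Clopens X :=
  ⟨C, C.isCompact.isClosed, C.isOpen⟩

variable (X) in
/-- The monoid of clopen subsets, with intersection as multiplication. -/
def ClopenMonoid : Type _ := Clopens X

instance : CommMonoid (ClopenMonoid X) where
  mul U V := min (α := Clopens X) U V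
  mul_assoc U V W := inf_assoc (α := Clopens X) U V W
  one := (⊤ : Clopens X)
  one_mul U := top_inf_eq (α := Clopens X) U
  mul_one U := inf_top_eq (α := Clopens X) U
  mul_comm U V := inf_comm (α := Clopens X) U V

end Spaces

/-! ### Spaces of functions -/

section Functions

variable {X : Type*} [TopologicalSpace X]
variable {k : Type*} [CommRing k] [TopologicalSpace k] [IsTopologicalRing k]

variable (k) in
/-- The characteristic function of a clopen subset. -/
def chi (U : Clopens X) : C(X, k) := (LocallyConstant.charFn k U.isClopen : LocallyConstant X k)

theorem chi_apply {k : Type*} [CommRing k] [TopologicalSpace k] (U : Clopens X) (x : X) :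
    chi k U x = Set.indicator (U : Set X) 1 x := rfl

variable (X k) in
/-- `U ↦ χ_U`, as a morphism of monoids. -/
def chiHom : ClopenMonoid X →* C(X, k) where
  toFun U := chi k U
  map_one' := by
    ext x
    change Set.indicator (Set.univ : Set X) (1 : X → k) x = 1
    simp
  map_mul' U V := by
    have key : ∀ A B : Clopens X, chi k (A ⊓ B) = chi k A * chi k B := by
      intro A B
      ext x
      rw [ContinuousMap.mul_apply, chi_apply, chi_apply, chi_apply]
      by_cases h : x ∈ (A : Set X) <;> by_cases h' : x ∈ (B : Set X) <;> simp_all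
    exact key U V

variable (X k) in
/-- The `k`-algebra homomorphism `k[Σ(X)] → C(X, k)` which extends `U ↦ χ_U`. -/
def clopenAlgebraMap : MonoidAlgebra k (ClopenMonoid X) →ₐ[k] C(X, k) :=
  MonoidAlgebra.lift k C(X, k) (ClopenMonoid X) (chiHom X k)

/-- Composition with a continuous map `Y → X`. -/
def pullback {Y : Type*} [TopologicalSpace Y] (π : C(Y, X)) : C(X, k) →L[k] C(Y, k) where
  toFun f := f.comp π
  map_add' _ _ := rfl
  map_smul' _ _ := rfl
  cont := ContinuousMap.continuous_precomp π

variable (X k) in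
/-- The continuous functions with almost compact support. -/
def acsSubmodule : Submodule k C(X, k) where
  carrier := {f | ∀ I : Ideal k, IsOpen (I : Set k) →
    ∃ Z : Set X, IsCompact Z ∧ ∀ x ∉ Z, f x ∈ I}
  zero_mem' := fun I _ => ⟨∅, isCompact_empty, fun x _ => by simp⟩
  add_mem' := by
    intro f g hf hg I hI
    obtain ⟨Z, hZ, h⟩ := hf I hI
    obtain ⟨Z', hZ', h'⟩ := hg I hI
    refine ⟨Z ∪ Z', hZ.union hZ', fun x hx => ?_⟩
    rw [Set.mem_union, not_or] at hx
    exact I.add_mem (h x hx.1) (h' x hx.2)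
  smul_mem' := by
    intro c f hf I hI
    obtain ⟨Z, hZ, h⟩ := hf I hI
    exact ⟨Z, hZ, fun x hx => I.mul_mem_left c (h x hx)⟩

variable (X k) in
/-- The space of continuous functions with almost compact support, with the topology of uniform
convergence. -/
def CAcs : Type _ := acsSubmodule X k

instance : AddCommGroup (CAcs X k) := inferInstanceAs (AddCommGroup (acsSubmodule X k))
instance : Module k (CAcs X k) := inferInstanceAs (Module k (acsSubmodule X k))
instance : TopologicalSpace (CAcs X k) :=
  linearTopology {N : Submodule k (CAcs X k) | ∃ I : Ideal k, IsOpen (I : Set k) ∧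
    ∀ f : CAcs X k, f ∈ N ↔ ∀ x, f.1 x ∈ I}
instance : Mul (CAcs X k) where
  mul f g := ⟨f.1 * g.1, fun I hI => by
    obtain ⟨Z, hZ, h⟩ := f.2 I hI
    exact ⟨Z, hZ, fun x hx => I.mul_mem_right _ (h x hx)⟩⟩

variable (k) in
/-- The characteristic function of a compact open subset. -/
def chiAcs [T2Space X] (C : CompactOpens X) : CAcs X k :=
  ⟨chi k (compactOpenClopen C), fun I _ => ⟨C, C.isCompact, fun x hx => by
    rw [chi_apply, Set.indicator_of_notMem]
    · exact I.zero_mem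
    · exact hx⟩⟩

variable (k) in
/-- The uniformly continuous functions: continuous functions such that, for every open ideal `I`,
the cover of `X` by the preimages of the cosets of `I` is refined by the fibres of some radius. -/
def unifSubmodule (Θ : TDUniformity X) : Submodule k C(X, k) where
  carrier := {f | ∀ I : Ideal k, IsOpen (I : Set k) →
    ∃ D ∈ Θ.radii, ∀ x y, D.proj x = D.proj y → f x - f y ∈ I}
  zero_mem' := fun I _ => by
    obtain ⟨D, hD⟩ := Θ.nonempty
    exact ⟨D, hD, fun x y _ => by simp⟩
  add_mem' := by
    intro f g hf hg I hI
    obtain ⟨D, hD, h⟩ := hf I hI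
    obtain ⟨D', hD', h'⟩ := hg I hI
    obtain ⟨E, hE, l, l'⟩ := Θ.cofiltered D hD D' hD'
    refine ⟨E, hE, fun x y hxy => ?_⟩
    have h1 := h x y (by rw [← DiscreteQuotient.ofLE_proj l, hxy, DiscreteQuotient.ofLE_proj])
    have h2 := h' x y (by rw [← DiscreteQuotient.ofLE_proj l', hxy, DiscreteQuotient.ofLE_proj])
    have := I.add_mem h1 h2
    rwa [sub_add_sub_comm] at this
  smul_mem' := by
    intro c f hf I hI
    obtain ⟨D, hD, h⟩ := hf I hI
    refine ⟨D, hD, fun x y hxy => ?_⟩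
    have := I.mul_mem_left c (h x y hxy)
    rwa [mul_sub] at this

variable (k) in
/-- The space of uniformly continuous functions, with the topology of uniform convergence. -/
def CUnif (Θ : TDUniformity X) : Type _ := unifSubmodule k Θ

variable {Θ : TDUniformity X}

instance : AddCommGroup (CUnif k Θ) := inferInstanceAs (AddCommGroup (unifSubmodule k Θ))
instance : Module k (CUnif k Θ) := inferInstanceAs (Module k (unifSubmodule k Θ))
instance : TopologicalSpace (CUnif k Θ) :=
  linearTopology {N : Submodule k (CUnif k Θ) | ∃ I : Ideal k, IsOpen (I : Set k) ∧
    ∀ f : CUnif k Θ, f ∈ N ↔ ∀ x, f.1 x ∈ I}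
instance : Mul (CUnif k Θ) where
  mul f g := ⟨f.1 * g.1, fun I hI => by
    obtain ⟨D, hD, h⟩ := f.2 I hI
    obtain ⟨D', hD', h'⟩ := g.2 I hI
    obtain ⟨E, hE, l, l'⟩ := Θ.cofiltered D hD D' hD'
    refine ⟨E, hE, fun x y hxy => ?_⟩
    have h1 := h x y (by rw [← DiscreteQuotient.ofLE_proj l, hxy, DiscreteQuotient.ofLE_proj])
    have h2 := h' x y (by rw [← DiscreteQuotient.ofLE_proj l', hxy, DiscreteQuotient.ofLE_proj])
    have h3 := I.add_mem (I.mul_mem_left (f.1 x) h2) (I.mul_mem_right (g.1 y) h1)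
    have e : f.1 x * (g.1 x - g.1 y) + (f.1 x - f.1 y) * g.1 y
        = (f.1 * g.1) x - (f.1 * g.1) y := by
      simp only [ContinuousMap.mul_apply]; ring
    rwa [e] at h3⟩

/-- The projection to a discrete quotient, as a continuous map. -/
def projC (D : DiscreteQuotient X) : C(X, D) := ⟨D.proj, D.proj_continuous⟩

/-- The transition map between discrete quotients, as a continuous map. -/
def transC {D E : DiscreteQuotient X} (h : E ≤ D) : C(E, D) :=
  ⟨DiscreteQuotient.ofLE h, DiscreteQuotient.ofLE_continuous h⟩

/-- A function on a radius `D`, as a uniformly continuous function on `X`. -/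
def pullUnif (D : Θ.radii) (g : C(D.1, k)) : CUnif k Θ :=
  ⟨pullback (projC D.1) g, fun I _ => ⟨D.1, D.2, fun x y hxy => by
    change g (D.1.proj x) - g (D.1.proj y) ∈ I
    rw [hxy, sub_self]
    exact I.zero_mem⟩⟩

variable (k) in
/-- The characteristic function of a uniformly measurable subset. -/
def chiUnif (U : UnifSets Θ) : CUnif k Θ :=
  ⟨chi k ⟨U.1, U.isClopen⟩, fun I _ => by
    obtain ⟨D, hD, V, hV⟩ := U.2
    refine ⟨D, hD, fun x y hxy => ?_⟩
    have hm : x ∈ U.1 ↔ y ∈ U.1 := by rw [hV]; simp [hxy]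
    have e : chi k (⟨U.1, U.isClopen⟩ : Clopens X) x = chi k ⟨U.1, U.isClopen⟩ y := by
      rw [chi_apply, chi_apply]
      change Set.indicator U.1 1 x = Set.indicator U.1 1 y
      by_cases h : x ∈ U.1
      · rw [Set.indicator_of_mem h, Set.indicator_of_mem (hm.1 h)]
        rfl
      · rw [Set.indicator_of_notMem h, Set.indicator_of_notMem (fun h' => h (hm.2 h'))]
    rw [e, sub_self]
    exact I.zero_mem⟩

end Functions

/-! ### Spaces of measures -/

section Measures

variable (X : Type*) [TopologicalSpace X]
variable (k : Type*) [CommRing k] [TopologicalSpace k] [IsTopologicalRing k]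

/-- Measures with almost compact support: the weak dual of `C(X, k)`. -/
abbrev DAcs : Type _ := WkDual k C(X, k)

/-- Measures with almost compact support, with the strong topology. -/
abbrev DAcsStrong : Type _ := StDual k C(X, k)

/-- Measures: the weak dual of the space of functions with almost compact support. -/
abbrev DMeas : Type _ := WkDual k (CAcs X k)

/-- Measures, with the strong topology. -/
abbrev DMeasStrong : Type _ := StDual k (CAcs X k)

variable {X}

/-- Uniform measures: the limit, over the radii `D`, of the spaces `C(D, k)'_weak` of measures with
almost compact support on the discrete spaces `D`, along the push-forward maps. -/
def DUnif (Θ : TDUniformity X) : Submodule k ((D : Θ.radii) → DAcs D.1 k) where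
  carrier := {μ | ∀ (D E : Θ.radii) (h : E.1 ≤ D.1),
    WkDual.transpose (pullback (transC h)) (μ E) = μ D}
  zero_mem' := fun D E h => by simp
  add_mem' := fun {x y} hx hy D E h => by
    simp only [Pi.add_apply, map_add, hx D E h, hy D E h]
  smul_mem' := fun c x hx D E h => by
    simp only [Pi.smul_apply, map_smul, hx D E h]

variable {k} {Θ : TDUniformity X}

/-- `B μ f = ∫ f dμ` is the integration pairing between uniform measures and uniformly continuous
functions: it is bilinear, continuous in `f`, and on functions that factor through a radius `D` it
is the pairing of measures and functions on `D`. -/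
def IsUnifIntegration (B : DUnif k Θ →ₗ[k] CUnif k Θ →ₗ[k] k) : Prop :=
  (∀ μ, Continuous (B μ)) ∧
    ∀ (μ : DUnif k Θ) (D : Θ.radii) (g : C(D.1, k)), B μ (pullUnif D g) = WkDual.eval g (μ.1 D)

variable (k Θ) in
/-- The map from measures with almost compact support to uniform measures which is given by the
push-forwards to the radii. -/
def inc : DAcs X k →ₗ[k] DUnif k Θ where
  toFun μ := ⟨fun D => WkDual.transpose (pullback (projC D.1)) μ, fun _ _ _ => rfl⟩
  map_add' _ _ := rfl
  map_smul' _ _ := rfl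

/-- Unconditional additivity on disjoint families of uniformly measurable sets of the same
radius. -/
def IsUnifMeasure (m : UnifSets Θ → k) : Prop :=
  ∀ D ∈ Θ.radii, ∀ F : Set (UnifSets Θ), (∀ V ∈ F, IsMeasurableOfRadius D V.1) →
    F.PairwiseDisjoint (fun V => V.1) → ∀ U : UnifSets Θ, U.1 = ⋃ V ∈ F, V.1 →
      HasSum (fun V : F => m V.1) (m U)

/-- Unconditional additivity on disjoint families of clopen sets with clopen union. -/
def IsAcsMeasure (m : Clopens X → k) : Prop :=
  ∀ F : Set (Clopens X), F.PairwiseDisjoint (fun V => (V : Set X)) →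
    ∀ U : Clopens X, (U : Set X) = ⋃ V ∈ F, (V : Set X) → HasSum (fun V : F => m V.1) (m U)

/-- Finite additivity on compact open sets. -/
def IsFinAddMeasure (m : CompactOpens X → k) : Prop :=
  ∀ F : Finset (CompactOpens X), (F : Set (CompactOpens X)).PairwiseDisjoint
    (fun C => (C : Set X)) → m (F.sup id) = ∑ C ∈ F, m C

/-- The set function `U ↦ μ (χ_U)`. -/
def acsSetFunction : DAcs X k →ₗ[k] (Clopens X → k) :=
  LinearMap.pi fun U => WkDual.eval (chi k U)

/-- The set function `U ↦ μ (χ_U)`. -/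
def acsSetFunctionStrong : DAcsStrong X k →ₗ[k] (Clopens X → k) :=
  LinearMap.pi fun U => StDual.eval (chi k U)

/-- The set function `C ↦ μ (χ_C)`. -/
def measSetFunction [T2Space X] : DMeas X k →ₗ[k] (CompactOpens X → k) :=
  LinearMap.pi fun C => WkDual.eval (chiAcs k C)

/-- The set function `C ↦ μ (χ_C)`. -/
def measSetFunctionStrong [T2Space X] : DMeasStrong X k →ₗ[k] (CompactOpens X → k) :=
  LinearMap.pi fun C => StDual.eval (chiAcs k C)

/-- The set function `U ↦ ∫ χ_U dμ`. -/
def unifSetFunction (B : DUnif k Θ →ₗ[k] CUnif k Θ →ₗ[k] k) :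
    DUnif k Θ →ₗ[k] (UnifSets Θ → k) :=
  LinearMap.pi fun U => B.flip (chiUnif k U)

/-- The uniform measures with values in `J` on all the sets of radius `D`. -/
def unifNhd (B : DUnif k Θ →ₗ[k] CUnif k Θ →ₗ[k] k) (D : DiscreteQuotient X) (J : Ideal k) :
    Submodule k (DUnif k Θ) :=
  ⨅ U : {U : UnifSets Θ // IsMeasurableOfRadius D U.1},
    Submodule.comap (B.flip (chiUnif k U.1)) J

/-- The measures with values in `J` on all the members of the partition `D`. -/
def acsNhd (D : DiscreteQuotient X) (J : Ideal k) : Submodule k (DAcs X k) :=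
  ⨅ d : D, Submodule.comap (WkDual.eval (chi k (fibre D d))) J

/-- The measures with values in `I` on all the members of the finite family `F`. -/
def measNhd [T2Space X] (F : Finset (CompactOpens X)) (I : Ideal k) : Submodule k (DMeas X k) :=
  ⨅ C ∈ F, Submodule.comap (WkDual.eval (chiAcs k C)) I

variable (X) in
/-- The diagonal map. -/
def diagC : C(X, X × X) := ⟨fun x => (x, x), by fun_prop⟩

end Measures

end TDMeasure

end

set_option linter.unusedSectionVars false

noncomputable section

namespace TDMeasure

/-! ### Bases of open submodules -/

section Basis

variable {k : Type*} [CommRing k]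
variable {L : Type*} [AddCommGroup L] [Module k L] [TopologicalSpace L]
variable {ι κ : Type*} {p : ι → Prop} {B : ι → Submodule k L}

/-! All spaces here are linearly topologized, so every assertion is tested modulo one open ideal at
a time, where functions become step functions. Modulo an open ideal `I`, a continuous function is
constant on the fibres of a discrete partition of `X`; paracompactness and the clopen basis supply a
partition into compact open sets (`exists_properQuotient`), with which any partition can be
intersected. A map `C(X, k) → k / Q` that kills an open submodule is concentrated on a compact set
(`homMod_exists_valuesIn_le`), so it sees finitely many fibres of any partition, and on functions
constant modulo `Q` on the fibres it is determined by the characteristic functions of the fibres.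
Density, the injectivity of the passage to set functions and the bases of open submodules of the
weak duals come from this.

The weak dual is built from completions, yet contains only continuous functionals. A point of it has
a value at each vector, hence defines a linear functional, which on every null set agrees modulo `Q`
with a map killed by an open submodule. For `C(X, k)` a gliding hump argument makes such a
functional continuous (`exists_isOpen_le_comap_of_isApproximable`); for `CAcs X k` continuity is
immediate, since every admissible map modulo `Q` kills all functions with values in `Q`.

Conversely, a set function is integrated by Riemann sums (`IsAcsMeasure.exists_integral`).
Unconditional additivity forces the measure to be concentrated, modulo `I`, on a compact set
(`IsAcsMeasure.exists_compact`), whence continuity. A finitely additive function on compact open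
sets becomes unconditionally additive after intersection with one compact open set, and the pieces
are summed over a partition (`exists_hasSum_dMeas`). Uniform measures are treated radius by radius,
as measures on discrete spaces.

For the naive canonical topology one has to write a measure with values in an open ideal `(a₁, …,
aᵣ)` as `∑ aᵢ νᵢ`. On a compact open set this is a lifting problem for additive maps on the group of
locally constant integral functions, which is free (`exists_division`). The local solutions are then
summed over a partition. On `C(X, k)` the sum converges only if the `νᵢ` tend to zero, which is
arranged by dividing as sharply as possible along a countable basis of ideals
(`exists_division_uniform`); openness of products of open ideals enters here.

For the coproduct, modulo `J` and on functions constant on the members `e i` of a partition, `μ` is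
the combination `∑ μ(e i) δ i` of Dirac measures, so its coproduct must be `∑ μ(e i) δ i ⊗ δ i`.
Tensors modulo the corresponding annihilator are separated by their values on pairs `(e i, e j)`
(`CoproductChart.tensorMk_eq_zero`). This gives independence of choices, linearity, continuity and
both uniqueness statements, for the three weak spaces at once. -/

theorem IsBasisOfOpenSubmodules.isOpen_iff (h : IsBasisOfOpenSubmodules p B)
    {P : Submodule k L} : IsOpen (P : Set L) ↔ ∃ i, p i ∧ B i ≤ P := by
  constructor
  · intro hP
    obtain ⟨i, hi, h'⟩ := (h.2 0).mem_iff.1 (hP.mem_nhds P.zero_mem)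
    exact ⟨i, hi, fun x hx => h' (by simpa using hx)⟩
  · rintro ⟨i, hi, h'⟩
    rw [isOpen_iff_mem_nhds]
    intro x hx
    refine (h.2 x).mem_iff.2 ⟨i, hi, fun y hy => ?_⟩
    have := P.add_mem (h' hy) hx
    rwa [sub_add_cancel] at this

theorem IsBasisOfOpenSubmodules.reindex (h : IsBasisOfOpenSubmodules p B) {q : κ → Prop}
    {C : κ → Submodule k L} (h₁ : ∀ i, p i → ∃ j, q j ∧ C j ≤ B i)
    (h₂ : ∀ j, q j → ∃ i, p i ∧ B i ≤ C j) : IsBasisOfOpenSubmodules q C :=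
  ⟨fun j hj => h.isOpen_iff.2 (h₂ j hj), fun x => (h.2 x).to_hasBasis
    (fun i hi => (h₁ i hi).imp fun _ hj => ⟨hj.1, fun _ hy => hj.2 hy⟩)
    (fun j hj => (h₂ j hj).imp fun _ hi => ⟨hi.1, fun _ hy => hi.2 hy⟩)⟩

theorem IsBasisOfOpenSubmodules.continuous {L' : Type*} [AddCommGroup L'] [Module k L']
    [TopologicalSpace L'] {q : κ → Prop} {C : κ → Submodule k L'}
    (h : IsBasisOfOpenSubmodules p B) (h' : IsBasisOfOpenSubmodules q C) (u : L →ₗ[k] L')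
    (hu : ∀ j, q j → ∃ i, p i ∧ B i ≤ (C j).comap u) : Continuous u := by
  rw [continuous_iff_continuousAt]
  intro x
  refine ((h.2 x).tendsto_iff (h'.2 (u x))).2 fun j hj => ?_
  obtain ⟨i, hi, hB⟩ := hu j hj
  refine ⟨i, hi, fun y hy => ?_⟩
  have := hB hy
  simpa using this

theorem IsBasisOfOpenSubmodules.exists_le {L' : Type*} [AddCommGroup L'] [Module k L']
    [TopologicalSpace L'] {q : κ → Prop} {C : κ → Submodule k L'}
    (h : IsBasisOfOpenSubmodules p B) (h' : IsBasisOfOpenSubmodules q C) {u : L →ₗ[k] L'}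
    (hu : Continuous u) {j : κ} (hj : q j) : ∃ i, p i ∧ B i ≤ (C j).comap u :=
  h.isOpen_iff.1 ((h'.1 j hj).preimage hu)

/-- No compatibility of the topology with addition is assumed. Under a map to a discrete module the
neighbourhood filter of `μ` is principal on a coset of the kernel, and an infimum of principal
filters over a directed family has these cosets as a basis. -/
theorem isBasisOfOpenSubmodules_of_eq_iInf {T : ι → Type*} [∀ i, AddCommGroup (T i)]
    [∀ i, Module k (T i)] [Nonempty ι] (u : ∀ i, L →ₗ[k] T i)
    (ht : ‹TopologicalSpace L› = ⨅ i, TopologicalSpace.induced (u i) ⊥)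
    (hd : ∀ i j, ∃ l, LinearMap.ker (u l) ≤ LinearMap.ker (u i) ⊓ LinearMap.ker (u j)) :
    IsBasisOfOpenSubmodules (fun _ : ι => True) (fun i => LinearMap.ker (u i)) := by
  have hb : ∀ μ : L, (𝓝 μ).HasBasis (fun _ : ι => True)
      (fun i => {ν | ν - μ ∈ LinearMap.ker (u i)}) := by
    intro μ
    have e : 𝓝 μ = ⨅ i, Filter.principal {ν | ν - μ ∈ LinearMap.ker (u i)} := by
      rw [ht, nhds_iInf]
      refine iInf_congr fun i => ?_
      let : TopologicalSpace (T i) := ⊥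
      have : DiscreteTopology (T i) := ⟨rfl⟩
      rw [nhds_induced, nhds_discrete, Filter.comap_pure]
      congr 1
      ext ν
      simp [sub_eq_zero]
    rw [e]
    refine Filter.hasBasis_iInf_principal fun i j => ?_
    obtain ⟨l, hl⟩ := hd i j
    exact ⟨l, fun _ hy => (hl hy).1, fun _ hy => (hl hy).2⟩
  refine ⟨fun i _ => ?_, hb⟩
  rw [isOpen_iff_mem_nhds]
  intro x hx
  refine (hb x).mem_iff.2 ⟨i, trivial, fun y hy => ?_⟩
  have := (LinearMap.ker (u i)).add_mem hy hx
  rwa [sub_add_cancel] at this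

theorem isBasisOfOpenSubmodules_linearTopology {S : Set (Submodule k L)}
    (ht : ‹TopologicalSpace L› = linearTopology S) (hS : S.Nonempty)
    (hd : ∀ N ∈ S, ∀ N' ∈ S, ∃ N'' ∈ S, N'' ≤ N ⊓ N') :
    IsBasisOfOpenSubmodules (fun N : Submodule k L => N ∈ S) (fun N => N) := by
  have : Nonempty S := hS.to_subtype
  have h := isBasisOfOpenSubmodules_of_eq_iInf (ι := S) (fun N => N.1.mkQ)
    (by rw [ht, linearTopology, iInf_subtype']) (fun N N' => by
      obtain ⟨N'', h, h'⟩ := hd N.1 N.2 N'.1 N'.2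
      exact ⟨⟨N'', h⟩, by simpa using h'⟩)
  refine h.reindex (fun N _ => ⟨N.1, N.2, by simp⟩) (fun N hN => ⟨⟨N, hN⟩, trivial, by simp⟩)

end Basis

/-! ### The base ring -/

section Base

variable {k : Type*} [CommRing k] [UniformSpace k] [IsUniformAddGroup k] [IsTopologicalRing k]
  [BaseRing k]

variable (k) in
theorem isBasisOfOpenSubmodules_self :
    IsBasisOfOpenSubmodules (L := k) (fun I : Ideal k => IsOpen (I : Set k)) (fun I => I) := by
  refine ⟨fun _ h => h, fun x => ?_⟩
  have h := (BaseRing.linear (k := k)).comap (fun y => y - x)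
  have e : Filter.comap (fun y => y - x) (𝓝 0) = 𝓝 x := by
    have := (Homeomorph.subRight x).nhds_eq_comap x
    simpa using this.symm
  rw [e] at h
  exact h

theorem isClosed_of_isOpen_ideal {I : Ideal k} (hI : IsOpen (I : Set k)) :
    IsClosed (I : Set k) :=
  AddSubgroup.isClosed_of_isOpen I.toAddSubgroup hI

theorem eq_of_forall_sub_mem {a b : k}
    (h : ∀ I : Ideal k, IsOpen (I : Set k) → a - b ∈ I) : a = b := by
  have := BaseRing.separated (k := k)
  by_contra hab
  have : {x : k | x ≠ a - b} ∈ 𝓝 (0 : k) :=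
    isOpen_ne.mem_nhds (fun h => hab (sub_eq_zero.1 h.symm))
  obtain ⟨I, hI, h'⟩ := (BaseRing.linear (k := k)).mem_iff.1 this
  exact h' (h I hI) rfl

theorem isOpen_inf {I J : Ideal k} (hI : IsOpen (I : Set k)) (hJ : IsOpen (J : Set k)) :
    IsOpen ((I ⊓ J : Ideal k) : Set k) := hI.inter hJ

theorem isOpen_of_le {I J : Ideal k} (hI : IsOpen (I : Set k)) (h : I ≤ J) :
    IsOpen (J : Set k) := (isBasisOfOpenSubmodules_self k).isOpen_iff.2 ⟨I, hI, h⟩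

theorem isOpen_top_ideal : IsOpen ((⊤ : Ideal k) : Set k) := by simp

/-- Completeness of `k`, as surjectivity of `k → lim k / I`: the representatives form a Cauchy net
indexed by the open ideals under reverse inclusion, and open ideals are closed, so the congruences
pass to the limit. -/
theorem exists_sub_mem_of_compatible (a : ∀ I : Ideal k, IsOpen (I : Set k) → k)
    (h : ∀ (I J : Ideal k) (hI : IsOpen (I : Set k)) (hJ : IsOpen (J : Set k)), I ≤ J →
      a I hI - a J hJ ∈ J) :
    ∃ x : k, ∀ (I : Ideal k) (hI : IsOpen (I : Set k)), x - a I hI ∈ I := by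
  have := BaseRing.complete (k := k)
  let ι := {I : Ideal k // IsOpen (I : Set k)}ᵒᵈ
  have : Nonempty ι := ⟨OrderDual.toDual ⟨⊤, isOpen_top_ideal⟩⟩
  have : IsDirectedOrder ι := ⟨fun I J => ⟨OrderDual.toDual ⟨(OrderDual.ofDual I).1 ⊓
    (OrderDual.ofDual J).1, isOpen_inf (OrderDual.ofDual I).2 (OrderDual.ofDual J).2⟩,
    inf_le_left (a := (OrderDual.ofDual I).1), inf_le_right (a := (OrderDual.ofDual I).1)⟩⟩
  let s : ι → k := fun I => a (OrderDual.ofDual I).1 (OrderDual.ofDual I).2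
  have hs : CauchySeq s := by
    refine cauchy_map_iff'.2 fun V hV => ?_
    rw [uniformity_eq_comap_nhds_zero] at hV
    obtain ⟨I, hI, h'⟩ := (((BaseRing.linear (k := k)).comap
      (fun x : k × k => x.2 - x.1)).mem_iff).1 hV
    have he := Filter.eventually_ge_atTop (OrderDual.toDual ⟨I, hI⟩ : ι)
    rw [Filter.mem_map]
    filter_upwards [he.prod_mk he] with ⟨J, J'⟩ hJ
    obtain ⟨hJ, hJ'⟩ := hJ
    refine h' ?_
    have h1 := h _ _ (OrderDual.ofDual J).2 hI hJ
    have h2 := h _ _ (OrderDual.ofDual J').2 hI hJ'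
    have := I.sub_mem h2 h1
    rwa [sub_sub_sub_cancel_right] at this
  obtain ⟨x, hx⟩ := cauchySeq_tendsto_of_complete hs
  refine ⟨x, fun I hI => ?_⟩
  have hc : Filter.Tendsto (fun J => s J - a I hI) Filter.atTop (𝓝 (x - a I hI)) :=
    hx.sub tendsto_const_nhds
  refine (isClosed_of_isOpen_ideal hI).mem_of_tendsto hc ?_
  filter_upwards [Filter.eventually_ge_atTop (OrderDual.toDual ⟨I, hI⟩ : ι)] with J hJ
  exact h _ _ (OrderDual.ofDual J).2 hI hJ

/-- A linear functional is given by a compatible system of approximate values: `R I m a` says that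
`a` is a value at `m` modulo `I`. -/
theorem exists_linearMap_of_approx {M : Type*} [AddCommGroup M] [Module k M]
    (R : Ideal k → M → k → Prop)
    (ex : ∀ I : Ideal k, IsOpen (I : Set k) → ∀ m, ∃ a, R I m a)
    (mono : ∀ {I J : Ideal k}, IsOpen (I : Set k) → I ≤ J → ∀ {m a}, R I m a → R J m a)
    (add : ∀ {I : Ideal k}, IsOpen (I : Set k) → ∀ {m m' a a'},
      R I m a → R I m' a' → R I (m + m') (a + a'))
    (smul : ∀ {I : Ideal k}, IsOpen (I : Set k) → ∀ (c : k) {m a}, R I m a → R I (c • m) (c * a))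
    (zero : ∀ {I : Ideal k}, IsOpen (I : Set k) → ∀ {a}, R I 0 a → a ∈ I) :
    ∃ φ : M →ₗ[k] k, ∀ {I : Ideal k}, IsOpen (I : Set k) → ∀ {m a}, R I m a → φ m - a ∈ I := by
  -- The difference of two values at `m` is a value at `0`, hence lies in `I`.
  have uniq : ∀ {I : Ideal k}, IsOpen (I : Set k) → ∀ {m a a'}, R I m a → R I m a' →
      a - a' ∈ I := by
    intro I hI m a a' h h'
    have := add hI h (smul hI (-1) h')
    rw [neg_smul, one_smul, add_neg_cancel] at this
    have := zero hI this
    rwa [neg_one_mul, ← sub_eq_add_neg] at this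
  choose a ha using ex
  have key : ∀ m, ∃ x : k, ∀ (I : Ideal k) (hI : IsOpen (I : Set k)), x - a I hI m ∈ I := fun m =>
    exists_sub_mem_of_compatible (fun I hI => a I hI m) fun I J hI hJ hIJ =>
      uniq hJ (mono hI hIJ (ha I hI m)) (ha J hJ m)
  choose φ hφ using key
  have hφ' : ∀ {I : Ideal k}, IsOpen (I : Set k) → ∀ {m b}, R I m b → φ m - b ∈ I := by
    intro I hI m b hb
    have := I.add_mem (hφ m I hI) (uniq hI (ha I hI m) hb)
    rwa [sub_add_sub_cancel] at this
  refine ⟨⟨⟨φ, fun m m' => ?_⟩, fun c m => ?_⟩, fun hI _ _ h => hφ' hI h⟩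
  · refine eq_of_forall_sub_mem fun I hI => ?_
    have h1 := hφ' hI (add hI (ha I hI m) (ha I hI m'))
    have h2 := I.add_mem (hφ m I hI) (hφ m' I hI)
    have := I.sub_mem h1 h2
    convert this using 1
    ring
  · refine eq_of_forall_sub_mem fun I hI => ?_
    have h1 := hφ' hI (smul hI c (ha I hI m))
    have h2 := I.mul_mem_left c (hφ m I hI)
    have := I.sub_mem h1 h2
    convert this using 1
    simp only [RingHom.id_apply, smul_eq_mul]
    ring

variable (k) in
theorem nonarchimedeanAddGroup : NonarchimedeanAddGroup k where
  is_nonarchimedean U hU := by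
    obtain ⟨I, hI, h⟩ := (BaseRing.linear (k := k)).mem_iff.1 hU
    exact ⟨⟨I.toAddSubgroup, hI⟩, h⟩

/-- In a complete nonarchimedean group, tending to zero along the cofinite filter suffices for
summability. -/
theorem summable_of_finite {ι : Type*} {f : ι → k}
    (h : ∀ I : Ideal k, IsOpen (I : Set k) → {i | f i ∉ I}.Finite) : Summable f := by
  have := BaseRing.complete (k := k)
  have := nonarchimedeanAddGroup k
  refine NonarchimedeanAddGroup.summable_of_tendsto_cofinite_zero ?_
  rw [(BaseRing.linear (k := k)).tendsto_right_iff]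
  exact fun I hI => h I hI

theorem finite_of_summable {ι : Type*} {f : ι → k} (h : Summable f) {I : Ideal k}
    (hI : IsOpen (I : Set k)) : {i | f i ∉ I}.Finite := by
  have := h.tendsto_cofinite_zero
  rw [(BaseRing.linear (k := k)).tendsto_right_iff] at this
  exact this I hI

theorem hasSum_mem {ι : Type*} {f : ι → k} {a : k} (h : HasSum f a) {I : Ideal k}
    (hI : IsOpen (I : Set k)) (hf : ∀ i, f i ∈ I) : a ∈ I :=
  (isClosed_of_isOpen_ideal hI).mem_of_tendsto h
    (Filter.Eventually.of_forall fun _ => I.sum_mem fun i _ => hf i)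

theorem tsum_mem {ι : Type*} {f : ι → k} {I : Ideal k}
    (hI : IsOpen (I : Set k)) (hf : ∀ i, f i ∈ I) : ∑' i, f i ∈ I := by
  by_cases h : Summable f
  · exact hasSum_mem h.hasSum hI hf
  -- A family that is not summable has sum `0` by convention, which lies in `I`.
  · rw [tsum_eq_zero_of_not_summable h]
    exact I.zero_mem

end Base

/-! ### Weak and strong duals of linearly topologized modules -/

section Duals

variable {k : Type*} [CommRing k] [UniformSpace k] [IsUniformAddGroup k] [IsTopologicalRing k]
  [BaseRing k]
variable {M : Type*} [AddCommGroup M] [Module k M] [TopologicalSpace M]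
variable {N : Type*} [AddCommGroup N] [Module k N] [TopologicalSpace N]

variable (k M) in
/-- The open submodules form a basis of open submodules. -/
def IsLinearlyTopologized : Prop :=
  IsBasisOfOpenSubmodules (fun P : Submodule k M => IsOpen (P : Set M)) (fun P => P)

theorem IsBasisOfOpenSubmodules.isLinearlyTopologized {ι : Type*} {p : ι → Prop}
    {B : ι → Submodule k M} (h : IsBasisOfOpenSubmodules p B) : IsLinearlyTopologized k M :=
  h.reindex (fun i hi => ⟨B i, h.1 i hi, le_rfl⟩) (fun _ hP => h.isOpen_iff.1 hP)

theorem IsLinearlyTopologized.continuous (hM : IsLinearlyTopologized k M) (φ : M →ₗ[k] k)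
    (h : ∀ I : Ideal k, IsOpen (I : Set k) →
      ∃ P : Submodule k M, IsOpen (P : Set M) ∧ P ≤ Submodule.comap φ I) : Continuous φ :=
  IsBasisOfOpenSubmodules.continuous hM (isBasisOfOpenSubmodules_self k) φ h

variable (k) in
/-- A set which is almost contained in every open submodule. -/
def IsNullSet (S : Set M) : Prop :=
  ∀ P : Submodule k M, IsOpen (P : Set M) → (S \ P).Finite

theorem IsNullSet.of_finite {S : Set M} (h : S.Finite) : IsNullSet k S :=
  fun _ _ => h.subset Set.sdiff_subset

theorem mk_smul_eq_zero {Q : Ideal k} {r : k} (hr : r ∈ Q) (x : k ⧸ Q) : r • x = 0 := by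
  obtain ⟨y, rfl⟩ := Submodule.mkQ_surjective Q x
  rw [← map_smul, Submodule.mkQ_apply, Submodule.Quotient.mk_eq_zero]
  exact Ideal.mul_mem_right y Q hr

theorem mkQ_eq_mkQ {Q : Ideal k} {a b : k} :
    Submodule.mkQ Q a = Submodule.mkQ Q b ↔ a - b ∈ Q := by
  rw [Submodule.mkQ_apply, Submodule.mkQ_apply, Submodule.Quotient.eq]

/-- The maps that vanish on a null set form an open submodule for the weak topology. -/
def nullOpen (Q : OpenSub k k) {S : Set M} (hS : IsNullSet k S) : weakOpen k M (k ⧸ Q.1) :=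
  ⟨{ carrier := {φ | ∀ m ∈ S, φ.1 m = 0}
     zero_mem' := fun _ _ => rfl
     add_mem' := fun {φ ψ} hφ hψ m hm => by
       have : φ.1 m + ψ.1 m = 0 := by rw [hφ m hm, hψ m hm, add_zero]
       exact this
     smul_mem' := fun c φ hφ m hm => by
       have : c • φ.1 m = 0 := by rw [hφ m hm, smul_zero]
       exact this }, by
    -- A map killed by `P` has to be tested only on the finite set `S \ P`; the ideal can be `Q`
    -- itself, which annihilates `k / Q`.
    refine ⟨fun P hP => ⟨(hS P hP).toFinset, fun φ hφ hF m hm => ?_⟩, Q.1, Q.2, ?_⟩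
    · by_cases h : m ∈ P
      · exact LinearMap.mem_ker.1 (hφ h)
      · exact hF m (by simp [hm, h])
    · rw [Submodule.smul_le]
      exact fun r hr φ _ m _ => mk_smul_eq_zero hr (φ.1 m)⟩

/-- The intersection of two open submodules. -/
def weakInf {Q : OpenSub k k} (W W' : weakOpen k M (k ⧸ Q.1)) : weakOpen k M (k ⧸ Q.1) :=
  ⟨W.1 ⊓ W'.1, by
    classical
    refine ⟨fun P hP => ?_, ?_⟩
    · obtain ⟨F, hF⟩ := W.2.1 P hP
      obtain ⟨F', hF'⟩ := W'.2.1 P hP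
      exact ⟨F ∪ F', fun φ hφ h => ⟨hF φ hφ fun m hm => h m (Finset.mem_union_left _ hm),
        hF' φ hφ fun m hm => h m (Finset.mem_union_right _ hm)⟩⟩
    · obtain ⟨I, hI, h⟩ := W.2.2
      obtain ⟨I', hI', h'⟩ := W'.2.2
      exact ⟨I ⊓ I', isOpen_inf hI hI', le_inf
        ((Submodule.smul_mono_left inf_le_left).trans h)
        ((Submodule.smul_mono_left inf_le_right).trans h')⟩⟩

theorem smul_top_le_comap {A B : Type*} [AddCommGroup A] [Module k A] [AddCommGroup B]
    [Module k B] (u : A →ₗ[k] B) {I : Ideal k} {W : Submodule k B} (h : I • ⊤ ≤ W) :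
    I • (⊤ : Submodule k A) ≤ W.comap u := by
  rw [← Submodule.map_le_iff_le_comap, Submodule.map_smul'']
  exact (Submodule.smul_mono le_rfl le_top).trans h

/-- The inverse image of an open submodule under reduction to a smaller quotient of `k`. -/
def weakComap {Q Q' : OpenSub k k} (h : Q.1 ≤ Q'.1) (W : weakOpen k M (k ⧸ Q'.1)) :
    weakOpen k M (k ⧸ Q.1) :=
  ⟨W.1.comap (HomMod.map M (Submodule.factor h)), by
    refine ⟨fun P hP => ?_, ?_⟩
    · obtain ⟨F, hF⟩ := W.2.1 P hP
      refine ⟨F, fun φ hφ h' => hF _ (fun m hm => ?_) fun m hm => ?_⟩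
      · rw [LinearMap.mem_ker]
        exact (congrArg (Submodule.factor h) (LinearMap.mem_ker.1 (hφ hm))).trans (map_zero _)
      · exact (congrArg (Submodule.factor h) (h' m hm)).trans (map_zero _)
    · obtain ⟨I, hI, h'⟩ := W.2.2
      exact ⟨I, hI, smul_top_le_comap _ h'⟩⟩

/-- Reduction of functionals modulo `Q`. -/
def wkReduce (Q : OpenSub k k) : WkDual k M →ₗ[k] HomMod k M (k ⧸ Q.1) := reduceMod Q

/-- Reduction of functionals modulo `Q`. -/
def stReduce (Q : OpenSub k k) : StDual k M →ₗ[k] HomMod k M (k ⧸ Q.1) := reduceMod Q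

theorem WkDual.ext {μ ν : WkDual k M} (h : ∀ m, WkDual.eval m μ = WkDual.eval m ν) : μ = ν :=
  ContinuousLinearMap.ext h

theorem StDual.ext {μ ν : StDual k M} (h : ∀ m, StDual.eval m μ = StDual.eval m ν) : μ = ν :=
  ContinuousLinearMap.ext h

variable (k M) in
theorem isBasisOfOpenSubmodules_wkDual :
    IsBasisOfOpenSubmodules (L := WkDual k M)
      (fun _ : (Q : OpenSub k k) × weakOpen k M (k ⧸ Q.1) => True)
      (fun i => i.2.1.comap (wkReduce i.1)) := by
  have : Nonempty ((Q : OpenSub k k) × weakOpen k M (k ⧸ Q.1)) :=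
    ⟨⟨⟨⊤, isOpen_top_ideal⟩, nullOpen _ (IsNullSet.of_finite Set.finite_empty)⟩⟩
  have h := isBasisOfOpenSubmodules_of_eq_iInf (L := WkDual k M)
    (ι := (Q : OpenSub k k) × weakOpen k M (k ⧸ Q.1))
    (fun i => (WeakQuot.mk k M i.2) ∘ₗ (wkReduce i.1)) ?_ ?_
  · refine h.reindex (fun i _ => ⟨i, trivial, fun μ hμ => ?_⟩)
      (fun i _ => ⟨i, trivial, fun μ hμ => ?_⟩)
    · exact (Submodule.Quotient.mk_eq_zero _).2 hμ
    · exact (Submodule.Quotient.mk_eq_zero i.2.1).1 hμ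
  · change TopologicalSpace.induced _ (⨅ (Q : OpenSub k k) (W : weakOpen k M (k ⧸ Q.1)), _) = _
    rw [iInf_sigma, induced_iInf]
    refine iInf_congr fun Q => ?_
    rw [induced_iInf]
    refine iInf_congr fun W => ?_
    rw [induced_compose]
    rfl
  · rintro ⟨Q, W⟩ ⟨Q', W'⟩
    -- The common refinement lives over `Q ⊓ Q'`, where both open submodules are pulled back along
    -- the reductions and intersected.
    refine ⟨⟨⟨Q.1 ⊓ Q'.1, isOpen_inf Q.2 Q'.2⟩, weakInf (weakComap inf_le_left W)
      (weakComap inf_le_right W')⟩, fun μ hμ => ?_⟩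
    have := (Submodule.Quotient.mk_eq_zero _).1 hμ
    exact ⟨(Submodule.Quotient.mk_eq_zero _).2 this.1, (Submodule.Quotient.mk_eq_zero _).2 this.2⟩

/-- The transpose on maps modulo `Q`. -/
def homTranspose (T : M →L[k] N) (Q : OpenSub k k) :
    HomMod k N (k ⧸ Q.1) →ₗ[k] HomMod k M (k ⧸ Q.1) where
  toFun φ := ⟨φ.1 ∘ₗ (T : M →ₗ[k] N), by
    obtain ⟨P, hP, h⟩ := φ.2
    exact ⟨P.comap (T : M →ₗ[k] N), hP.preimage T.continuous, fun x hx => h hx⟩⟩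
  map_add' _ _ := rfl
  map_smul' _ _ := rfl

/-- Weakly open submodules pull back along transposition: a finite test set `F` for the submodule
`T⁻¹ P` of `M` yields the test set `T F` for the submodule `P` of `N`. -/
theorem wkDual_continuous_transpose (T : M →L[k] N) : Continuous (WkDual.transpose (k := k) T) := by
  classical
  refine (isBasisOfOpenSubmodules_wkDual k N).continuous (isBasisOfOpenSubmodules_wkDual k M) _ ?_
  rintro ⟨Q, W⟩ -
  refine ⟨⟨Q, W.1.comap (homTranspose T Q), fun P hP => ?_, ?_⟩, trivial, fun μ hμ => hμ⟩
  · obtain ⟨F, hF⟩ := W.2.1 (P.comap (T : M →ₗ[k] N)) (hP.preimage T.continuous)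
    exact ⟨F.image T, fun φ hφ h => hF _ (fun x hx => hφ hx)
      fun m hm => h _ (Finset.mem_image_of_mem _ hm)⟩
  · obtain ⟨I, hI, h⟩ := W.2.2
    exact ⟨I, hI, smul_top_le_comap _ h⟩

/-! ### Points of the weak dual as functionals. -/

/-- A linear functional has finite approximations on null sets if, modulo each open ideal `Q` and on
each null set, it agrees with a map that vanishes on an open submodule. -/
def IsApproximable (φ : M →ₗ[k] k) : Prop :=
  ∀ (Q : OpenSub k k) (S : Set M), IsNullSet k S →
    ∃ ψ : HomMod k M (k ⧸ Q.1), ∀ m ∈ S, ψ.1 m = Submodule.mkQ Q.1 (φ m)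

theorem weakHomLim_mono (x : WeakHomLim k M k) {Q Q' : OpenSub k k} (h : Q.1 ≤ Q'.1)
    {W : weakOpen k M (k ⧸ Q.1)} {W' : weakOpen k M (k ⧸ Q'.1)}
    (hW : W.1 ≤ W'.1.comap (HomMod.map M (Submodule.factor h))) {ψ : HomMod k M (k ⧸ Q.1)}
    (hψ : x.1 Q W = WeakQuot.mk k M W ψ) :
    x.1 Q' W' = WeakQuot.mk k M W' (HomMod.map M (Submodule.factor h) ψ) := by
  rw [← x.2 Q Q' h W W' hW, hψ]
  rfl

/-- The compatibility condition for two equal ideals: the reduction map is then the identity, and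
what remains compares two open submodules over the same ideal. -/
theorem weakHomLim_mono' (x : WeakHomLim k M k) {Q : OpenSub k k}
    {W W' : weakOpen k M (k ⧸ Q.1)} (hW : W.1 ≤ W'.1) {ψ : HomMod k M (k ⧸ Q.1)}
    (hψ : x.1 Q W = WeakQuot.mk k M W ψ) : x.1 Q W' = WeakQuot.mk k M W' ψ := by
  have e : ∀ φ : HomMod k M (k ⧸ Q.1), HomMod.map M (Submodule.factor (le_refl Q.1)) φ = φ := by
    intro φ
    apply Subtype.ext
    ext m
    change Submodule.factor (le_refl Q.1) (φ.1 m) = φ.1 m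
    obtain ⟨y, hy⟩ := Submodule.mkQ_surjective Q.1 (φ.1 m)
    rw [← hy]
    rfl
  rw [weakHomLim_mono x (le_refl Q.1) (fun φ hφ => by
    rw [Submodule.mem_comap, e]; exact hW hφ) hψ, e]

theorem weakQuot_mk_eq {Q : OpenSub k k} {W : weakOpen k M (k ⧸ Q.1)}
    {φ ψ : HomMod k M (k ⧸ Q.1)} : WeakQuot.mk k M W φ = WeakQuot.mk k M W ψ ↔ φ - ψ ∈ W.1 :=
  Submodule.Quotient.eq _

theorem homMod_eq_of_sub_mem {Q : OpenSub k k} {φ ψ : HomMod k M (k ⧸ Q.1)} {W : Submodule k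
    (HomMod k M (k ⧸ Q.1))} (h : φ - ψ ∈ W) {m : M} (hW : ∀ θ ∈ W, θ.1 m = 0) :
    φ.1 m = ψ.1 m := by
  have : φ.1 m - ψ.1 m = 0 := hW _ h
  exact sub_eq_zero.1 this

theorem weakQuot_mk_surjective {Q : OpenSub k k} (W : weakOpen k M (k ⧸ Q.1)) :
    Function.Surjective (WeakQuot.mk k M W) := Submodule.mkQ_surjective _

/-- `a` is the value at `m`, modulo `Q`, of the point `x` of the weak dual. -/
def IsWeakValue (x : WeakHomLim k M k) (Q : OpenSub k k) (m : M) (a : k) : Prop :=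
  ∃ (W : weakOpen k M (k ⧸ Q.1)) (ψ : HomMod k M (k ⧸ Q.1)),
    x.1 Q W = WeakQuot.mk k M W ψ ∧ (∀ θ ∈ W.1, θ.1 m = 0) ∧ ψ.1 m = Submodule.mkQ Q.1 a

theorem isNullSet_singleton (m : M) : IsNullSet k {m} := IsNullSet.of_finite (Set.finite_singleton m)

theorem isWeakValue_exists (x : WeakHomLim k M k) (Q : OpenSub k k) (m : M) :
    ∃ a, IsWeakValue x Q m a := by
  obtain ⟨ψ, hψ⟩ := weakQuot_mk_surjective _ (x.1 Q (nullOpen Q (isNullSet_singleton m)))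
  obtain ⟨a, ha⟩ := Submodule.mkQ_surjective Q.1 (ψ.1 m)
  exact ⟨a, nullOpen Q (isNullSet_singleton m), ψ, hψ.symm, fun θ hθ => hθ m rfl, ha.symm⟩

theorem IsWeakValue.mono {x : WeakHomLim k M k} {Q Q' : OpenSub k k} (h : Q.1 ≤ Q'.1) {m : M} {a : k}
    (hx : IsWeakValue x Q m a) : IsWeakValue x Q' m a := by
  obtain ⟨W, ψ, hψ, hm, ha⟩ := hx
  refine ⟨nullOpen Q' (isNullSet_singleton m), HomMod.map M (Submodule.factor h) ψ,
    weakHomLim_mono x h (W := W) ?_ hψ, fun θ hθ => hθ m rfl, ?_⟩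
  · rintro θ hθ m' rfl
    exact (congrArg (Submodule.factor h) (hm θ hθ)).trans (map_zero _)
  · exact (congrArg (Submodule.factor h) ha).trans rfl

theorem IsWeakValue.add {x : WeakHomLim k M k} {Q : OpenSub k k} {m m' : M} {a a' : k}
    (h : IsWeakValue x Q m a) (h' : IsWeakValue x Q m' a') :
    IsWeakValue x Q (m + m') (a + a') := by
  obtain ⟨W, ψ, hψ, hm, ha⟩ := h
  obtain ⟨W', ψ', hψ', hm', ha'⟩ := h'
  -- One representative modulo the intersection serves both vectors: it has the value of `ψ` at `m`
  -- and that of `ψ'` at `m'`.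
  obtain ⟨θ, hθ⟩ := weakQuot_mk_surjective _ (x.1 Q (weakInf W W'))
  refine ⟨weakInf W W', θ, hθ.symm, fun η hη => ?_, ?_⟩
  · rw [map_add, hm _ hη.1, hm' _ hη.2, add_zero]
  · have h1 := weakHomLim_mono' x (W' := W) inf_le_left hθ.symm
    have h2 := weakHomLim_mono' x (W' := W') inf_le_right hθ.symm
    rw [map_add, map_add, ← ha, ← ha', homMod_eq_of_sub_mem (weakQuot_mk_eq.1 (h1.symm.trans hψ)) hm,
      homMod_eq_of_sub_mem (weakQuot_mk_eq.1 (h2.symm.trans hψ')) hm']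

theorem IsWeakValue.smul {x : WeakHomLim k M k} {Q : OpenSub k k} (c : k) {m : M} {a : k}
    (h : IsWeakValue x Q m a) : IsWeakValue x Q (c • m) (c * a) := by
  obtain ⟨W, ψ, hψ, hm, ha⟩ := h
  refine ⟨W, ψ, hψ, fun θ hθ => ?_, ?_⟩
  · rw [map_smul, hm _ hθ, smul_zero]
  · rw [map_smul, ha, ← map_smul, smul_eq_mul]

/-- A point of the completed limit still has a value at each vector `m`, since the maps that vanish
at `m` form an open submodule. Continuity of the resulting functional is a separate matter. -/
theorem weakHomLim_exists_functional (x : WeakHomLim k M k) :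
    ∃ φ : M →ₗ[k] k, ∀ (Q : OpenSub k k) (W : weakOpen k M (k ⧸ Q.1)) (ψ : HomMod k M (k ⧸ Q.1)),
      x.1 Q W = WeakQuot.mk k M W ψ → ∀ m, (∀ θ ∈ W.1, θ.1 m = 0) →
        ψ.1 m = Submodule.mkQ Q.1 (φ m) := by
  obtain ⟨φ, hφ⟩ : ∃ φ : M →ₗ[k] k, ∀ {I : Ideal k}, IsOpen (I : Set k) → ∀ {m a},
      (∃ hI : IsOpen (I : Set k), IsWeakValue x ⟨I, hI⟩ m a) → φ m - a ∈ I := by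
    refine exists_linearMap_of_approx (fun (I : Ideal k) m a =>
      ∃ hI : IsOpen (I : Set k), IsWeakValue x ⟨I, hI⟩ m a) ?_ ?_ ?_ ?_ ?_
    · intro I hI m
      obtain ⟨a, ha⟩ := isWeakValue_exists x ⟨I, hI⟩ m
      exact ⟨a, hI, ha⟩
    · rintro I J hI hIJ m a ⟨_, h⟩
      exact ⟨isOpen_of_le hI hIJ, h.mono hIJ⟩
    · rintro I hI m m' a a' ⟨_, h⟩ ⟨_, h'⟩
      exact ⟨hI, h.add h'⟩
    · rintro I hI c m a ⟨_, h⟩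
      exact ⟨hI, h.smul c⟩
    · rintro I hI a ⟨_, W, ψ, hψ, hm, ha⟩
      rw [map_zero] at ha
      exact (Submodule.Quotient.mk_eq_zero _).1 ha.symm
  refine ⟨φ, fun Q W ψ hψ m hm => ?_⟩
  obtain ⟨a, ha⟩ := Submodule.mkQ_surjective Q.1 (ψ.1 m)
  have := hφ Q.2 ⟨Q.2, W, ψ, hψ, hm, ha.symm⟩
  rw [← ha]
  exact (mkQ_eq_mkQ.2 this).symm

theorem wkDual_toLim_injective : Function.Injective (WkDual.toLim k M) := by
  rw [injective_iff_map_eq_zero]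
  intro μ hμ
  refine WkDual.ext fun m => eq_of_forall_sub_mem fun I hI => ?_
  have h := congrFun (congrFun (congrArg Subtype.val hμ) ⟨I, hI⟩) (nullOpen ⟨I, hI⟩
    (isNullSet_singleton m))
  have := (Submodule.Quotient.mk_eq_zero _).1 h m rfl
  have := (Submodule.Quotient.mk_eq_zero I).1 this
  rw [map_zero, sub_zero]
  exact this

/-- For surjectivity, representatives of a point approximate its functional on every null set, so
`hA` makes the functional continuous. By `hN` the submodules `nullOpen` are cofinal, hence the
values of the functional recover the point. -/
theorem wkDual_toLim_bijective (hM : IsLinearlyTopologized k M)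
    (hN : ∀ (Q : OpenSub k k) (W : weakOpen k M (k ⧸ Q.1)), ∃ (S : Set M) (hS : IsNullSet k S),
      (nullOpen Q hS).1 ≤ W.1)
    (hA : ∀ φ : M →ₗ[k] k, IsApproximable φ → ∀ I : Ideal k, IsOpen (I : Set k) →
      ∃ P : Submodule k M, IsOpen (P : Set M) ∧ P ≤ Submodule.comap φ I) :
    Function.Bijective (WkDual.toLim k M) := by
  refine ⟨wkDual_toLim_injective, fun x => ?_⟩
  obtain ⟨φ, hφ⟩ := weakHomLim_exists_functional x
  have hc : Continuous φ := hM.continuous φ (hA φ fun Q S hS => by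
    obtain ⟨ψ, hψ⟩ := weakQuot_mk_surjective _ (x.1 Q (nullOpen Q hS))
    exact ⟨ψ, fun m hm => hφ Q _ ψ hψ.symm m fun θ hθ => hθ m hm⟩)
  refine ⟨(⟨φ, hc⟩ : M →L[k] k), Subtype.ext (funext fun Q => funext fun W => ?_)⟩
  obtain ⟨S, hS, hW⟩ := hN Q W
  obtain ⟨ψ, hψ⟩ := weakQuot_mk_surjective _ (x.1 Q (nullOpen Q hS))
  rw [weakHomLim_mono' x hW hψ.symm]
  refine weakQuot_mk_eq.2 (hW fun m hm => ?_)
  have h1 := hφ Q _ ψ hψ.symm m fun θ hθ => hθ m hm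
  change Submodule.mkQ Q.1 (φ m) - ψ.1 m = 0
  rw [h1, sub_self]

/-- The criterion used for both weak duals: `h` yields openness, through `nullOpen`, and `h'` yields
cofinality. -/
theorem isBasisOfOpenSubmodules_wkDual_of {ι : Type*} {p : ι → Prop}
    {B : ι → Submodule k (WkDual k M)}
    (h : ∀ i, p i → ∃ (Q : OpenSub k k) (S : Set M), IsNullSet k S ∧
      ∀ μ, (∀ m ∈ S, WkDual.eval m μ ∈ Q.1) → μ ∈ B i)
    (h' : ∀ (Q : OpenSub k k) (W : weakOpen k M (k ⧸ Q.1)), ∃ i, p i ∧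
      ∀ μ ∈ B i, wkReduce Q μ ∈ W.1) :
    IsBasisOfOpenSubmodules p B := by
  refine (isBasisOfOpenSubmodules_wkDual k M).reindex (fun ⟨Q, W⟩ _ => ?_) fun i hi => ?_
  · obtain ⟨i, hi, hB⟩ := h' Q W
    exact ⟨i, hi, hB⟩
  · obtain ⟨Q, S, hS, hB⟩ := h i hi
    refine ⟨⟨Q, nullOpen Q hS⟩, trivial, fun μ hμ => hB μ fun m hm => ?_⟩
    exact (Submodule.Quotient.mk_eq_zero Q.1).1 (hμ m hm)

/-! ### The strong dual. -/

theorem stDual_toLim_bijective (hM : IsLinearlyTopologized k M) :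
    Function.Bijective (StDual.toLim k M) := by
  constructor
  · rw [injective_iff_map_eq_zero]
    intro μ hμ
    refine StDual.ext fun m => eq_of_forall_sub_mem fun I hI => ?_
    have h := congrFun (congrArg Subtype.val hμ) ⟨I, hI⟩
    have h' := LinearMap.congr_fun (congrArg Subtype.val h) m
    rw [map_zero, sub_zero]
    exact (Submodule.Quotient.mk_eq_zero I).1 h'
  · intro x
    let R : Ideal k → M → k → Prop := fun I m a =>
      ∃ hI : IsOpen (I : Set k), (x.1 ⟨I, hI⟩).1 m = Submodule.mkQ I a
    obtain ⟨φ, hφ⟩ : ∃ φ : M →ₗ[k] k, ∀ {I : Ideal k}, IsOpen (I : Set k) → ∀ {m a},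
        R I m a → φ m - a ∈ I := by
      refine exists_linearMap_of_approx R ?_ ?_ ?_ ?_ ?_
      · intro I hI m
        obtain ⟨a, ha⟩ := Submodule.mkQ_surjective I ((x.1 ⟨I, hI⟩).1 m)
        exact ⟨a, hI, ha.symm⟩
      · rintro I J hI hIJ m a ⟨hI', ha⟩
        have hJ := isOpen_of_le hI hIJ
        refine ⟨hJ, ?_⟩
        rw [← x.2 ⟨I, hI⟩ ⟨J, hJ⟩ hIJ]
        exact (congrArg (Submodule.factor hIJ) ha).trans rfl
      · rintro I hI m m' a a' ⟨_, ha⟩ ⟨_, ha'⟩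
        exact ⟨hI, by rw [map_add, ha, ha', map_add]⟩
      · rintro I hI c m a ⟨_, ha⟩
        exact ⟨hI, by rw [map_smul, ha, ← map_smul, smul_eq_mul]⟩
      · rintro I hI a ⟨_, ha⟩
        rw [map_zero] at ha
        exact (Submodule.Quotient.mk_eq_zero _).1 ha.symm
    have hφ' : ∀ (Q : OpenSub k k) m, Submodule.mkQ Q.1 (φ m) = (x.1 Q).1 m := by
      intro Q m
      obtain ⟨a, ha⟩ := Submodule.mkQ_surjective Q.1 ((x.1 Q).1 m)
      rw [← ha]
      exact mkQ_eq_mkQ.2 (hφ Q.2 ⟨Q.2, ha.symm⟩)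
    -- There is no completion here: the component of `x` at `I` already vanishes on an open
    -- submodule.
    have hc : Continuous φ := hM.continuous φ fun I hI => by
      obtain ⟨P, hP, h⟩ := (x.1 ⟨I, hI⟩).2
      refine ⟨P, hP, fun m hm => ?_⟩
      have := LinearMap.mem_ker.1 (h hm)
      rw [← hφ' ⟨I, hI⟩ m] at this
      exact (Submodule.Quotient.mk_eq_zero I).1 this
    refine ⟨(⟨φ, hc⟩ : M →L[k] k), Subtype.ext (funext fun Q => Subtype.ext ?_)⟩
    ext m
    exact hφ' Q m

variable (k M) in
-- The boxes whose sides are all `I • ⊤`, for one open ideal `I`, are cofinal among the basic ones.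
theorem isBasisOfOpenSubmodules_stDual :
    IsBasisOfOpenSubmodules (L := StDual k M) (fun I : Ideal k => IsOpen (I : Set k))
      (fun I => ⨅ Q : OpenSub k k, (I • (⊤ : Submodule k (HomMod k M (k ⧸ Q.1)))).comap
        (stReduce Q)) := by
  let S : Set (Submodule k (StrongHomLim k M k)) :=
    {W | ∃ U : (Q : OpenSub k k) → Submodule k (HomMod k M (k ⧸ Q.1)),
      (∃ I : Ideal k, IsOpen (I : Set k) ∧
        ∀ Q, I • (⊤ : Submodule k (HomMod k M (k ⧸ Q.1))) ≤ U Q) ∧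
      W = (Submodule.pi Set.univ U).comap (StrongHomLim k M k).subtype}
  have hI : ∀ I : Ideal k, IsOpen (I : Set k) → (Submodule.pi Set.univ fun Q : OpenSub k k =>
      I • (⊤ : Submodule k (HomMod k M (k ⧸ Q.1)))).comap (StrongHomLim k M k).subtype ∈ S :=
    fun I hI => ⟨_, ⟨I, hI, fun _ => le_rfl⟩, rfl⟩
  have : Nonempty S := ⟨⟨_, hI ⊤ isOpen_top_ideal⟩⟩
  have h := isBasisOfOpenSubmodules_of_eq_iInf (L := StDual k M) (ι := S)
    (T := fun W => StrongHomLim k M k ⧸ W.1) (fun W => W.1.mkQ.comp (StDual.toLim k M)) ?_ ?_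
  · refine h.reindex ?_ fun I h => ⟨⟨_, hI I h⟩, trivial, fun μ hμ => ?_⟩
    · rintro ⟨W, U, ⟨I, hI, h⟩, rfl⟩ -
      refine ⟨I, hI, fun μ hμ => (Submodule.Quotient.mk_eq_zero _).2 fun Q _ => ?_⟩
      exact h Q ((Submodule.mem_iInf _).1 hμ Q)
    · have := (Submodule.Quotient.mk_eq_zero _).1 hμ
      exact (Submodule.mem_iInf _).2 fun Q => this Q trivial
  · change TopologicalSpace.induced _ (linearTopology S) = _
    rw [linearTopology, iInf_subtype', induced_iInf]
    refine iInf_congr fun W => ?_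
    rw [induced_compose]
    rfl
  · rintro ⟨W, U, ⟨I, hI, h⟩, rfl⟩ ⟨W', U', ⟨I', hI', h'⟩, rfl⟩
    refine ⟨⟨_, fun Q => U Q ⊓ U' Q, ⟨I ⊓ I', isOpen_inf hI hI', fun Q => le_inf
        ((Submodule.smul_mono_left inf_le_left).trans (h Q))
        ((Submodule.smul_mono_left inf_le_right).trans (h' Q))⟩, rfl⟩, fun μ hμ => ?_⟩
    have := (Submodule.Quotient.mk_eq_zero _).1 hμ
    exact ⟨(Submodule.Quotient.mk_eq_zero _).2 fun Q _ => (this Q trivial).1,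
      (Submodule.Quotient.mk_eq_zero _).2 fun Q _ => (this Q trivial).2⟩

/-- The strong dual has the naive canonical topology if the functionals with values in a small ideal
are multiples. -/
theorem hasNaiveCanonicalTopology_stDual
    (h : ∀ I : Ideal k, IsOpen (I : Set k) → ∃ J : Ideal k, IsOpen (J : Set k) ∧
      ∀ μ : StDual k M, (∀ m, StDual.eval m μ ∈ J) → μ ∈ I • (⊤ : Submodule k (StDual k M))) :
    HasNaiveCanonicalTopology k (StDual k M) := by
  refine (isBasisOfOpenSubmodules_stDual k M).reindex (fun I hI => ⟨I, hI, ?_⟩) fun I hI => ?_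
  · exact le_iInf fun Q => smul_top_le_comap _ le_rfl
  · obtain ⟨J, hJ, h'⟩ := h I hI
    refine ⟨J, hJ, fun μ hμ => h' μ fun m => ?_⟩
    -- Since `J` annihilates `k / J`, the side at `Q = J` of the box defined by `J` is zero, so the
    -- functionals in the box take values in `J`.
    have h1 := (Submodule.mem_iInf _).1 hμ ⟨J, hJ⟩
    have h2 : J • (⊤ : Submodule k (HomMod k M (k ⧸ J))) ≤
        (nullOpen ⟨J, hJ⟩ (isNullSet_singleton m)).1 := by
      rw [Submodule.smul_le]
      rintro r hr φ - m' rfl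
      exact mk_smul_eq_zero hr (φ.1 m')
    exact (Submodule.Quotient.mk_eq_zero J).1 (h2 h1 m rfl)

theorem stDual_continuous_transpose (T : M →L[k] N) :
    Continuous (StDual.transpose (k := k) T) := by
  refine (isBasisOfOpenSubmodules_stDual k N).continuous (isBasisOfOpenSubmodules_stDual k M) _
    fun I hI => ⟨I, hI, fun μ hμ => (Submodule.mem_iInf _).2 fun Q => ?_⟩
  exact smul_top_le_comap (homTranspose T Q) le_rfl ((Submodule.mem_iInf _).1 hμ Q)

end Duals

/-! ### Partitions into compact open sets -/

section Partitions

variable {X : Type*} [TopologicalSpace X]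

/-- The discrete quotient given by a locally constant equivalence relation. -/
def quotientOfSetoid (r : Setoid X) (h : ∀ x, ∀ᶠ y in 𝓝 x, r x y) : DiscreteQuotient X where
  toSetoid := r
  isOpen_setOfPred_rel x := by
    rw [isOpen_iff_mem_nhds]
    intro y hy
    filter_upwards [h y] with z hz
    exact r.trans hy hz

theorem quotientOfSetoid_proj_eq {r : Setoid X} {h : ∀ x, ∀ᶠ y in 𝓝 x, r x y} {x y : X} :
    (quotientOfSetoid r h).proj x = (quotientOfSetoid r h).proj y ↔ r x y :=
  Quotient.eq''

theorem proj_out (D : DiscreteQuotient X) (d : D) : D.proj (Quotient.out d) = d :=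
  Quotient.out_eq d

theorem mem_fibre {D : DiscreteQuotient X} {d : D} {x : X} :
    x ∈ (fibre D d : Set X) ↔ D.proj x = d := Iff.rfl

theorem finite_image_proj (D : DiscreteQuotient X) {K : Set X} (hK : IsCompact K) :
    (D.proj '' K).Finite :=
  isCompact_iff_finite.1 (hK.image D.proj_continuous)

theorem eventually_proj_eq (D : DiscreteQuotient X) (x : X) : ∀ᶠ y in 𝓝 x, D.proj y = D.proj x :=
  (IsLocallyConstant.iff_eventually_eq _).1 D.proj_isLocallyConstant x

theorem eventually_mem_iff {U : Set X} (hU : IsClopen U) (x : X) :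
    ∀ᶠ y in 𝓝 x, (y ∈ U ↔ x ∈ U) := by
  by_cases h : x ∈ U
  · filter_upwards [hU.2.mem_nhds h] with y hy
    simp [h, hy]
  · filter_upwards [hU.1.isOpen_compl.mem_nhds h] with y hy
    simp only [h, iff_false]
    exact hy

theorem proj_eq_of_le {D E : DiscreteQuotient X} (h : E ≤ D) {x y : X}
    (hxy : E.proj x = E.proj y) : D.proj x = D.proj y := by
  rw [← DiscreteQuotient.ofLE_proj h, hxy, DiscreteQuotient.ofLE_proj]

variable [TDSpace X]

theorem exists_compactOpens_mem {x : X} {U : Set X} (hU : IsOpen U) (hx : x ∈ U) :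
    ∃ C : CompactOpens X, x ∈ C ∧ (C : Set X) ⊆ U := by
  obtain ⟨K, hK, hxK, hKU⟩ := exists_compact_subset hU hx
  obtain ⟨V, hV, hxV, hVK⟩ := (TDSpace.clopen_basis (X := X)).exists_subset_of_mem_open hxK
    isOpen_interior
  exact ⟨⟨⟨V, hK.of_isClosed_subset hV.1 (hVK.trans interior_subset)⟩, hV.2⟩, hxV,
    (hVK.trans interior_subset).trans hKU⟩

theorem exists_compactOpens_between {K U : Set X} (hK : IsCompact K) (hU : IsOpen U)
    (hKU : K ⊆ U) : ∃ C : CompactOpens X, K ⊆ C ∧ (C : Set X) ⊆ U := by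
  refine hK.induction_on (p := fun s => ∃ C : CompactOpens X, s ⊆ C ∧ (C : Set X) ⊆ U)
    ⟨⊥, by simp, by simp⟩ ?_ ?_ ?_
  · rintro s t hst ⟨C, h, h'⟩
    exact ⟨C, hst.trans h, h'⟩
  · rintro s t ⟨C, h, h'⟩ ⟨C', h1, h1'⟩
    exact ⟨C ⊔ C', by simpa using Set.union_subset_union h h1, by simp [h', h1']⟩
  · intro x hx
    obtain ⟨C, hxC, hC⟩ := exists_compactOpens_mem hU (hKU hx)
    exact ⟨C, mem_nhdsWithin_of_mem_nhds (C.isOpen.mem_nhds hxC), C, subset_rfl, hC⟩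

variable (X) in
-- Paracompactness refines a cover by compact open sets to a locally finite one, and a closed
-- shrinking leaves room for a compact open `W i` between each closed piece and the open set around
-- it. Sorting points by the first `W i` that contains them makes this locally finite cover
-- disjoint.
theorem exists_properQuotient : ∃ D : DiscreteQuotient X, IsProperQuotient D := by
  choose C hC _ using fun x : X => exists_compactOpens_mem isOpen_univ (Set.mem_univ x)
  obtain ⟨u, uo, uc, uf, hu⟩ := precise_refinement (fun x => (C x : Set X))
    (fun x => (C x).isOpen) (Set.iUnion_eq_univ_iff.2 fun x => ⟨x, hC x⟩)
  obtain ⟨v, vc, hv, hvu⟩ := exists_iUnion_eq_closed_subset uo uf.point_finite uc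
  choose W hvW hWu using fun i => exists_compactOpens_between
    ((C i).isCompact.of_isClosed_subset (hv i) ((hvu i).trans (hu i))) (uo i) (hvu i)
  have hne : ∀ x, {i | x ∈ W i}.Nonempty := fun x => by
    obtain ⟨i, hi⟩ := Set.iUnion_eq_univ_iff.1 vc x
    exact ⟨i, hvW i hi⟩
  have hloc : ∀ x, ∀ᶠ y in 𝓝 x, {i | y ∈ W i} = {i | x ∈ W i} := by
    intro x
    obtain ⟨t, ht, hfin⟩ := uf x
    have h1 : ∀ᶠ y in 𝓝 x, ∀ i ∈ {i | (u i ∩ t).Nonempty}, (y ∈ (W i : Set X) ↔ x ∈ (W i : Set X)) :=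
      (Filter.eventually_all_finite hfin).2 fun i _ =>
        eventually_mem_iff ⟨(W i).isCompact.isClosed, (W i).isOpen⟩ x
    filter_upwards [h1, ht] with y hy hyt
    ext i
    by_cases hi : (u i ∩ t).Nonempty
    · exact hy i hi
    · exact ⟨fun h => (hi ⟨y, hWu i h, hyt⟩).elim,
        fun h => (hi ⟨x, hWu i h, mem_of_mem_nhds ht⟩).elim⟩
  -- The first index `i` with `x ∈ W i`, for a well-ordering of the index type `X`. It depends only
  -- on the set of such indices, which is locally constant by `hloc`.
  let f : X → X := fun x => WellFounded.min (IsWellFounded.wf (r := (WellOrderingRel : X → X → Prop))) {i | x ∈ W i} (hne x)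
  have hf : ∀ x, x ∈ W (f x) := fun x => WellFounded.min_mem _ _ (hne x)
  refine ⟨quotientOfSetoid (Setoid.ker f) fun x => ?_, fun d => ?_⟩
  · filter_upwards [hloc x] with y hy
    change f x = f y
    simp only [f, hy]
  · obtain ⟨x, rfl⟩ := DiscreteQuotient.proj_surjective _ d
    refine (W (f x)).isCompact.of_isClosed_subset (DiscreteQuotient.isClosed_preimage _ _) ?_
    intro y hy
    have : f y = f x := quotientOfSetoid_proj_eq.1 hy
    rw [← this]
    exact hf y

end Partitions

/-! ### Continuous functions with values in the base ring -/

section Functions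

variable {X : Type*} [TopologicalSpace X]
variable {k : Type*} [CommRing k] [UniformSpace k] [IsUniformAddGroup k] [IsTopologicalRing k]
  [BaseRing k]

theorem chi_of_mem {U : Clopens X} {x : X} (h : x ∈ (U : Set X)) : chi k U x = 1 := by
  rw [chi_apply, Set.indicator_of_mem h]
  rfl

theorem chi_of_notMem {U : Clopens X} {x : X} (h : x ∉ (U : Set X)) : chi k U x = 0 := by
  rw [chi_apply, Set.indicator_of_notMem h]

theorem chi_inf (U V : Clopens X) : chi k (U ⊓ V) = chi k U * chi k V := by
  ext x
  rw [ContinuousMap.mul_apply]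
  by_cases h : x ∈ (U : Set X) <;> by_cases h' : x ∈ (V : Set X)
  · rw [chi_of_mem h, chi_of_mem h', chi_of_mem (U := U ⊓ V) ⟨h, h'⟩, one_mul]
  · rw [chi_of_mem h, chi_of_notMem h', chi_of_notMem (U := U ⊓ V) fun h => h' h.2, one_mul]
  · rw [chi_of_notMem h, chi_of_notMem (U := U ⊓ V) fun h' => h h'.1, zero_mul]
  · rw [chi_of_notMem h, chi_of_notMem (U := U ⊓ V) fun h' => h h'.1, zero_mul]

theorem eventually_sub_mem (f : C(X, k)) {I : Ideal k} (hI : IsOpen (I : Set k)) (x : X) :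
    ∀ᶠ y in 𝓝 x, f x - f y ∈ I := by
  have : Filter.Tendsto (fun y => f x - f y) (𝓝 x) (𝓝 (f x - f x)) :=
    tendsto_const_nhds.sub (f.continuous.tendsto x)
  rw [sub_self] at this
  exact this (hI.mem_nhds I.zero_mem)

/-- Congruence modulo `I` of the values of a function. -/
def levelSetoid (f : X → k) (I : Ideal k) : Setoid X where
  r x y := f x - f y ∈ I
  iseqv := ⟨fun x => by simp, fun {x y} h => by
    have := I.neg_mem h
    rwa [neg_sub] at this, fun {x y z} h h' => by
    have := I.add_mem h h'
    rwa [sub_add_sub_cancel] at this⟩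

/-- The partition of `X` into the sets on which `f` is constant modulo `I`. -/
def levelQuotient (f : C(X, k)) {I : Ideal k} (hI : IsOpen (I : Set k)) : DiscreteQuotient X :=
  quotientOfSetoid (levelSetoid f I) (eventually_sub_mem f hI)

/-- `f` is constant modulo `I` on the fibres of `D`. -/
def IsConstMod (D : DiscreteQuotient X) (I : Ideal k) (f : X → k) : Prop :=
  ∀ x y, D.proj x = D.proj y → f x - f y ∈ I

theorem isConstMod_levelQuotient (f : C(X, k)) {I : Ideal k} (hI : IsOpen (I : Set k)) :
    IsConstMod (levelQuotient f hI) I f :=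
  fun _ _ h => quotientOfSetoid_proj_eq.1 h

theorem IsConstMod.mono {D E : DiscreteQuotient X} {I J : Ideal k} {f : X → k}
    (h : IsConstMod D I f) (hE : E ≤ D) (hI : I ≤ J) : IsConstMod E J f :=
  fun x y hxy => hI (h x y (proj_eq_of_le hE hxy))

theorem IsConstMod.mul {D : DiscreteQuotient X} {I : Ideal k} {f g : X → k}
    (hf : IsConstMod D I f) (hg : IsConstMod D I g) : IsConstMod D I (fun x => f x * g x) := by
  intro x y h
  have := I.add_mem (I.mul_mem_left (f x) (hg x y h)) (I.mul_mem_right (g y) (hf x y h))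
  convert this using 1
  ring

theorem IsConstMod.sub_out_mem {D : DiscreteQuotient X} {I : Ideal k} {f : X → k}
    (h : IsConstMod D I f) (x : X) : f x - f (Quotient.out (D.proj x)) ∈ I :=
  h x _ (proj_out D _).symm

theorem isConstMod_chi_fibre (D : DiscreteQuotient X) (I : Ideal k) (d : D) :
    IsConstMod D I (chi k (fibre D d)) := by
  intro x y h
  by_cases hx : D.proj x = d
  · rw [chi_of_mem (mem_fibre.2 hx), chi_of_mem (mem_fibre.2 (h.symm.trans hx)), sub_self]
    exact I.zero_mem
  · rw [chi_of_notMem (mt mem_fibre.1 hx), chi_of_notMem (mt mem_fibre.1 fun h' => hx (h.trans h')),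
      sub_self]
    exact I.zero_mem

theorem sum_smul_chi_fibre_apply {D : DiscreteQuotient X} (s : Finset D) (g : D → k) {x : X}
    (hx : D.proj x ∈ s) : (∑ d ∈ s, g d • chi k (fibre D d)) x = g (D.proj x) := by
  classical
  rw [ContinuousMap.sum_apply, Finset.sum_eq_single (D.proj x)]
  · rw [ContinuousMap.smul_apply, chi_of_mem (mem_fibre.2 rfl), smul_eq_mul, mul_one]
  · intro d _ hd
    rw [ContinuousMap.smul_apply, chi_of_notMem (mt mem_fibre.1 hd.symm), smul_zero]
  · exact fun h => (h hx).elim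

variable (k) in
/-- The functions with values in `I` on `K`. -/
def valuesIn (K : Set X) (I : Ideal k) : Submodule k C(X, k) where
  carrier := {f | ∀ x ∈ K, f x ∈ I}
  zero_mem' := fun _ _ => I.zero_mem
  add_mem' := fun hf hg x hx => I.add_mem (hf x hx) (hg x hx)
  smul_mem' := fun c _ hf x hx => I.mul_mem_left c (hf x hx)

variable (X k) in
-- The compact-open topology is that of uniform convergence on compact sets, and the open ideals
-- give a basis of the uniformity of `k`.
theorem isBasisOfOpenSubmodules_continuousMap :
    IsBasisOfOpenSubmodules (L := C(X, k))
      (fun p : Set X × Ideal k => IsCompact p.1 ∧ IsOpen (p.2 : Set k))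
      (fun p => valuesIn k p.1 p.2) := by
  have hu : (uniformity k).HasBasis (fun I : Ideal k => IsOpen (I : Set k))
      (fun I => {p : k × k | p.2 - p.1 ∈ I}) := by
    rw [uniformity_eq_comap_nhds_zero]
    exact (BaseRing.linear (k := k)).comap _
  have hb : ∀ f : C(X, k), (𝓝 f).HasBasis
      (fun p : Set X × Ideal k => IsCompact p.1 ∧ IsOpen (p.2 : Set k))
      (fun p => {g | g - f ∈ valuesIn k p.1 p.2}) := fun f =>
    nhds_basis_uniformity' hu.compactConvergenceUniformity
  refine ⟨fun p hp => ?_, hb⟩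
  rw [isOpen_iff_mem_nhds]
  intro x hx
  refine (hb x).mem_iff.2 ⟨p, hp, fun y hy => ?_⟩
  have := (valuesIn k p.1 p.2).add_mem hy hx
  rwa [sub_add_cancel] at this

theorem isOpen_valuesIn {K : Set X} (hK : IsCompact K) {I : Ideal k} (hI : IsOpen (I : Set k)) :
    IsOpen (valuesIn k K I : Set C(X, k)) :=
  (isBasisOfOpenSubmodules_continuousMap X k).1 (K, I) ⟨hK, hI⟩

theorem exists_valuesIn_le {P : Submodule k C(X, k)} (hP : IsOpen (P : Set C(X, k))) :
    ∃ (K : Set X) (I : Ideal k), IsCompact K ∧ IsOpen (I : Set k) ∧ valuesIn k K I ≤ P := by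
  obtain ⟨⟨K, I⟩, ⟨hK, hI⟩, h⟩ := (isBasisOfOpenSubmodules_continuousMap X k).isOpen_iff.1 hP
  exact ⟨K, I, hK, hI, h⟩

/-- Approximation by step functions on a compact set. -/
theorem IsConstMod.sub_sum_mem_valuesIn {D : DiscreteQuotient X} {I : Ideal k} {f : C(X, k)}
    (h : IsConstMod D I f) {K : Set X} (hK : IsCompact K) :
    f - ∑ d ∈ (finite_image_proj D hK).toFinset, f (Quotient.out d) • chi k (fibre D d) ∈
      valuesIn k K I := by
  intro x hx
  rw [ContinuousMap.sub_apply, sum_smul_chi_fibre_apply _ (fun d => f (Quotient.out d))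
    (by simpa using ⟨x, hx, rfl⟩)]
  exact h.sub_out_mem x

/-- A map `C(X, k) → k / Q` that vanishes on an open submodule vanishes on the functions with values
in `Q` on a compact set. -/
theorem homMod_exists_valuesIn_le {Q : OpenSub k k} (φ : HomMod k C(X, k) (k ⧸ Q.1)) :
    ∃ K : Set X, IsCompact K ∧ valuesIn k K Q.1 ≤ LinearMap.ker φ.1 := by
  obtain ⟨P, hP, hφ⟩ := φ.2
  obtain ⟨K, I, hK, hI, hP'⟩ := exists_valuesIn_le hP
  refine ⟨K, hK, fun f hf => ?_⟩
  -- Working modulo `I ⊓ Q` does two things: the step approximation of `f` differs from `f` by an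
  -- element of `P`, and its coefficients lie in `Q`, because each chosen point shares its fibre
  -- with a point of `K`, where `f` is in `Q`.
  have hI' := isOpen_inf hI Q.2
  have hc := isConstMod_levelQuotient f hI'
  have h := hφ (hP' fun x hx => (hc.sub_sum_mem_valuesIn hK x hx).1)
  rw [LinearMap.mem_ker, map_sub, sub_eq_zero] at h
  rw [LinearMap.mem_ker, h, map_sum]
  refine Finset.sum_eq_zero fun d hd => ?_
  rw [map_smul]
  refine mk_smul_eq_zero ?_ _
  simp only [Set.Finite.mem_toFinset] at hd
  obtain ⟨x, hx, rfl⟩ := hd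
  have := Q.1.sub_mem (hf x hx) (hc.sub_out_mem x).2
  rwa [sub_sub_cancel] at this

/-- The reduction of `μ` modulo `I` kills every function with values in `I`. This bound is what
allows step approximations to replace functions everywhere below. -/
theorem wkEval_mem_of_valuesIn (μ : DAcs X k) {I : Ideal k} (hI : IsOpen (I : Set k)) {f : C(X, k)}
    (hf : ∀ x, f x ∈ I) : WkDual.eval f μ ∈ I := by
  obtain ⟨K, _, h⟩ := homMod_exists_valuesIn_le (wkReduce ⟨I, hI⟩ μ)
  have := h (x := f) fun x _ => hf x
  exact (Submodule.Quotient.mk_eq_zero I).1 this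

/-- Multiplication by a function, as a continuous linear map. -/
def mulC (g : C(X, k)) : C(X, k) →L[k] C(X, k) where
  toLinearMap := LinearMap.mulLeft k g
  cont := (isBasisOfOpenSubmodules_continuousMap X k).continuous
    (isBasisOfOpenSubmodules_continuousMap X k) (LinearMap.mulLeft k g) fun p hp =>
      ⟨p, hp, fun _ hf x hx => p.2.mul_mem_left _ (hf x hx)⟩

/-- A map modulo `Q` is concentrated on a compact set, which meets finitely many fibres; it is the
sum of its localizations at these. -/
theorem homMod_eq_sum {Q : OpenSub k k} (φ : HomMod k C(X, k) (k ⧸ Q.1)) (D : DiscreteQuotient X) :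
    ∃ s : Finset D, φ = ∑ d ∈ s, homTranspose (mulC (chi k (fibre D d))) Q φ ∧
      ∀ d ∉ s, ∀ f, φ.1 (chi k (fibre D d) * f) = 0 := by
  obtain ⟨K, hK, h⟩ := homMod_exists_valuesIn_le φ
  refine ⟨(finite_image_proj D hK).toFinset, ?_, fun d hd f => h fun x hx => ?_⟩
  · apply Subtype.ext
    ext f
    have h1 : f - ∑ d ∈ (finite_image_proj D hK).toFinset, chi k (fibre D d) * f ∈
        valuesIn k K Q.1 := by
      intro x hx
      have h2 := sum_smul_chi_fibre_apply (finite_image_proj D hK).toFinset (fun _ => (1 : k))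
        (x := x) (by simpa using ⟨x, hx, rfl⟩)
      simp only [one_smul] at h2
      rw [← Finset.sum_mul, ContinuousMap.sub_apply, ContinuousMap.mul_apply, h2, one_mul, sub_self]
      exact Q.1.zero_mem
    have h3 := h h1
    rw [LinearMap.mem_ker, map_sub, sub_eq_zero, map_sum] at h3
    rw [h3]
    have e : ∀ s : Finset D, (∑ d ∈ s, homTranspose (mulC (chi k (fibre D d))) Q φ).1 =
        ∑ d ∈ s, (homTranspose (mulC (chi k (fibre D d))) Q φ).1 := fun s =>
      map_sum (homSubmodule k C(X, k) (k ⧸ Q.1)).subtype _ s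
    rw [e, LinearMap.sum_apply]
    rfl
  · rw [ContinuousMap.mul_apply, chi_of_notMem, zero_mul]
    · exact Q.1.zero_mem
    · rintro rfl
      exact hd (by simpa using ⟨x, hx, rfl⟩)

/-- A compact set meets finitely many fibres, so almost all these functions vanish on it. -/
theorem isNullSet_range_chi_mul (D : DiscreteQuotient X) (m : D → C(X, k)) :
    IsNullSet k (Set.range fun d => chi k (fibre D d) * m d) := by
  intro P hP
  obtain ⟨K, I, hK, hI, h⟩ := exists_valuesIn_le hP
  refine ((finite_image_proj D hK).image fun d => chi k (fibre D d) * m d).subset ?_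
  rintro _ ⟨⟨d, rfl⟩, hd⟩
  refine ⟨d, ?_, rfl⟩
  by_contra hn
  refine hd (h fun x hx => ?_)
  rw [ContinuousMap.mul_apply, chi_of_notMem, zero_mul]
  · exact I.zero_mem
  · rintro rfl
    exact hn ⟨x, hx, rfl⟩

theorem isNullSet_range_chi (D : DiscreteQuotient X) :
    IsNullSet k (Set.range fun d => chi k (fibre D d)) := by
  simpa using isNullSet_range_chi_mul D (fun _ => (1 : C(X, k)))

/-- On the compact set where `φ` is concentrated, `f` is congruent modulo `Q` to a finite
combination of characteristic functions of fibres. -/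
theorem homMod_eq_zero_of_isConstMod {Q : OpenSub k k} {φ : HomMod k C(X, k) (k ⧸ Q.1)}
    {D : DiscreteQuotient X} (hφ : ∀ d : D, φ.1 (chi k (fibre D d)) = 0) {f : C(X, k)}
    (hf : IsConstMod D Q.1 f) : φ.1 f = 0 := by
  obtain ⟨K, hK, h⟩ := homMod_exists_valuesIn_le φ
  have := h (hf.sub_sum_mem_valuesIn hK)
  rw [LinearMap.mem_ker, map_sub, sub_eq_zero, map_sum] at this
  rw [this]
  refine Finset.sum_eq_zero fun d _ => ?_
  rw [map_smul, hφ, smul_zero]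

/-- The maps that vanish on the members of a suitable partition belong to a given open submodule. -/
theorem exists_partition_le_weakOpen [TDSpace X] (Q : OpenSub k k)
    (W : weakOpen k C(X, k) (k ⧸ Q.1)) :
    ∃ D : DiscreteQuotient X, IsProperQuotient D ∧ ∀ φ : HomMod k C(X, k) (k ⧸ Q.1),
      (∀ d : D, φ.1 (chi k (fibre D d)) = 0) → φ ∈ W.1 := by
  obtain ⟨E, hE⟩ := exists_properQuotient X
  -- For maps concentrated on the compact fibre over `e`, membership in `W` is tested on the finite
  -- set `F e`.
  choose F hF using fun e : E => W.2.1 (valuesIn k (E.proj ⁻¹' {e}) Q.1) (isOpen_valuesIn (hE e) Q.2)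
  -- Inside the fibre of `E` over `e`, the new partition separates points until all functions of `F
  -- e` are constant modulo `Q` on its members.
  let r : Setoid X :=
    { r := fun x y => E.proj x = E.proj y ∧ ∀ f ∈ F (E.proj x), f x - f y ∈ Q.1
      iseqv := ⟨fun x => ⟨rfl, fun f _ => (levelSetoid f Q.1).refl x⟩,
        fun h => ⟨h.1.symm, fun f hf => (levelSetoid f Q.1).symm (h.2 f (h.1 ▸ hf))⟩,
        fun h h' => ⟨h.1.trans h'.1, fun f hf =>
          (levelSetoid f Q.1).trans (h.2 f hf) (h'.2 f (h.1 ▸ hf))⟩⟩ }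
  have hr : ∀ x, ∀ᶠ y in 𝓝 x, r x y := by
    intro x
    filter_upwards [eventually_proj_eq E x, (Filter.eventually_all_finset (F (E.proj x))).2
      fun f _ => eventually_sub_mem f Q.2 x] with y h1 h2
    exact ⟨h1.symm, h2⟩
  refine ⟨quotientOfSetoid r hr, fun d => ?_, fun φ hφ => ?_⟩
  · obtain ⟨x, rfl⟩ := DiscreteQuotient.proj_surjective _ d
    refine (hE (E.proj x)).of_isClosed_subset (DiscreteQuotient.isClosed_preimage _ _) ?_
    intro y hy
    exact (quotientOfSetoid_proj_eq.1 hy).1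
  -- The localizations of `φ` at the fibres of `E` are tested one by one: for `f` in `F e`, the
  -- product of `f` with the characteristic function of the fibre is constant modulo `Q` on the
  -- members of the partition, so `φ` kills it.
  · obtain ⟨s, hs, -⟩ := homMod_eq_sum φ E
    rw [hs]
    refine Submodule.sum_mem _ fun e _ => hF e _ (fun f hf => ?_) fun f hf => ?_
    · obtain ⟨K, hK, h⟩ := homMod_exists_valuesIn_le φ
      refine h fun x _ => ?_
      change chi k (fibre E e) x * f x ∈ Q.1
      by_cases hx : E.proj x = e
      · exact Ideal.mul_mem_left Q.1 _ (hf x hx)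
      · rw [chi_of_notMem (mt mem_fibre.1 hx), zero_mul]
        exact Q.1.zero_mem
    · refine homMod_eq_zero_of_isConstMod hφ (fun x y hxy => ?_)
      change chi k (fibre E e) x * f x - chi k (fibre E e) y * f y ∈ Q.1
      obtain ⟨h1, h2⟩ := quotientOfSetoid_proj_eq.1 hxy
      by_cases hx : E.proj x = e
      · subst hx
        rw [chi_of_mem (mem_fibre.2 rfl), chi_of_mem (mem_fibre.2 h1.symm), one_mul, one_mul]
        exact h2 f hf
      · rw [chi_of_notMem (mt mem_fibre.1 hx), chi_of_notMem (mt mem_fibre.1 fun h => hx (h1.trans h)),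
          zero_mul, zero_mul, sub_self]
        exact Q.1.zero_mem

/-- A gliding hump. On each fibre where `φ` takes a value outside `I`, choose a function that shows
it; these functions, cut off to their fibres, form a null set. A map that agrees with `φ` modulo `I`
on this null set sees finitely many fibres, so there are finitely many bad fibres, and their union
is the compact set sought. -/
theorem exists_isOpen_le_comap_of_isApproximable [TDSpace X] {φ : C(X, k) →ₗ[k] k}
    (hφ : IsApproximable φ) {I : Ideal k} (hI : IsOpen (I : Set k)) :
    ∃ P : Submodule k C(X, k), IsOpen (P : Set C(X, k)) ∧ P ≤ Submodule.comap φ I := by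
  classical
  obtain ⟨E, hE⟩ := exists_properQuotient X
  let A : Set E := {e | ∃ m, φ (chi k (fibre E e) * m) ∉ I}
  have hm : ∀ e, ∃ m, e ∈ A → φ (chi k (fibre E e) * m) ∉ I := by
    intro e
    by_cases h : e ∈ A
    · exact h.imp fun m hm _ => hm
    · exact ⟨0, fun h' => (h h').elim⟩
  choose m hm using hm
  have hA : A.Finite := by
    obtain ⟨ψ, hψ⟩ := hφ ⟨I, hI⟩ _ (isNullSet_range_chi_mul E m)
    obtain ⟨s, -, hs⟩ := homMod_eq_sum ψ E
    refine s.finite_toSet.subset fun e he => ?_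
    by_contra hn
    have h1 := hψ _ ⟨e, rfl⟩
    rw [hs e hn (m e)] at h1
    exact hm e he ((Submodule.Quotient.mk_eq_zero I).1 h1.symm)
  refine ⟨valuesIn k (⋃ e ∈ A, E.proj ⁻¹' {e}) I,
    isOpen_valuesIn (hA.isCompact_biUnion fun e _ => hE e) hI, fun f hf => ?_⟩
  -- A second null set, made of `f` and its restrictions to the fibres. The approximation `ψ` kills
  -- each restriction: over `A` because the restriction has values in `I`, elsewhere by the
  -- definition of `A`. As `ψ` is a finite sum of localizations, it kills `f`.
  obtain ⟨ψ, hψ⟩ := hφ ⟨I, hI⟩ ({f} ∪ Set.range fun e => chi k (fibre E e) * f) (fun P hP => by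
    rw [Set.union_sdiff_distrib]
    exact ((Set.finite_singleton f).subset Set.sdiff_subset).union
      (isNullSet_range_chi_mul E (fun _ => f) P hP))
  obtain ⟨s, hs, -⟩ := homMod_eq_sum ψ E
  obtain ⟨K, hK, hK'⟩ := homMod_exists_valuesIn_le ψ
  have h0 : ∀ e, ψ.1 (chi k (fibre E e) * f) = 0 := by
    intro e
    by_cases he : e ∈ A
    · refine hK' fun x _ => ?_
      rw [ContinuousMap.mul_apply]
      by_cases hx : E.proj x = e
      · exact I.mul_mem_left _ (hf x (Set.mem_biUnion he hx))
      · rw [chi_of_notMem (mt mem_fibre.1 hx), zero_mul]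
        exact I.zero_mem
    · rw [hψ _ (Or.inr ⟨e, rfl⟩)]
      by_contra hn
      exact he ⟨f, fun h => hn ((Submodule.Quotient.mk_eq_zero I).2 h)⟩
  have h1 : ψ.1 f = 0 := by
    have e : ∀ s : Finset E, (∑ d ∈ s, homTranspose (mulC (chi k (fibre E d))) ⟨I, hI⟩ ψ).1 =
        ∑ d ∈ s, (homTranspose (mulC (chi k (fibre E d))) ⟨I, hI⟩ ψ).1 := fun s =>
      map_sum (homSubmodule k C(X, k) (k ⧸ I)).subtype _ s
    rw [hs, e, LinearMap.sum_apply]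
    exact Finset.sum_eq_zero fun d _ => h0 d
  rw [hψ f (Or.inl rfl)] at h1
  exact (Submodule.Quotient.mk_eq_zero I).1 h1

variable (X k) in
theorem wkDual_continuousMap_toLim_bijective [TDSpace X] :
    Function.Bijective (WkDual.toLim k C(X, k)) := by
  refine wkDual_toLim_bijective (isBasisOfOpenSubmodules_continuousMap X k).isLinearlyTopologized
    (fun Q W => ?_) fun φ hφ I hI => exists_isOpen_le_comap_of_isApproximable hφ hI
  obtain ⟨D, -, h⟩ := exists_partition_le_weakOpen Q W
  exact ⟨_, isNullSet_range_chi D, fun φ hφ => h φ fun d => hφ _ ⟨d, rfl⟩⟩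

variable (X k) in
theorem isBasisOfOpenSubmodules_acsNhd [TDSpace X] :
    IsBasisOfOpenSubmodules
      (fun p : DiscreteQuotient X × Ideal k => IsProperQuotient p.1 ∧ IsOpen (p.2 : Set k))
      (fun p => acsNhd p.1 p.2) := by
  refine isBasisOfOpenSubmodules_wkDual_of ?_ fun Q W => ?_
  · rintro ⟨D, I⟩ ⟨hD, hI⟩
    exact ⟨⟨I, hI⟩, _, isNullSet_range_chi D, fun μ hμ =>
      (Submodule.mem_iInf _).2 fun d => hμ _ ⟨d, rfl⟩⟩
  · obtain ⟨D, hD, h⟩ := exists_partition_le_weakOpen Q W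
    refine ⟨(D, Q.1), ⟨hD, Q.2⟩, fun μ hμ => h _ fun d => ?_⟩
    exact (Submodule.Quotient.mk_eq_zero Q.1).2 ((Submodule.mem_iInf _).1 hμ d)

variable (X k) in
-- The level sets of `f` modulo `I` are clopen, and finitely many of them cover a given compact set.
theorem denseRange_clopenAlgebraMap : DenseRange (clopenAlgebraMap X k) := by
  intro f
  rw [mem_closure_iff_nhds_basis ((isBasisOfOpenSubmodules_continuousMap X k).2 f)]
  rintro ⟨K, I⟩ ⟨hK, hI⟩
  have h := (isConstMod_levelQuotient f hI).sub_sum_mem_valuesIn hK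
  refine ⟨_, ⟨∑ d ∈ (finite_image_proj (levelQuotient f hI) hK).toFinset,
    MonoidAlgebra.single (fibre _ d : ClopenMonoid X) (f (Quotient.out d)), rfl⟩, ?_⟩
  have := (valuesIn k K I).neg_mem h
  rw [neg_sub] at this
  rw [Set.mem_ofPred_eq]
  convert this using 2
  rw [map_sum]
  refine Finset.sum_congr rfl fun d _ => ?_
  exact MonoidAlgebra.lift_single _ _ _

end Functions

/-! ### Measures with almost compact support as set functions -/

section AcsMeasures

variable {X : Type*} [TopologicalSpace X]
variable {k : Type*} [CommRing k] [UniformSpace k] [IsUniformAddGroup k] [IsTopologicalRing k]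
  [BaseRing k]

/-- On a compact set the sum becomes finite and exact: finitely many members of `F` cover the part
of the compact set inside `U`. -/
theorem hasSum_chi {F : Set (Clopens X)} (hF : F.PairwiseDisjoint (fun V => (V : Set X)))
    {U : Clopens X} (hU : (U : Set X) = ⋃ V ∈ F, (V : Set X)) :
    HasSum (fun V : F => chi k V.1) (chi k U) := by
  classical
  refine (((isBasisOfOpenSubmodules_continuousMap X k).2 (chi k U)).tendsto_right_iff).2 ?_
  rintro ⟨K, I⟩ ⟨hK, hI⟩
  obtain ⟨t, ht⟩ := (hK.inter_right U.isClopen.1).elim_finite_subcover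
    (fun V : F => (V.1 : Set X)) (fun V => V.1.isClopen.2) (by
      rintro x ⟨-, hx⟩
      rw [hU] at hx
      simpa using hx)
  filter_upwards [Filter.eventually_ge_atTop t] with s hs
  intro x hx
  have e : (∑ V ∈ s, chi k V.1) x = chi k U x := by
    rw [ContinuousMap.sum_apply]
    by_cases hxU : x ∈ (U : Set X)
    · obtain ⟨V, hV, hxV⟩ := Set.mem_iUnion₂.1 (ht ⟨hx, hxU⟩)
      rw [chi_of_mem hxU, Finset.sum_eq_single V, chi_of_mem hxV]
      · intro V' _ hV'
        refine chi_of_notMem fun h => ?_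
        exact Set.disjoint_left.1 (hF V'.2 V.2 fun h => hV' (Subtype.ext h)) h hxV
      · exact fun h => (h (hs hV)).elim
    · rw [chi_of_notMem hxU]
      refine Finset.sum_eq_zero fun V _ => chi_of_notMem fun h => hxU ?_
      rw [hU]
      exact Set.mem_biUnion V.2 h
  rw [ContinuousMap.sub_apply, e, sub_self]
  exact I.zero_mem

theorem isAcsMeasure_acsSetFunction (μ : DAcs X k) : IsAcsMeasure (acsSetFunction μ) :=
  fun _ hF _ hU => ContinuousLinearMap.hasSum (show C(X, k) →L[k] k from μ) (hasSum_chi hF hU)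

theorem acsSetFunction_injective : Function.Injective (acsSetFunction (X := X) (k := k)) := by
  rw [injective_iff_map_eq_zero]
  intro μ hμ
  refine WkDual.ext fun f => eq_of_forall_sub_mem fun I hI => ?_
  rw [map_zero, sub_zero]
  have := homMod_eq_zero_of_isConstMod (φ := wkReduce ⟨I, hI⟩ μ) (fun d => ?_)
    (isConstMod_levelQuotient f hI)
  · exact (Submodule.Quotient.mk_eq_zero I).1 this
  · have h0 : WkDual.eval (chi k (fibre (levelQuotient f hI) d)) μ = 0 := congrFun hμ _
    exact (Submodule.Quotient.mk_eq_zero I).2 (h0.symm ▸ I.zero_mem)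

variable {m : Clopens X → k}

theorem IsAcsMeasure.bot (hm : IsAcsMeasure m) : m ⊥ = 0 := by
  have := BaseRing.separated (k := k)
  have h := hm ∅ (Set.pairwiseDisjoint_empty) ⊥ (by simp)
  exact h.unique hasSum_empty

/-- Passage from sets of clopen subsets to indexed families. A disjoint family can repeat only the
empty set, which has measure zero, so the family is injective on the indices that matter. -/
theorem IsAcsMeasure.hasSum (hm : IsAcsMeasure m) {ι : Type*} {V : ι → Clopens X}
    (hV : Pairwise fun i j => Disjoint (V i : Set X) (V j)) {U : Clopens X}
    (hU : (U : Set X) = ⋃ i, (V i : Set X)) : HasSum (fun i => m (V i)) (m U) := by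
  have hF : (Set.range V).PairwiseDisjoint (fun V => (V : Set X)) := by
    rintro _ ⟨i, rfl⟩ _ ⟨j, rfl⟩ hij
    exact hV fun h => hij (congrArg V h)
  have h := hm _ hF U (by rw [hU, Set.biUnion_range])
  let g : {i | V i ≠ ⊥} → Set.range V := fun i => ⟨V i, i, rfl⟩
  have hg : Function.Injective g := by
    rintro ⟨i, hi⟩ ⟨j, hj⟩ hij
    have h' : V i = V j := congrArg Subtype.val hij
    by_contra hn
    have hd : Disjoint (V i : Set X) (V j) := hV fun h => hn (Subtype.ext h)
    rw [h', disjoint_self] at hd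
    exact hj (SetLike.coe_injective (by simpa using hd))
  have h2 := (hg.hasSum_iff (f := fun V : Set.range V => m V.1) (a := m U) ?_).2 h
  · refine (hasSum_subtype_iff_of_support_subset fun i hi => ?_).1 h2
    intro h0
    apply hi
    change m (V i) = 0
    rw [h0, hm.bot]
  · rintro ⟨_, i, rfl⟩ hi
    have : V i = ⊥ := by
      by_contra h0
      exact hi ⟨⟨i, h0⟩, rfl⟩
    change m (V i) = 0
    rw [this, hm.bot]

theorem isClopen_of_eventually {S : Set X} (h : ∀ x, ∀ᶠ y in 𝓝 x, (y ∈ S ↔ x ∈ S)) :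
    IsClopen S := by
  refine ⟨⟨isOpen_iff_mem_nhds.2 fun x hx => ?_⟩, isOpen_iff_mem_nhds.2 fun x hx => ?_⟩
  · filter_upwards [h x] with y hy
    exact fun h => hx (hy.1 h)
  · filter_upwards [h x] with y hy
    exact hy.2 hx

/-- The union of a family of clopen sets `V d` in the fibres of a partition. -/
def fibreUnion (D : DiscreteQuotient X) (V : D → Clopens X) : Clopens X :=
  ⟨{x | x ∈ V (D.proj x)}, isClopen_of_eventually fun x => by
    filter_upwards [eventually_proj_eq D x, eventually_mem_iff (V (D.proj x)).isClopen x]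
      with y hy h
    rw [hy]
    exact h⟩

theorem pairwise_disjoint_fibre (D : DiscreteQuotient X) :
    Pairwise fun d e => Disjoint (fibre D d : Set X) (fibre D e) := by
  intro d e hde
  refine Set.disjoint_left.2 fun x hx hx' => hde ?_
  rw [← mem_fibre.1 hx, mem_fibre.1 hx']

theorem IsAcsMeasure.hasSum_fibreUnion (hm : IsAcsMeasure m) (D : DiscreteQuotient X)
    {V : D → Clopens X} (hV : ∀ d, V d ≤ fibre D d) :
    HasSum (fun d => m (V d)) (m (fibreUnion D V)) := by
  refine hm.hasSum (fun d e hde => (pairwise_disjoint_fibre D hde).mono (hV d) (hV e)) ?_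
  ext x
  rw [Set.mem_iUnion]
  constructor
  · exact fun h => ⟨_, h⟩
  · rintro ⟨d, hd⟩
    have := mem_fibre.1 (hV d hd)
    subst this
    exact hd

theorem IsAcsMeasure.hasSum_fibre_inf (hm : IsAcsMeasure m) (D : DiscreteQuotient X)
    (U : Clopens X) : HasSum (fun d => m (fibre D d ⊓ U)) (m U) := by
  have h := hm.hasSum_fibreUnion D (V := fun d => fibre D d ⊓ U) fun d => inf_le_left
  have e : fibreUnion D (fun d => fibre D d ⊓ U) = U := by
    ext x
    exact ⟨fun h => h.2, fun h => ⟨rfl, h⟩⟩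
  rwa [e] at h

theorem IsAcsMeasure.finite_fibre (hm : IsAcsMeasure m) (D : DiscreteQuotient X) {I : Ideal k}
    (hI : IsOpen (I : Set k)) : {d : D | m (fibre D d) ∉ I}.Finite :=
  finite_of_summable (hm.hasSum_fibreUnion D fun _ => le_rfl).summable hI

theorem IsAcsMeasure.summable_mul (hm : IsAcsMeasure m) (D : DiscreteQuotient X) (g : D → k) :
    Summable fun d => g d * m (fibre D d) :=
  summable_of_finite fun _ hI => (hm.finite_fibre D hI).subset fun _ hd h =>
    hd (Ideal.mul_mem_left _ _ h)

/-- Riemann sums do not change under refinement: group the terms over the fibres of `E → D` and use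
additivity of `m` in each group. -/
theorem IsAcsMeasure.hasSum_refine (hm : IsAcsMeasure m) {D E : DiscreteQuotient X} (h : E ≤ D)
    {g : D → k} {a : k} (ha : HasSum (fun d => g d * m (fibre D d)) a) :
    HasSum (fun e => g (DiscreteQuotient.ofLE h e) * m (fibre E e)) a := by
  have := BaseRing.separated (k := k)
  obtain ⟨b, hb⟩ := hm.summable_mul E fun e => g (DiscreteQuotient.ofLE h e)
  have hs := (Equiv.sigmaFiberEquiv (DiscreteQuotient.ofLE h)).hasSum_iff.2 hb
  have h' := hs.sigma (g := fun d => g d * m (fibre D d)) fun d => ?_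
  · rwa [ha.unique h']
  · have h1 : HasSum (fun e : {e // DiscreteQuotient.ofLE h e = d} => m (fibre E e.1))
        (m (fibre D d)) := by
      refine hm.hasSum (fun e e' he => pairwise_disjoint_fibre E fun h => he (Subtype.ext h)) ?_
      ext x
      rw [Set.mem_iUnion]
      constructor
      · intro hx
        exact ⟨⟨E.proj x, by rw [DiscreteQuotient.ofLE_proj]; exact hx⟩, rfl⟩
      · rintro ⟨⟨e, he⟩, hx⟩
        rw [mem_fibre, ← DiscreteQuotient.ofLE_proj h, mem_fibre.1 hx, he]
    refine (h1.mul_left (g d)).congr_fun ?_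
    rintro ⟨e, rfl⟩
    rfl

/-- The value modulo `I` at `f` is the Riemann sum of any step function congruent to `f` modulo `I`.
Passing to a common refinement gives additivity, and a step function with values in `I` has its
Riemann sum in `I`, so the value is well defined. -/
theorem IsAcsMeasure.exists_integral (hm : IsAcsMeasure m) :
    ∃ φ : C(X, k) →ₗ[k] k, ∀ {I : Ideal k}, IsOpen (I : Set k) → ∀ {f : C(X, k)} {a : k},
      (∃ (D : DiscreteQuotient X) (g : D → k), (∀ x, f x - g (D.proj x) ∈ I) ∧
        HasSum (fun d => g d * m (fibre D d)) a) → φ f - a ∈ I := by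
  refine exists_linearMap_of_approx (fun I (f : C(X, k)) a =>
    ∃ (D : DiscreteQuotient X) (g : D → k), (∀ x, f x - g (D.proj x) ∈ I) ∧
        HasSum (fun d => g d * m (fibre D d)) a) ?_ ?_ ?_ ?_ ?_
  · intro I hI f
    exact ⟨_, levelQuotient f hI, fun d => f (Quotient.out d),
      (isConstMod_levelQuotient f hI).sub_out_mem, (hm.summable_mul _ _).hasSum⟩
  · rintro I J hI hIJ f a ⟨D, g, hf, ha⟩
    exact ⟨D, g, fun x => hIJ (hf x), ha⟩
  · rintro I hI f f' a a' ⟨D, g, hf, ha⟩ ⟨D', g', hf', ha'⟩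
    refine ⟨D ⊓ D', fun e => g (DiscreteQuotient.ofLE inf_le_left e) +
      g' (DiscreteQuotient.ofLE inf_le_right e), fun x => ?_, ?_⟩
    · have := I.add_mem (hf x) (hf' x)
      simp only [ContinuousMap.add_apply, DiscreteQuotient.ofLE_proj]
      convert this using 1
      ring
    · simp only [add_mul]
      exact (hm.hasSum_refine inf_le_left ha).add (hm.hasSum_refine inf_le_right ha')
  · rintro I hI c f a ⟨D, g, hf, ha⟩
    refine ⟨D, fun d => c * g d, fun x => ?_, ?_⟩
    · have := I.mul_mem_left c (hf x)
      rwa [mul_sub] at this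
    · simp only [mul_assoc]
      exact ha.mul_left c
  · rintro I hI a ⟨D, g, hf, ha⟩
    refine hasSum_mem ha hI fun d => I.mul_mem_right _ ?_
    obtain ⟨x, rfl⟩ := D.proj_surjective d
    have := hf x
    rw [ContinuousMap.zero_apply, zero_sub, neg_mem_iff] at this
    exact this

/-- In each fibre choose, where possible, a clopen subset with measure outside `I`. The union of the
choices is clopen, so their measures form a convergent series and almost all lie in `I`; hence the
choice was possible in finitely many fibres only. -/
theorem IsAcsMeasure.exists_compact [TDSpace X] (hm : IsAcsMeasure m) {I : Ideal k}
    (hI : IsOpen (I : Set k)) : ∃ (E : DiscreteQuotient X) (A : Set E),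
      IsCompact (E.proj ⁻¹' A) ∧ ∀ e ∉ A, ∀ U ≤ fibre E e, m U ∈ I := by
  obtain ⟨E, hE⟩ := exists_properQuotient X
  have hV : ∀ e : E, ∃ V ≤ fibre E e, (∃ U ≤ fibre E e, m U ∉ I) → m V ∉ I := by
    intro e
    by_cases h : ∃ U ≤ fibre E e, m U ∉ I
    · obtain ⟨U, hU, h'⟩ := h
      exact ⟨U, hU, fun _ => h'⟩
    · exact ⟨⊥, bot_le, fun h' => (h h').elim⟩
  choose V hV hV' using hV
  have hfin := finite_of_summable (hm.hasSum_fibreUnion E hV).summable hI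
  refine ⟨E, {e | m (V e) ∉ I}, ?_, fun e he U hU => ?_⟩
  · have := hfin.isCompact_biUnion fun e _ => hE e
    rwa [Set.biUnion_preimage_singleton] at this
  · by_contra h
    exact he (hV' e ⟨U, hU, h⟩)

theorem IsAcsMeasure.exists_functional [TDSpace X] (hm : IsAcsMeasure m) :
    ∃ μ : DAcs X k, acsSetFunction μ = m := by
  obtain ⟨φ, hφ⟩ := hm.exists_integral
  have hc : Continuous φ := by
    refine (isBasisOfOpenSubmodules_continuousMap X k).isLinearlyTopologized.continuous φ
      fun I hI => ?_
    obtain ⟨E, A, hK, hA⟩ := hm.exists_compact hI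
    refine ⟨valuesIn k (E.proj ⁻¹' A) I, isOpen_valuesIn hK hI, fun f hf => ?_⟩
    have hD : IsConstMod (levelQuotient f hI ⊓ E) I f :=
      (isConstMod_levelQuotient f hI).mono inf_le_left le_rfl
    have hs := (hm.summable_mul (levelQuotient f hI ⊓ E) fun d => f (Quotient.out d)).hasSum
    have h1 := hφ hI ⟨_, _, hD.sub_out_mem, hs⟩
    have h2 := hasSum_mem hs hI fun d => ?_
    · have := I.add_mem h1 h2
      rwa [sub_add_cancel] at this
    -- Each term of the Riemann sum lies in `I`: inside `E.proj ⁻¹' A` because the value of `f`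
    -- does, outside because the value of `m` does.
    · by_cases h : E.proj (Quotient.out d) ∈ A
      · exact I.mul_mem_right _ (hf _ h)
      · refine I.mul_mem_left _ (hA _ h _ fun x hx => ?_)
        refine mem_fibre.2 (proj_eq_of_le (inf_le_right (a := levelQuotient f hI)) ?_)
        rw [proj_out]
        exact hx
  refine ⟨(⟨φ, hc⟩ : C(X, k) →L[k] k), funext fun U => eq_of_forall_sub_mem fun I hI => ?_⟩
  -- For the partition into `U` and its complement the step function is exact, and its Riemann sum
  -- is `m U`.
  refine hφ hI ⟨DiscreteQuotient.ofIsClopen U.isClopen, fun d => chi k U (Quotient.out d), ?_, ?_⟩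
  · have hU : ∀ x y, (DiscreteQuotient.ofIsClopen U.isClopen).proj x =
        (DiscreteQuotient.ofIsClopen U.isClopen).proj y → (x ∈ (U : Set X) ↔ y ∈ (U : Set X)) :=
      fun x y h => (Quotient.eq''.1 h : _)
    intro x
    have := hU x _ (proj_out _ _).symm
    beta_reduce
    by_cases hx : x ∈ (U : Set X)
    · rw [chi_of_mem hx, chi_of_mem (this.1 hx), sub_self]
      exact I.zero_mem
    · rw [chi_of_notMem hx, chi_of_notMem (mt this.2 hx), sub_self]
      exact I.zero_mem
  · refine (hm.hasSum_fibre_inf (DiscreteQuotient.ofIsClopen U.isClopen) U).congr_fun fun d => ?_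
    have hU : ∀ x, x ∈ (fibre (DiscreteQuotient.ofIsClopen U.isClopen) d : Set X) →
        (x ∈ (U : Set X) ↔ Quotient.out d ∈ (U : Set X)) := by
      intro x hx
      exact (Quotient.eq''.1 ((mem_fibre.1 hx).trans (proj_out _ d).symm) : _)
    beta_reduce
    by_cases h : Quotient.out d ∈ (U : Set X)
    · rw [chi_of_mem h, one_mul, inf_eq_left.2 fun x hx => (hU x hx).2 h]
    · have e : fibre (DiscreteQuotient.ofIsClopen U.isClopen) d ⊓ U = ⊥ := by
        ext x
        exact ⟨fun hx => h ((hU x hx.1).1 hx.2), fun hx => hx.elim⟩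
      rw [chi_of_notMem h, zero_mul, e, hm.bot]

theorem range_acsSetFunction [TDSpace X] :
    Set.range (acsSetFunction (X := X) (k := k)) = {m | IsAcsMeasure m} := by
  ext m
  constructor
  · rintro ⟨μ, rfl⟩
    exact isAcsMeasure_acsSetFunction μ
  · exact fun h => IsAcsMeasure.exists_functional h

theorem acsSetFunctionStrong_injective :
    Function.Injective (acsSetFunctionStrong (X := X) (k := k)) :=
  acsSetFunction_injective (X := X) (k := k)

theorem range_acsSetFunctionStrong [TDSpace X] :
    Set.range (acsSetFunctionStrong (X := X) (k := k)) = {m | IsAcsMeasure m} :=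
  range_acsSetFunction (X := X) (k := k)

end AcsMeasures

/-! ### Functions with almost compact support and measures -/

section Measures

variable {X : Type*} [TopologicalSpace X]
variable {k : Type*} [CommRing k] [UniformSpace k] [IsUniformAddGroup k] [IsTopologicalRing k]
  [BaseRing k]

variable (X k) in
/-- The inclusion of the functions with almost compact support into all continuous functions. -/
def acsIncl : CAcs X k →ₗ[k] C(X, k) := (acsSubmodule X k).subtype

theorem acsIncl_apply (f : CAcs X k) : acsIncl X k f = f.1 := rfl

theorem acsIncl_injective : Function.Injective (acsIncl X k) := Subtype.val_injective

variable (X) in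
/-- The functions with almost compact support and values in `I`. -/
def acsValuesIn (I : Ideal k) : Submodule k (CAcs X k) := (valuesIn k Set.univ I).comap (acsIncl X k)

theorem mem_acsValuesIn {I : Ideal k} {f : CAcs X k} :
    f ∈ acsValuesIn X I ↔ ∀ x, f.1 x ∈ I := by
  simp only [acsValuesIn, Submodule.mem_comap]
  exact ⟨fun h x => h x trivial, fun h x _ => h x⟩

variable (X k) in
theorem isBasisOfOpenSubmodules_cAcs :
    IsBasisOfOpenSubmodules (L := CAcs X k) (fun I : Ideal k => IsOpen (I : Set k))
      (fun I => acsValuesIn X I) := by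
  have h := isBasisOfOpenSubmodules_linearTopology (L := CAcs X k)
    (S := {N : Submodule k (CAcs X k) | ∃ I : Ideal k, IsOpen (I : Set k) ∧
      ∀ f : CAcs X k, f ∈ N ↔ ∀ x, f.1 x ∈ I}) rfl
    ⟨acsValuesIn X ⊤, ⊤, isOpen_top_ideal, fun _ => mem_acsValuesIn⟩ ?_
  · refine h.reindex ?_ fun I hI => ⟨acsValuesIn X I, ⟨I, hI, fun _ => mem_acsValuesIn⟩, le_rfl⟩
    rintro N ⟨I, hI, hN⟩
    exact ⟨I, hI, fun f hf => (hN f).2 (mem_acsValuesIn.1 hf)⟩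
  · rintro N ⟨I, hI, hN⟩ N' ⟨I', hI', hN'⟩
    refine ⟨acsValuesIn X (I ⊓ I'), ⟨_, isOpen_inf hI hI', fun _ => mem_acsValuesIn⟩, fun f hf => ?_⟩
    rw [mem_acsValuesIn] at hf
    exact ⟨(hN f).2 fun x => (hf x).1, (hN' f).2 fun x => (hf x).2⟩

/-- The fibre of a proper discrete quotient, as a compact open subset. -/
def compactFibre {D : DiscreteQuotient X} (hD : IsProperQuotient D) (d : D) : CompactOpens X :=
  ⟨⟨D.proj ⁻¹' {d}, hD d⟩, D.isOpen_preimage {d}⟩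

theorem IsProperQuotient.of_le {D E : DiscreteQuotient X} (hD : IsProperQuotient D) (h : E ≤ D) :
    IsProperQuotient E := by
  intro e
  refine (hD (DiscreteQuotient.ofLE h e)).of_isClosed_subset (E.isClosed_preimage _) fun x hx => ?_
  rw [Set.mem_preimage, Set.mem_singleton_iff, ← DiscreteQuotient.ofLE_proj h, ← hx]

theorem IsProperQuotient.isCompact_preimage {D : DiscreteQuotient X} (hD : IsProperQuotient D)
    (s : Finset D) : IsCompact (D.proj ⁻¹' (s : Set D)) := by
  have := s.finite_toSet.isCompact_biUnion fun e _ => hD e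
  rwa [Set.biUnion_preimage_singleton] at this

/-- `f` is constant modulo `I` on the fibres of `D`, and in `I` on the fibres outside `s`. -/
def IsStepMod (D : DiscreteQuotient X) (s : Finset D) (I : Ideal k) (f : X → k) : Prop :=
  IsConstMod D I f ∧ ∀ x, D.proj x ∉ s → f x ∈ I

variable [TDSpace X]

theorem exists_isStepMod (f : CAcs X k) {I : Ideal k} (hI : IsOpen (I : Set k)) :
    ∃ (D : DiscreteQuotient X) (s : Finset D), IsProperQuotient D ∧ IsStepMod D s I f.1 := by
  obtain ⟨E, hE⟩ := exists_properQuotient X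
  obtain ⟨Z, hZ, hf⟩ := f.2 I hI
  refine ⟨levelQuotient f.1 hI ⊓ E, (finite_image_proj _ hZ).toFinset, hE.of_le inf_le_right,
    (isConstMod_levelQuotient f.1 hI).mono inf_le_left le_rfl, fun x hx => hf x fun h => hx ?_⟩
  simpa using ⟨x, h, rfl⟩

theorem chiAcs_apply (C : CompactOpens X) (x : X) :
    (chiAcs k C).1 x = chi k (compactOpenClopen C) x := rfl

theorem acsIncl_chiAcs_compactFibre {D : DiscreteQuotient X} (hD : IsProperQuotient D) (d : D) :
    acsIncl X k (chiAcs k (compactFibre hD d)) = chi k (fibre D d) := rfl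

theorem IsStepMod.sub_sum_mem {D : DiscreteQuotient X} {s : Finset D} {I : Ideal k} {f : CAcs X k}
    (hf : IsStepMod D s I f.1) (hD : IsProperQuotient D) :
    f - ∑ d ∈ s, f.1 (Quotient.out d) • chiAcs k (compactFibre hD d) ∈ acsValuesIn X I := by
  intro x _
  rw [map_sub, map_sum]
  simp only [map_smul, acsIncl_chiAcs_compactFibre]
  rw [ContinuousMap.sub_apply]
  by_cases hx : D.proj x ∈ s
  · rw [sum_smul_chi_fibre_apply s (fun d => f.1 (Quotient.out d)) hx]
    exact hf.1.sub_out_mem x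
  · rw [ContinuousMap.sum_apply, Finset.sum_eq_zero, sub_zero]
    · exact hf.2 x hx
    · intro d hd
      rw [ContinuousMap.smul_apply, chi_of_notMem, smul_zero]
      rintro rfl
      exact hx hd

/-- As for `C(X, k)`, but almost compact support allows approximation by finite step functions
uniformly on `X`. Hence one open submodule, the same for all maps modulo `Q`, is killed. -/
theorem homMod_acsValuesIn_le {Q : OpenSub k k} (φ : HomMod k (CAcs X k) (k ⧸ Q.1)) :
    acsValuesIn X Q.1 ≤ LinearMap.ker φ.1 := by
  obtain ⟨P, hP, hφ⟩ := φ.2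
  obtain ⟨I, hI, hIP⟩ := (isBasisOfOpenSubmodules_cAcs X k).isOpen_iff.1 hP
  intro f hf
  rw [mem_acsValuesIn] at hf
  obtain ⟨D, s, hD, hs⟩ := exists_isStepMod f hI
  have h := hφ (hIP (hs.sub_sum_mem hD))
  rw [LinearMap.mem_ker, map_sub, sub_eq_zero] at h
  rw [LinearMap.mem_ker, h, map_sum]
  refine Finset.sum_eq_zero fun d hd => ?_
  rw [map_smul]
  exact mk_smul_eq_zero (hf _) _

theorem eval_mem_of_acsValuesIn (μ : DMeas X k) {I : Ideal k} (hI : IsOpen (I : Set k))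
    {f : CAcs X k} (hf : ∀ x, f.1 x ∈ I) : WkDual.eval f μ ∈ I :=
  (Submodule.Quotient.mk_eq_zero I).1
    (homMod_acsValuesIn_le (wkReduce ⟨I, hI⟩ μ) (mem_acsValuesIn.2 hf))

variable (X k) in
-- All maps modulo `Q` kill `acsValuesIn X Q`, so finite sets suffice as null sets, and
-- approximation on a single vector already gives continuity.
theorem wkDual_cAcs_toLim_bijective : Function.Bijective (WkDual.toLim k (CAcs X k)) := by
  refine wkDual_toLim_bijective (isBasisOfOpenSubmodules_cAcs X k).isLinearlyTopologized
    (fun Q W => ?_) fun φ hφ I hI => ?_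
  · obtain ⟨F, hF⟩ := W.2.1 _ ((isBasisOfOpenSubmodules_cAcs X k).1 Q.1 Q.2)
    exact ⟨F, IsNullSet.of_finite F.finite_toSet, fun φ hφ =>
      hF φ (homMod_acsValuesIn_le φ) fun m hm => hφ m hm⟩
  · refine ⟨acsValuesIn X I, (isBasisOfOpenSubmodules_cAcs X k).1 I hI, fun f hf => ?_⟩
    obtain ⟨ψ, hψ⟩ := hφ ⟨I, hI⟩ _ (isNullSet_singleton f)
    have h := hψ f rfl
    rw [LinearMap.mem_ker.1 (homMod_acsValuesIn_le ψ hf)] at h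
    exact (Submodule.Quotient.mk_eq_zero I).1 h.symm

theorem IsStepMod.eval_mem {D : DiscreteQuotient X} {s : Finset D} {I : Ideal k} {f : CAcs X k}
    (hf : IsStepMod D s I f.1) (hD : IsProperQuotient D) (hI : IsOpen (I : Set k)) {μ : DMeas X k}
    (hμ : ∀ d ∈ s, WkDual.eval (chiAcs k (compactFibre hD d)) μ ∈ I) : WkDual.eval f μ ∈ I := by
  have h := eval_mem_of_acsValuesIn μ hI (mem_acsValuesIn.1 (hf.sub_sum_mem hD))
  have h' : WkDual.eval (∑ d ∈ s, f.1 (Quotient.out d) • chiAcs k (compactFibre hD d)) μ ∈ I := by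
    have e : WkDual.eval (∑ d ∈ s, f.1 (Quotient.out d) • chiAcs k (compactFibre hD d)) μ =
        ∑ d ∈ s, f.1 (Quotient.out d) * WkDual.eval (chiAcs k (compactFibre hD d)) μ := by
      refine (map_sum (show CAcs X k →L[k] k from μ) _ _).trans (Finset.sum_congr rfl fun d _ => ?_)
      exact map_smul (show CAcs X k →L[k] k from μ) _ _
    rw [e]
    exact I.sum_mem fun d hd => I.mul_mem_left _ (hμ d hd)
  have e : WkDual.eval (f - ∑ d ∈ s, f.1 (Quotient.out d) • chiAcs k (compactFibre hD d)) μ =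
      WkDual.eval f μ - WkDual.eval (∑ d ∈ s, f.1 (Quotient.out d) •
        chiAcs k (compactFibre hD d)) μ := map_sub (show CAcs X k →L[k] k from μ) _ _
  rw [e] at h
  have := I.add_mem h h'
  rwa [sub_add_cancel] at this

variable (X k) in
theorem isBasisOfOpenSubmodules_measNhd :
    IsBasisOfOpenSubmodules
      (fun p : Finset (CompactOpens X) × Ideal k => IsOpen (p.2 : Set k))
      (fun p => measNhd p.1 p.2) := by
  classical
  refine isBasisOfOpenSubmodules_wkDual_of ?_ fun Q W => ?_
  · rintro ⟨F, I⟩ hI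
    refine ⟨⟨I, hI⟩, chiAcs k '' F, IsNullSet.of_finite (F.finite_toSet.image _), fun μ hμ => ?_⟩
    simp only [measNhd, Submodule.mem_iInf, Submodule.mem_comap]
    exact fun C hC => hμ _ ⟨C, hC, rfl⟩
  · obtain ⟨F, hF⟩ := W.2.1 _ ((isBasisOfOpenSubmodules_cAcs X k).1 Q.1 Q.2)
    choose D s hD hs using fun f : CAcs X k => exists_isStepMod f Q.2
    -- The finite test set `F` of functions is replaced by the fibres that occur in step
    -- approximations modulo `Q` of its members.
    refine ⟨(F.biUnion fun f => (s f).image (compactFibre (hD f)), Q.1), Q.2, fun μ hμ =>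
      hF _ (homMod_acsValuesIn_le _) fun f hf => ?_⟩
    simp only [measNhd, Submodule.mem_iInf, Submodule.mem_comap] at hμ
    refine (Submodule.Quotient.mk_eq_zero Q.1).2 ((hs f).eval_mem (hD f) Q.2 fun d hd => ?_)
    exact hμ _ (Finset.mem_biUnion.2 ⟨f, hf, Finset.mem_image_of_mem _ hd⟩)

theorem measSetFunction_injective : Function.Injective (measSetFunction (X := X) (k := k)) := by
  rw [injective_iff_map_eq_zero]
  intro μ hμ
  refine WkDual.ext fun f => eq_of_forall_sub_mem fun I hI => ?_
  rw [map_zero, sub_zero]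
  obtain ⟨D, s, hD, hs⟩ := exists_isStepMod f hI
  refine hs.eval_mem hD hI fun d _ => ?_
  have h0 : WkDual.eval (chiAcs k (compactFibre hD d)) μ = 0 := congrFun hμ _
  rw [h0]
  exact I.zero_mem

theorem isFinAddMeasure_measSetFunction (μ : DMeas X k) : IsFinAddMeasure (measSetFunction μ) := by
  intro F hF
  have e : chiAcs k (F.sup id) = ∑ C ∈ F, chiAcs k C := by
    apply acsIncl_injective
    rw [map_sum]
    ext x
    rw [ContinuousMap.sum_apply]
    change chi k (compactOpenClopen (F.sup id)) x = ∑ C ∈ F, chi k (compactOpenClopen C) x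
    have hmem : x ∈ (compactOpenClopen (F.sup id) : Set X) ↔ ∃ C ∈ F, x ∈ (C : Set X) := by
      change x ∈ ((F.sup id : CompactOpens X) : Set X) ↔ _
      simp
    by_cases hx : ∃ C ∈ F, x ∈ (C : Set X)
    · rw [chi_of_mem (hmem.2 hx)]
      obtain ⟨C, hC, hxC⟩ := hx
      rw [Finset.sum_eq_single C, chi_of_mem (U := compactOpenClopen C) hxC]
      · intro C' hC' hne
        refine chi_of_notMem fun h => ?_
        exact Set.disjoint_left.1 (hF hC' hC hne) h hxC
      · exact fun h => (h hC).elim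
    · rw [chi_of_notMem (mt hmem.1 hx)]
      exact (Finset.sum_eq_zero fun C hC => chi_of_notMem fun h => hx ⟨C, hC, h⟩).symm
  change (show CAcs X k →L[k] k from μ) (chiAcs k (F.sup id)) = _
  rw [e, map_sum]
  rfl

/-- The sum of functionals on `C(X, k)` which live on the fibres of a partition is a functional on the
functions with almost compact support. -/
theorem exists_hasSum_dMeas (E : DiscreteQuotient X) (μ : E → DAcs X k)
    (hμ : ∀ e f, WkDual.eval f (μ e) = WkDual.eval (chi k (fibre E e) * f) (μ e)) :
    ∃ ν : DMeas X k, ∀ f : CAcs X k, HasSum (fun e => WkDual.eval f.1 (μ e)) (WkDual.eval f ν) := by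
  have := BaseRing.separated (k := k)
  have hmem : ∀ {I : Ideal k} (_ : IsOpen (I : Set k)) (e : E) (f : C(X, k)),
      (∀ x, E.proj x = e → f x ∈ I) → WkDual.eval f (μ e) ∈ I := by
    intro I hI e f hf
    rw [hμ]
    refine wkEval_mem_of_valuesIn _ hI fun x => ?_
    rw [ContinuousMap.mul_apply]
    by_cases hx : E.proj x = e
    · exact I.mul_mem_left _ (hf x hx)
    · rw [chi_of_notMem (mt mem_fibre.1 hx), zero_mul]
      exact I.zero_mem
  -- Modulo `I`, only the fibres that meet the compact set `Z`, off which `f` lies in `I`,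
  -- contribute.
  have hs : ∀ f : CAcs X k, Summable fun e => WkDual.eval f.1 (μ e) := by
    intro f
    refine summable_of_finite fun I hI => ?_
    obtain ⟨Z, hZ, hf⟩ := f.2 I hI
    refine (finite_image_proj E hZ).subset fun e he => ?_
    by_contra hn
    exact he (hmem hI e f.1 fun x hx => hf x fun h => hn ⟨x, h, hx⟩)
  let φ : CAcs X k →ₗ[k] k :=
    { toFun := fun f => ∑' e, WkDual.eval f.1 (μ e)
      map_add' := fun f g => by
        rw [← (hs f).tsum_add (hs g)]
        exact tsum_congr fun e => map_add (show C(X, k) →L[k] k from μ e) f.1 g.1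
      map_smul' := fun c f => by
        rw [RingHom.id_apply, smul_eq_mul, ← (hs f).tsum_mul_left]
        exact tsum_congr fun e => map_smul (show C(X, k) →L[k] k from μ e) c f.1 }
  have hc : Continuous φ := by
    refine (isBasisOfOpenSubmodules_cAcs X k).continuous (isBasisOfOpenSubmodules_self k) φ
      fun I hI => ⟨I, hI, fun f hf => ?_⟩
    exact tsum_mem hI fun e => hmem hI e f.1 fun x _ => mem_acsValuesIn.1 hf x
  exact ⟨(⟨φ, hc⟩ : CAcs X k →L[k] k), fun f => (hs f).hasSum⟩

/-- The intersection of a compact open and a clopen subset. -/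
def interClopen (C : CompactOpens X) (U : Clopens X) : CompactOpens X :=
  ⟨⟨C ∩ U, C.isCompact.inter_right U.isClopen.1⟩, C.isOpen.inter U.isClopen.2⟩

variable {m : CompactOpens X → k}

theorem IsFinAddMeasure.bot (hm : IsFinAddMeasure m) : m ⊥ = 0 := by
  simpa using hm ∅ (by simp)

theorem IsFinAddMeasure.sup (hm : IsFinAddMeasure m) {A B : CompactOpens X}
    (h : Disjoint (A : Set X) B) : m (A ⊔ B) = m A + m B := by
  classical
  -- If `A = B`, the finite set `{A, B}` has one element and its sum one term; both sets are then
  -- empty.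
  by_cases hAB : A = B
  · subst hAB
    have : A = ⊥ := SetLike.coe_injective (by simpa using h)
    rw [this, sup_idem, hm.bot, add_zero]
  · have := hm {A, B} (by
      rw [Finset.coe_pair]
      rintro C (rfl | rfl) C' (rfl | rfl) hne
      exacts [(hne rfl).elim, h, h.symm, (hne rfl).elim])
    rwa [Finset.sup_insert, Finset.sup_singleton, Finset.sum_pair hAB] at this

theorem IsFinAddMeasure.sum (hm : IsFinAddMeasure m) {ι : Type*} (s : Finset ι)
    {V : ι → CompactOpens X} (hV : Pairwise fun i j => Disjoint (V i : Set X) (V j)) :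
    m (s.sup V) = ∑ i ∈ s, m (V i) := by
  classical
  induction s using Finset.induction_on with
  | empty => simpa using hm.bot
  | insert i s hi ih =>
    rw [Finset.sup_insert, Finset.sum_insert hi, ← ih]
    refine hm.sup ?_
    rw [CompactOpens.coe_finsetSup, Set.disjoint_iUnion₂_right]
    exact fun j hj => hV fun h => hi (h ▸ hj)

/-- By compactness of `C ∩ U`, only finitely many members of a disjoint clopen cover meet it, so
unconditional additivity reduces to finite additivity. -/
theorem IsFinAddMeasure.isAcsMeasure_inter (hm : IsFinAddMeasure m) (C : CompactOpens X) :
    IsAcsMeasure fun U : Clopens X => m (interClopen C U) := by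
  classical
  intro F hF U hU
  obtain ⟨t, ht⟩ := (interClopen C U).isCompact.elim_finite_subcover
    (fun V : F => (V.1 : Set X)) (fun V => V.1.isClopen.2) (by
      rintro x ⟨-, hx⟩
      rw [hU] at hx
      simpa using hx)
  have h := hasSum_sum_of_ne_finset_zero (L := .unconditional _) (f := fun V : F => m (interClopen C V.1)) (s := t) ?_
  · have e : t.sup (fun V : F => interClopen C V.1) = interClopen C U := by
      apply SetLike.coe_injective
      rw [CompactOpens.coe_finsetSup]
      ext x
      rw [Set.mem_iUnion₂]
      constructor
      · rintro ⟨V, hV, hx⟩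
        refine ⟨hx.1, ?_⟩
        rw [hU]
        exact Set.mem_biUnion V.2 hx.2
      · intro hx
        obtain ⟨V, hV, hxV⟩ := Set.mem_iUnion₂.1 (ht hx)
        exact ⟨V, hV, hx.1, hxV⟩
    rw [← hm.sum t, e] at h
    · exact h
    · intro V V' hVV'
      exact (hF V.2 V'.2 fun h => hVV' (Subtype.ext h)).mono Set.inter_subset_right
        Set.inter_subset_right
  · intro V hV
    have : interClopen C V.1 = ⊥ := by
      apply SetLike.coe_injective
      refine Set.eq_empty_of_forall_notMem fun x hx => ?_
      have hxU : x ∈ (U : Set X) := by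
        rw [hU]
        exact Set.mem_biUnion V.2 hx.2
      obtain ⟨V', hV', hxV'⟩ := Set.mem_iUnion₂.1 (ht ⟨hx.1, hxU⟩)
      refine Set.disjoint_left.1 (hF V.2 V'.2 fun h => hV ?_) hx.2 hxV'
      rwa [Subtype.ext h]
    rw [this, hm.bot]

theorem eval_eq_eval_chi_mul {μ : DAcs X k} {V : Clopens X}
    (h : ∀ U, acsSetFunction μ U = acsSetFunction μ (V ⊓ U)) (f : C(X, k)) :
    WkDual.eval f μ = WkDual.eval (chi k V * f) μ := by
  have e : μ = WkDual.transpose (mulC (chi k V)) μ := by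
    apply acsSetFunction_injective
    funext U
    rw [h]
    change WkDual.eval (chi k (V ⊓ U)) μ = WkDual.eval (chi k V * chi k U) μ
    rw [chi_inf]
  exact congrArg (WkDual.eval f) e

/-- Restricted to one compact fibre of a partition, `m` is unconditionally additive and comes from a
functional on `C(X, k)`; the sum of these functionals converges on functions with almost compact
support. -/
theorem IsFinAddMeasure.exists_functional (hm : IsFinAddMeasure m) :
    ∃ μ : DMeas X k, measSetFunction μ = m := by
  classical
  have := BaseRing.separated (k := k)
  obtain ⟨E, hE⟩ := exists_properQuotient X
  choose μ hμ using fun e => (hm.isAcsMeasure_inter (compactFibre hE e)).exists_functional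
  obtain ⟨ν, hν⟩ := exists_hasSum_dMeas E μ fun e f => eval_eq_eval_chi_mul (fun U => by
    rw [hμ]
    refine congrArg m (SetLike.coe_injective ?_)
    change E.proj ⁻¹' {e} ∩ (U : Set X) = E.proj ⁻¹' {e} ∩ (E.proj ⁻¹' {e} ∩ U)
    rw [← Set.inter_assoc, Set.inter_self]) f
  refine ⟨ν, funext fun C => ?_⟩
  refine (hν (chiAcs k C)).unique ?_
  have hv : ∀ e, WkDual.eval (chiAcs k C).1 (μ e) =
      m (interClopen (compactFibre hE e) (compactOpenClopen C)) := fun e =>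
    congrFun (hμ e) (compactOpenClopen C)
  simp only [hv]
  have h := hasSum_sum_of_ne_finset_zero (L := .unconditional _) (s := (finite_image_proj E C.isCompact).toFinset)
    (f := fun e => m (interClopen (compactFibre hE e) (compactOpenClopen C))) ?_
  · rw [← hm.sum] at h
    · convert h using 2
      apply SetLike.coe_injective
      rw [CompactOpens.coe_finsetSup]
      ext x
      rw [Set.mem_iUnion₂]
      constructor
      · intro hx
        exact ⟨E.proj x, by simpa using ⟨x, hx, rfl⟩, rfl, hx⟩
      · rintro ⟨e, -, hx⟩
        exact hx.2
    · exact fun e e' h => (pairwise_disjoint_fibre E h).mono Set.inter_subset_left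
        Set.inter_subset_left
  · intro e he
    have : interClopen (compactFibre hE e) (compactOpenClopen C) = ⊥ := by
      apply SetLike.coe_injective
      refine Set.eq_empty_of_forall_notMem fun x hx => he ?_
      simpa using ⟨x, hx.2, hx.1⟩
    rw [this, hm.bot]

theorem range_measSetFunction :
    Set.range (measSetFunction (X := X) (k := k)) = {m | IsFinAddMeasure m} := by
  ext m
  constructor
  · rintro ⟨μ, rfl⟩
    exact isFinAddMeasure_measSetFunction μ
  · exact fun h => IsFinAddMeasure.exists_functional h

theorem measSetFunctionStrong_injective :
    Function.Injective (measSetFunctionStrong (X := X) (k := k)) :=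
  measSetFunction_injective (X := X) (k := k)

theorem range_measSetFunctionStrong :
    Set.range (measSetFunctionStrong (X := X) (k := k)) = {m | IsFinAddMeasure m} :=
  range_measSetFunction (X := X) (k := k)

end Measures

/-! ### Division of measures, and the strong topology -/

section Division

variable {X : Type*} [TopologicalSpace X] [TDSpace X]
variable {k : Type*} [CommRing k] [UniformSpace k] [IsUniformAddGroup k] [IsTopologicalRing k]
  [BaseRing k]

/-- Nöbeling's theorem, for the profinite set `C`. -/
theorem free_locallyConstant_int (C : CompactOpens X) :
    Module.Free ℤ (LocallyConstant (C : Set X) ℤ) := by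
  have := totallySeparatedSpace_of_t0_of_basis_clopen (TDSpace.clopen_basis (X := X))
  have : CompactSpace (C : Set X) := isCompact_iff_compactSpace.1 C.isCompact
  exact LocallyConstant.freeOfProfinite (Profinite.of (C : Set X))

open Classical in
/-- Extension by zero of a locally constant integral function. -/
def extendZero (C : CompactOpens X) (g : LocallyConstant (C : Set X) ℤ) : C(X, k) where
  toFun x := if h : x ∈ (C : Set X) then ((g ⟨x, h⟩ : ℤ) : k) else 0
  continuous_toFun := by
    refine IsLocallyConstant.continuous ((IsLocallyConstant.iff_eventually_eq _).2 fun x => ?_)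
    by_cases hx : x ∈ (C : Set X)
    · have h1 : ∀ᶠ y in 𝓝 (⟨x, hx⟩ : (C : Set X)), g y = g ⟨x, hx⟩ :=
        (IsLocallyConstant.iff_eventually_eq _).1 g.isLocallyConstant _
      have h2 := (C.isOpen.isOpenEmbedding_subtypeVal).map_nhds_eq ⟨x, hx⟩
      have h3 : ∀ᶠ y in 𝓝 x, ∃ h : y ∈ (C : Set X), g ⟨y, h⟩ = g ⟨x, hx⟩ := by
        rw [← h2, Filter.eventually_map]
        filter_upwards [h1] with y hy
        exact ⟨y.2, hy⟩
      filter_upwards [h3] with y ⟨hy, hyx⟩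
      rw [dif_pos hy, dif_pos hx, hyx]
    · filter_upwards [C.isCompact.isClosed.isOpen_compl.mem_nhds hx] with y hy
      rw [dif_neg hy, dif_neg hx]

theorem extendZero_of_mem {C : CompactOpens X} (g : LocallyConstant (C : Set X) ℤ) {x : X}
    (h : x ∈ (C : Set X)) : extendZero (k := k) C g x = ((g ⟨x, h⟩ : ℤ) : k) := dif_pos h

theorem extendZero_of_notMem {C : CompactOpens X} (g : LocallyConstant (C : Set X) ℤ) {x : X}
    (h : x ∉ (C : Set X)) : extendZero (k := k) C g x = 0 := dif_neg h

/-- The trace on `C` of the characteristic function of a compact open subset. -/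
def charOn (C C' : CompactOpens X) : LocallyConstant (C : Set X) ℤ :=
  LocallyConstant.charFn ℤ (U := Subtype.val ⁻¹' (C' : Set X))
    ⟨C'.isCompact.isClosed.preimage continuous_subtype_val,
      C'.isOpen.preimage continuous_subtype_val⟩

open Classical in
theorem charOn_apply (C C' : CompactOpens X) (x : (C : Set X)) :
    charOn C C' x = if x.1 ∈ (C' : Set X) then 1 else 0 := by
  change Set.indicator (Subtype.val ⁻¹' (C' : Set X)) (1 : {x // x ∈ (C : Set X)} → ℤ) x = _
  simp [Set.indicator_apply]

theorem charOn_finset_sup (C : CompactOpens X) (F : Finset (CompactOpens X))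
    (hF : (F : Set (CompactOpens X)).PairwiseDisjoint (fun C => (C : Set X))) :
    charOn C (F.sup id) = ∑ C' ∈ F, charOn C C' := by
  classical
  ext x
  have e : (∑ C' ∈ F, charOn C C') x = ∑ C' ∈ F, charOn C C' x :=
    map_sum (LocallyConstant.evalAddMonoidHom x) _ F
  rw [e]
  simp only [charOn_apply, CompactOpens.coe_finsetSup, id_eq]
  by_cases hx : ∃ C' ∈ F, x.1 ∈ (C' : Set X)
  · obtain ⟨C', hC', hxC⟩ := hx
    rw [if_pos (Set.mem_iUnion₂.2 ⟨C', hC', hxC⟩), Finset.sum_eq_single C', if_pos hxC]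
    · intro C'' hC'' hne
      exact if_neg fun h => Set.disjoint_left.1 (hF hC'' hC' hne) h hxC
    · exact fun h => (h hC').elim
  · rw [if_neg, Finset.sum_eq_zero]
    · exact fun C' hC' => if_neg fun h => hx ⟨C', hC', h⟩
    · intro h
      obtain ⟨C', hC', h'⟩ := Set.mem_iUnion₂.1 h
      exact hx ⟨C', hC', h'⟩

theorem eval_mem_of_chi {μ : DAcs X k} {I : Ideal k} (hI : IsOpen (I : Set k))
    (h : ∀ U, acsSetFunction μ U ∈ I) (f : C(X, k)) : WkDual.eval f μ ∈ I :=
  (Submodule.Quotient.mk_eq_zero I).1 (homMod_eq_zero_of_isConstMod (φ := wkReduce ⟨I, hI⟩ μ)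
    (fun _ => (Submodule.Quotient.mk_eq_zero I).2 (h _)) (isConstMod_levelQuotient f hI))

theorem mem_span_range_mul_iff {r : ℕ} (a : Fin r → k) (I : Ideal k) (x : k) :
    x ∈ Ideal.span (Set.range a) * I ↔ ∃ b : Fin r → k, (∀ i, b i ∈ I) ∧ ∑ i, a i * b i = x := by
  rw [mul_comm, ← smul_eq_mul, Ideal.span, Submodule.mem_ideal_smul_span_iff_exists_sum]
  constructor
  · rintro ⟨b, hb, rfl⟩
    refine ⟨b, hb, ?_⟩
    rw [Finsupp.sum_fintype _ _ (by simp)]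
    simp [mul_comm]
  · rintro ⟨b, hb, rfl⟩
    refine ⟨Finsupp.equivFunOnFinite.symm b, hb, ?_⟩
    rw [Finsupp.sum_fintype _ _ (by simp)]
    simp [mul_comm]

/-- A measure on a compact open set with values in `(a₁, …, aᵣ) I` is a combination of the `aᵢ` with
coefficients measures with values in `I`; this rests on the freeness of the group of locally constant
integral functions on a profinite set. -/
theorem exists_division {μ : DAcs X k} {C : CompactOpens X}
    (hμ : ∀ f, WkDual.eval f μ = WkDual.eval (chi k (compactOpenClopen C) * f) μ)
    {r : ℕ} (a : Fin r → k) {I : Ideal k} (hI : IsOpen (I : Set k))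
    (hJ : ∀ f, WkDual.eval f μ ∈ Ideal.span (Set.range a) * I) :
    ∃ ν : Fin r → DAcs X k, (∀ i f, WkDual.eval f (ν i) ∈ I) ∧
      (∀ i f, WkDual.eval f (ν i) = WkDual.eval (chi k (compactOpenClopen C) * f) (ν i)) ∧
      μ = ∑ i, a i • ν i := by
  have := free_locallyConstant_int C
  let J : Ideal k := Ideal.span (Set.range a) * I
  let u : (Fin r → I) →ₗ[ℤ] J := AddMonoidHom.toIntLinearMap
    { toFun := fun b => ⟨∑ i, a i * b i, (mem_span_range_mul_iff a I _).2
        ⟨fun i => b i, fun i => (b i).2, rfl⟩⟩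
      map_zero' := by ext; simp
      map_add' := fun b b' => by ext; simp [mul_add, Finset.sum_add_distrib] }
  have hu : Function.Surjective u := by
    rintro ⟨x, hx⟩
    obtain ⟨b, hb, rfl⟩ := (mem_span_range_mul_iff a I _).1 hx
    exact ⟨fun i => ⟨b i, hb i⟩, rfl⟩
  have hadd : ∀ g g' : LocallyConstant (C : Set X) ℤ,
      extendZero (k := k) C (g + g') = extendZero C g + extendZero C g' := by
    intro g g'
    ext x
    rw [ContinuousMap.add_apply]
    by_cases hx : x ∈ (C : Set X)
    · rw [extendZero_of_mem _ hx, extendZero_of_mem _ hx, extendZero_of_mem _ hx]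
      simp
    · rw [extendZero_of_notMem _ hx, extendZero_of_notMem _ hx, extendZero_of_notMem _ hx, add_zero]
  let L : LocallyConstant (C : Set X) ℤ →ₗ[ℤ] J := AddMonoidHom.toIntLinearMap
    (AddMonoidHom.mk' (fun g => ⟨WkDual.eval (extendZero C g) μ, hJ _⟩) fun g g' => by
      apply Subtype.ext
      change WkDual.eval (extendZero C (g + g')) μ = _
      rw [hadd]
      exact map_add (show C(X, k) →L[k] k from μ) _ _)
  -- Freeness over `ℤ` lifts the integral of integer-valued functions through the surjection `(b i)
  -- ↦ ∑ a i * b i`. An additive lift is enough: its components are finitely additive set functions,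
  -- hence measures.
  obtain ⟨L', hL'⟩ := Module.projective_lifting_property u L hu
  let m : Fin r → CompactOpens X → k := fun i C' => (L' (charOn C C') i : k)
  have hm : ∀ i, IsFinAddMeasure (m i) := by
    intro i F hF
    change ((L' (charOn C (F.sup id)) i : I) : k) = _
    rw [charOn_finset_sup C F hF, map_sum, Finset.sum_apply, AddSubmonoidClass.coe_finsetSum]
  choose ν hν using fun i => ((hm i).isAcsMeasure_inter C).exists_functional
  refine ⟨ν, fun i => eval_mem_of_chi hI fun U => ?_, fun i => eval_eq_eval_chi_mul fun U => ?_, ?_⟩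
  · rw [hν]
    exact (L' _ i).2
  · rw [hν]
    refine congrArg (m i) (SetLike.coe_injective ?_)
    change (C : Set X) ∩ (U : Set X) = (C : Set X) ∩ ((C : Set X) ∩ U)
    rw [← Set.inter_assoc, Set.inter_self]
  · apply acsSetFunction_injective
    funext U
    rw [map_sum, Finset.sum_apply]
    simp only [map_smul, hν, Pi.smul_apply, smul_eq_mul]
    have h1 : WkDual.eval (extendZero C (charOn C (interClopen C U))) μ =
        ∑ i, a i * (L' (charOn C (interClopen C U)) i : k) :=
      (congrArg Subtype.val (LinearMap.congr_fun hL' (charOn C (interClopen C U)))).symm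
    have h2 : extendZero (k := k) C (charOn C (interClopen C U)) =
        chi k (compactOpenClopen C) * chi k U := by
      classical
      ext x
      rw [ContinuousMap.mul_apply]
      by_cases hx : x ∈ (C : Set X)
      · rw [extendZero_of_mem _ hx, charOn_apply, chi_of_mem (U := compactOpenClopen C) hx, one_mul]
        by_cases hU : x ∈ (U : Set X)
        · rw [if_pos ⟨hx, hU⟩, chi_of_mem hU, Int.cast_one]
        · rw [if_neg fun h => hU h.2, chi_of_notMem hU, Int.cast_zero]
      · rw [extendZero_of_notMem _ hx, chi_of_notMem (U := compactOpenClopen C) hx, zero_mul]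
    rw [h2, ← hμ] at h1
    exact h1

/-! ### Gluing the divided measures over a partition. -/

theorem hasSum_chi_mul (E : DiscreteQuotient X) (f : C(X, k)) :
    HasSum (fun e => chi k (fibre E e) * f) f := by
  classical
  refine (((isBasisOfOpenSubmodules_continuousMap X k).2 f).tendsto_right_iff).2 ?_
  rintro ⟨K, I⟩ ⟨hK, hI⟩
  filter_upwards [Filter.eventually_ge_atTop (finite_image_proj E hK).toFinset] with s hs
  intro x hx
  have h2 := sum_smul_chi_fibre_apply s (fun _ => (1 : k)) (x := x)
    (hs (by simpa using ⟨x, hx, rfl⟩))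
  simp only [one_smul] at h2
  rw [← Finset.sum_mul, ContinuousMap.sub_apply, ContinuousMap.mul_apply, h2, one_mul, sub_self]
  exact I.zero_mem

theorem chi_mul_chi_mul (U : Clopens X) (f : C(X, k)) : chi k U * (chi k U * f) = chi k U * f := by
  rw [← mul_assoc, ← chi_inf, inf_idem]

/-- The sum of functionals that tend to zero uniformly. -/
theorem exists_hasSum_dAcs {ι : Type*} (μ : ι → DAcs X k)
    (hμ : ∀ I : Ideal k, IsOpen (I : Set k) → {i | ∃ f, WkDual.eval f (μ i) ∉ I}.Finite) :
    ∃ ν : DAcs X k, ∀ f, HasSum (fun i => WkDual.eval f (μ i)) (WkDual.eval f ν) := by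
  have := BaseRing.separated (k := k)
  have hs : ∀ f, Summable fun i => WkDual.eval f (μ i) := fun f =>
    summable_of_finite fun I hI => (hμ I hI).subset fun i hi => ⟨f, hi⟩
  let φ : C(X, k) →ₗ[k] k :=
    { toFun := fun f => ∑' i, WkDual.eval f (μ i)
      map_add' := fun f g => by
        rw [← (hs f).tsum_add (hs g)]
        exact tsum_congr fun i => map_add (show C(X, k) →L[k] k from μ i) f g
      map_smul' := fun c f => by
        rw [RingHom.id_apply, smul_eq_mul, ← (hs f).tsum_mul_left]
        exact tsum_congr fun i => map_smul (show C(X, k) →L[k] k from μ i) c f }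
  have hc : Continuous φ := by
    refine (isBasisOfOpenSubmodules_continuousMap X k).isLinearlyTopologized.continuous φ
      fun I hI => ?_
    -- Only finitely many `μ i` take a value outside `I`, so the conditions imposed on `f` define an
    -- open submodule.
    refine ⟨⨅ i ∈ (hμ I hI).toFinset, Submodule.comap
      ((show C(X, k) →L[k] k from μ i) : C(X, k) →ₗ[k] k) I, ?_, fun f hf => ?_⟩
    · rw [Submodule.coe_iInf]
      simp only [Submodule.coe_iInf]
      exact isOpen_biInter_finset fun i _ => hI.preimage (show C(X, k) →L[k] k from μ i).continuous
    · simp only [Submodule.mem_iInf] at hf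
      refine tsum_mem hI fun i => ?_
      by_cases hi : i ∈ (hμ I hI).toFinset
      · exact hf i hi
      · by_contra hn
        exact hi (by simpa using ⟨f, hn⟩)
  exact ⟨(⟨φ, hc⟩ : C(X, k) →L[k] k), fun f => (hs f).hasSum⟩

theorem exists_fin_span_isOpen {I : Ideal k} (hI : IsOpen (I : Set k)) :
    ∃ (r : ℕ) (a : Fin r → k), Ideal.span (Set.range a) ≤ I ∧
      IsOpen ((Ideal.span (Set.range a) : Ideal k) : Set k) := by
  obtain ⟨J, hJI, hJ, hJ'⟩ := BaseRing.finite I hI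
  obtain ⟨r, a, ha⟩ := Submodule.fg_iff_exists_fin_generating_family.1 hJ
  have ha' : Ideal.span (Set.range a) = J := ha
  exact ⟨r, a, ha'.le.trans hJI, by rwa [ha']⟩

theorem sum_smul_mem {L : Type*} [AddCommGroup L] [Module k L] {r : ℕ} {a : Fin r → k} {I : Ideal k}
    (ha : Ideal.span (Set.range a) ≤ I) (ν : Fin r → L) :
    ∑ i, a i • ν i ∈ I • (⊤ : Submodule k L) :=
  Submodule.sum_mem _ fun i _ => Submodule.smul_mem_smul
    (ha (Ideal.subset_span ⟨i, rfl⟩)) trivial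

/-- Division with the best possible control on the size of the quotients, for a sequence of ideals. -/
theorem exists_division_uniform {μ : DAcs X k} {C : CompactOpens X}
    (hμ : ∀ f, WkDual.eval f μ = WkDual.eval (chi k (compactOpenClopen C) * f) μ)
    {r : ℕ} (a : Fin r → k) (hJ : ∀ f, WkDual.eval f μ ∈ Ideal.span (Set.range a))
    {I : ℕ → Ideal k} (hI : ∀ n, IsOpen (I n : Set k)) (hanti : Antitone I)
    (hbasis : ∀ J : Ideal k, IsOpen (J : Set k) → ∃ n, I n ≤ J) :
    ∃ ν : Fin r → DAcs X k, μ = ∑ i, a i • ν i ∧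
      ∀ n, (∀ f, WkDual.eval f μ ∈ Ideal.span (Set.range a) * I n) →
        ∀ i f, WkDual.eval f (ν i) ∈ I n := by
  classical
  -- `Nat.find h` is the first level at which the values leave `(a) * I n`; the division takes place
  -- at the level just before it.
  by_cases h : ∃ n, ¬ ∀ f, WkDual.eval f μ ∈ Ideal.span (Set.range a) * I n
  · have hlt : ∀ n, (∀ f, WkDual.eval f μ ∈ Ideal.span (Set.range a) * I n) → n < Nat.find h := by
      intro n hn
      by_contra hle
      exact Nat.find_spec h fun f => Ideal.mul_mono_right (hanti (not_lt.1 hle)) (hn f)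
    rcases hN : Nat.find h with _ | N
    -- Level `0` already fails, so no level asks for control and plain division is enough.
    · obtain ⟨ν, -, -, hν⟩ := exists_division hμ a isOpen_top_ideal (by simpa using hJ)
      refine ⟨ν, hν, fun n hn => ?_⟩
      have := hlt n hn
      omega
    · have hN' : ∀ f, WkDual.eval f μ ∈ Ideal.span (Set.range a) * I N := by
        by_contra hn
        have := Nat.find_min' h hn
        omega
      obtain ⟨ν, hν', -, hν⟩ := exists_division hμ a (hI N) hN'
      refine ⟨ν, hν, fun n hn i f => hanti ?_ (hν' i f)⟩
      have := hlt n hn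
      omega
  -- If no level fails, the values of `μ` lie in every open ideal, hence `μ = 0`.
  · push Not at h
    have h0 : μ = 0 := by
      refine WkDual.ext fun f => eq_of_forall_sub_mem fun J hJ => ?_
      obtain ⟨n, hn⟩ := hbasis J hJ
      rw [map_zero, sub_zero]
      exact hn (Ideal.mul_le_right (h n f))
    refine ⟨0, by simp [h0], fun n _ i f => ?_⟩
    rw [Pi.zero_apply, map_zero]
    exact (I n).zero_mem

variable (X k) in
-- Inside `I` choose a finitely generated open ideal `(a)`. A measure with values in `(a)` is cut
-- along a partition into compact open sets and divided on each piece. The quotients have to tend to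
-- zero uniformly for their sum to be a functional on `C(X, k)`, hence the sharp form of division.
theorem hasNaiveCanonicalTopology_dAcsStrong : HasNaiveCanonicalTopology k (DAcsStrong X k) := by
  have := BaseRing.separated (k := k)
  refine hasNaiveCanonicalTopology_stDual fun I hI => ?_
  obtain ⟨r, a, haI, ha⟩ := exists_fin_span_isOpen hI
  refine ⟨_, ha, fun (μ : DAcs X k) hμ => ?_⟩
  obtain ⟨E, hE⟩ := exists_properQuotient X
  have := BaseRing.countable (k := k)
  obtain ⟨A, hA, hA'⟩ := (BaseRing.linear (k := k)).exists_antitone_subbasis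
  have hanti : Antitone A := fun i j hij => hA'.antitone hij
  have hbasis : ∀ J : Ideal k, IsOpen (J : Set k) → ∃ n, A n ≤ J := fun J hJ => by
    obtain ⟨n, -, hn⟩ := hA'.1.mem_iff.1 (hJ.mem_nhds J.zero_mem)
    exact ⟨n, hn⟩
  let μE : E → DAcs X k := fun e => WkDual.transpose (mulC (chi k (fibre E e))) μ
  have hμE : ∀ e f, WkDual.eval f (μE e) = WkDual.eval (chi k (fibre E e) * f) μ := fun _ _ => rfl
  choose ν hν hν' using fun e => exists_division_uniform (μ := μE e) (C := compactFibre hE e)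
    (fun f => by
      rw [hμE, hμE]
      exact congrArg (fun g => WkDual.eval g μ) (chi_mul_chi_mul _ _).symm)
    a (fun f => hμ _) hA hanti hbasis
  have hfin : ∀ i (J : Ideal k), IsOpen (J : Set k) →
      {e | ∃ f, WkDual.eval f (ν e i) ∉ J}.Finite := by
    intro i J hJ
    obtain ⟨n, hn⟩ := hbasis J hJ
    -- The product of the ideals `(a)` and `A n` is open, so all but finitely many pieces of `μ`
    -- take values in it, and their quotients take values in `A n`.
    obtain ⟨s, -, hs⟩ := homMod_eq_sum
      (wkReduce ⟨_, BaseRing.op _ _ ha (hA n)⟩ μ) E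
    refine s.finite_toSet.subset fun e he => ?_
    by_contra hes
    obtain ⟨f, hf⟩ := he
    exact hf (hn (hν' e n (fun g => (Submodule.Quotient.mk_eq_zero _).1 (hs e hes g)) i f))
  choose η hη using fun i => exists_hasSum_dAcs (fun e => ν e i) (hfin i)
  have e : μ = ∑ i, a i • η i := by
    refine WkDual.ext fun f => ?_
    have h1 : HasSum (fun e => WkDual.eval f (μE e)) (WkDual.eval f μ) :=
      ContinuousLinearMap.hasSum (show C(X, k) →L[k] k from μ) (hasSum_chi_mul E f)
    refine h1.unique ?_
    simp only [map_sum, map_smul]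
    have h2 := hasSum_sum (s := Finset.univ) fun i _ => (hη i f).mul_left (a i)
    refine h2.congr_fun fun e => ?_
    rw [hν e]
    simp only [map_sum, map_smul, smul_eq_mul]
  rw [e]
  exact sum_smul_mem (L := DAcsStrong X k) haI η

/-- Multiplication by the characteristic function of a compact open set. -/
def cutoff (C : CompactOpens X) : C(X, k) →L[k] CAcs X k where
  toFun f := ⟨chi k (compactOpenClopen C) * f, fun I _ => ⟨C, C.isCompact, fun x hx => by
    rw [ContinuousMap.mul_apply, chi_of_notMem (U := compactOpenClopen C) hx, zero_mul]
    exact I.zero_mem⟩⟩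
  map_add' f g := Subtype.ext (mul_add _ f g)
  map_smul' c f := Subtype.ext (mul_smul_comm c _ f)
  cont := (isBasisOfOpenSubmodules_continuousMap X k).continuous (isBasisOfOpenSubmodules_cAcs X k)
    { toFun := fun f => (⟨chi k (compactOpenClopen C) * f, _⟩ : CAcs X k)
      map_add' := fun f g => Subtype.ext (mul_add _ f g)
      map_smul' := fun c f => Subtype.ext (mul_smul_comm c _ f) }
    fun I hI => ⟨((C : Set X), I), ⟨C.isCompact, hI⟩, fun f hf => mem_acsValuesIn.2 fun x => by
      change chi k (compactOpenClopen C) x * f x ∈ I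
      by_cases hx : x ∈ (C : Set X)
      · exact I.mul_mem_left _ (hf x hx)
      · rw [chi_of_notMem (U := compactOpenClopen C) hx, zero_mul]
        exact I.zero_mem⟩

theorem cutoff_apply (C : CompactOpens X) (f : C(X, k)) :
    (cutoff C f).1 = chi k (compactOpenClopen C) * f := rfl

/-- Off a compact set `f` is in `I`, so discarding fibres that do not meet this set changes `f` by a
function with values in `I`. -/
theorem hasSum_cutoff {E : DiscreteQuotient X} (hE : IsProperQuotient E) (f : CAcs X k) :
    HasSum (fun e => cutoff (compactFibre hE e) f.1) f := by
  classical
  refine (((isBasisOfOpenSubmodules_cAcs X k).2 f).tendsto_right_iff).2 fun I hI => ?_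
  obtain ⟨Z, hZ, hf⟩ := f.2 I hI
  filter_upwards [Filter.eventually_ge_atTop (finite_image_proj E hZ).toFinset] with s hs
  intro x _
  rw [map_sub, map_sum]
  simp only [acsIncl_apply, cutoff_apply]
  change ((∑ e ∈ s, chi k (fibre E e) * f.1) - f.1) x ∈ I
  rw [← Finset.sum_mul, ContinuousMap.sub_apply, ContinuousMap.mul_apply]
  by_cases hx : E.proj x ∈ s
  · have h2 := sum_smul_chi_fibre_apply s (fun _ => (1 : k)) hx
    simp only [one_smul] at h2
    rw [h2, one_mul, sub_self]
    exact I.zero_mem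
  · have h3 : f.1 x ∈ I := hf x fun h => hx (hs (by simpa using ⟨x, h, rfl⟩))
    exact I.sub_mem (I.mul_mem_left _ h3) h3

variable (X k) in
-- On functions with almost compact support, any family of functionals living on the fibres can be
-- summed, so the quotients need no bound and division with the unit ideal suffices.
theorem hasNaiveCanonicalTopology_dMeasStrong : HasNaiveCanonicalTopology k (DMeasStrong X k) := by
  have := BaseRing.separated (k := k)
  refine hasNaiveCanonicalTopology_stDual fun I hI => ?_
  obtain ⟨r, a, haI, ha⟩ := exists_fin_span_isOpen hI
  refine ⟨_, ha, fun (μ : DMeas X k) hμ => ?_⟩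
  obtain ⟨E, hE⟩ := exists_properQuotient X
  let μE : E → DAcs X k := fun e => WkDual.transpose (cutoff (compactFibre hE e)) μ
  have hμE : ∀ e f, WkDual.eval f (μE e) = WkDual.eval (cutoff (compactFibre hE e) f) μ :=
    fun _ _ => rfl
  choose ν _ hν' hν using fun e => exists_division (μ := μE e) (C := compactFibre hE e)
    (fun f => by
      rw [hμE, hμE]
      exact congrArg (fun g => WkDual.eval g μ) (Subtype.ext (chi_mul_chi_mul _ _).symm))
    a isOpen_top_ideal (fun f => by rw [Ideal.mul_top]; exact hμ _)
  choose η hη using fun i => exists_hasSum_dMeas E (fun e => ν e i) fun e => hν' e i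
  have e : μ = ∑ i, a i • η i := by
    refine WkDual.ext fun f => ?_
    have h1 : HasSum (fun e => WkDual.eval f.1 (μE e)) (WkDual.eval f μ) :=
      ContinuousLinearMap.hasSum (show CAcs X k →L[k] k from μ) (hasSum_cutoff hE f)
    refine h1.unique ?_
    simp only [map_sum, map_smul]
    have h2 := hasSum_sum (s := Finset.univ) fun i _ => (hη i f).mul_left (a i)
    refine h2.congr_fun fun e => ?_
    rw [hν e]
    simp only [map_sum, map_smul, smul_eq_mul]
  rw [e]
  exact sum_smul_mem (L := DMeasStrong X k) haI η

end Division

/-! ### Coproducts -/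

section Coproduct

variable {k : Type*} [CommRing k]

section Values

variable {M N : Type*} [AddCommGroup M] [Module k M] [AddCommGroup N] [Module k N]

/-- The value of `α ⊗ β` on `M ⊗ N`. -/
def tensorEval (α : M →ₗ[k] k) (β : N →ₗ[k] k) : M ⊗[k] N →ₗ[k] k :=
  TensorProduct.lift ((LinearMap.mul k k).compl₁₂ α β)

theorem tensorEval_tmul (α : M →ₗ[k] k) (β : N →ₗ[k] k) (m : M) (n : N) :
    tensorEval α β (m ⊗ₜ n) = α m * β n := rfl

/-- The projection `M ⊗ N → M / P ⊗ N / Q`. -/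
def tensorMk (P : Submodule k M) (Q : Submodule k N) : M ⊗[k] N →ₗ[k] (M ⧸ P) ⊗[k] (N ⧸ Q) :=
  TensorProduct.map P.mkQ Q.mkQ

theorem tensorMk_surjective (P : Submodule k M) (Q : Submodule k N) :
    Function.Surjective (tensorMk P Q) :=
  TensorProduct.map_surjective P.mkQ_surjective Q.mkQ_surjective

theorem tensorMk_factor {P P' : Submodule k M} {Q Q' : Submodule k N} (hP : P ≤ P') (hQ : Q ≤ Q')
    (t : M ⊗[k] N) :
    TensorProduct.map (Submodule.factor hP) (Submodule.factor hQ) (tensorMk P Q t) =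
      tensorMk P' Q' t := by
  rw [tensorMk, tensorMk, ← LinearMap.comp_apply, ← TensorProduct.map_comp]
  rfl

theorem tensorValueMod_tensorMk (α : M →ₗ[k] k) (β : N →ₗ[k] k) (I : Ideal k) (P : Submodule k M)
    (Q : Submodule k N) (hP : P ≤ Submodule.comap α I) (hQ : Q ≤ Submodule.comap β I)
    (t : M ⊗[k] N) :
    tensorValueMod α β I P Q hP hQ (tensorMk P Q t) = Ideal.Quotient.mk I (tensorEval α β t) := by
  induction t using TensorProduct.induction_on with
  | zero => simp
  | tmul m n => rfl
  | add s t hs ht => rw [map_add, map_add, map_add, map_add, hs, ht]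

theorem tensorValueMod_factor (α : M →ₗ[k] k) (β : N →ₗ[k] k) (I : Ideal k) {P P' : Submodule k M}
    {Q Q' : Submodule k N} (hP : P ≤ Submodule.comap α I) (hQ : Q ≤ Submodule.comap β I)
    (hP' : P' ≤ Submodule.comap α I) (hQ' : Q' ≤ Submodule.comap β I) (h : P ≤ P') (h' : Q ≤ Q')
    (w : (M ⧸ P) ⊗[k] (N ⧸ Q)) :
    tensorValueMod α β I P' Q' hP' hQ'
      (TensorProduct.map (Submodule.factor h) (Submodule.factor h') w) =
    tensorValueMod α β I P Q hP hQ w := by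
  obtain ⟨t, rfl⟩ := tensorMk_surjective P Q w
  rw [tensorMk_factor, tensorValueMod_tensorMk, tensorValueMod_tensorMk]

theorem IsTensorValue.eq [TopologicalSpace k] [TopologicalSpace M] [TopologicalSpace N]
    {α : M →ₗ[k] k} {β : N →ₗ[k] k} {z : CompletedTensor k M N} {a : k}
    (h : IsTensorValue α β z a) {I : Ideal k} (hI : IsOpen (I : Set k)) (P : OpenSub k M)
    (Q : OpenSub k N) (hP : P.1 ≤ Submodule.comap α I) (hQ : Q.1 ≤ Submodule.comap β I) :
    tensorValueMod α β I P.1 Q.1 hP hQ (z.1 P Q) = Ideal.Quotient.mk I a := by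
  obtain ⟨P', Q', hP', hQ', h⟩ := h I hI
  let P'' : OpenSub k M := ⟨P.1 ⊓ P'.1, P.2.inter P'.2⟩
  let Q'' : OpenSub k N := ⟨Q.1 ⊓ Q'.1, Q.2.inter Q'.2⟩
  have h1 : P''.1 ≤ P.1 := inf_le_left
  have h2 : Q''.1 ≤ Q.1 := inf_le_left
  have h3 : P''.1 ≤ P'.1 := inf_le_right
  have h4 : Q''.1 ≤ Q'.1 := inf_le_right
  rw [← z.2 P'' P' Q'' Q' h3 h4, tensorValueMod_factor α β I (h1.trans hP) (h2.trans hQ)] at h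
  rw [← z.2 P'' P Q'' Q h1 h2, tensorValueMod_factor α β I (h1.trans hP) (h2.trans hQ), h]

end Values

variable [TopologicalSpace k]
variable {M : Type*} [AddCommGroup M] [Module k M] [TopologicalSpace M]
variable {A : Type*} [Mul A] {S : Type*}

/-- A chart for a space `M` of measures, which is paired with an algebra `A` of functions: modulo the
open ideal `J`, and for the functions in `fns`, every measure is a finite combination of the
Dirac measures `δ i`, with coefficients its values on the sets `e i`. -/
structure CoproductChart (ev : A → M →ₗ[k] k) (χ : S → A) (ι : Type*) where
  J : Ideal k
  isOpen_J : IsOpen (J : Set k)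
  fns : Set A
  mul_mem : ∀ f ∈ fns, ∀ g ∈ fns, f * g ∈ fns
  e : ι → S
  e_mem : ∀ i, χ (e i) ∈ fns
  δ : ι → M
  map_mul : ∀ f g i, ev (f * g) (δ i) = ev f (δ i) * ev g (δ i)
  finite : ∀ m, {i | ev (χ (e i)) m ∉ J}.Finite
  sub_sum_mem : ∀ (m : M) (s : Finset ι), (∀ i ∉ s, ev (χ (e i)) m ∈ J) → ∀ f ∈ fns,
    ev f m - ∑ i ∈ s, ev (χ (e i)) m * ev f (δ i) ∈ J

namespace CoproductChart

variable {ev : A → M →ₗ[k] k} {χ : S → A} {ι ι' : Type*} (c : CoproductChart ev χ ι)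

/-- The measures whose values on `fns` are in `J`. -/
def ann : Submodule k M := ⨅ f ∈ c.fns, Submodule.comap (ev f) c.J

theorem mem_ann {m : M} : m ∈ c.ann ↔ ∀ f ∈ c.fns, ev f m ∈ c.J := by
  simp [ann, Submodule.mem_iInf]

theorem ann_le {f : A} (hf : f ∈ c.fns) : c.ann ≤ Submodule.comap (ev f) c.J :=
  fun _ hm => c.mem_ann.1 hm f hf

theorem smul_mkQ {a : k} (ha : a ∈ c.J) (x : M ⧸ c.ann) : a • x = 0 := by
  obtain ⟨m, rfl⟩ := c.ann.mkQ_surjective x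
  rw [← map_smul, Submodule.mkQ_apply, Submodule.Quotient.mk_eq_zero, mem_ann]
  intro f _
  rw [map_smul]
  exact c.J.mul_mem_right _ ha

theorem mkQ_eq_sum (m : M) (s : Finset ι) (hs : ∀ i ∉ s, ev (χ (c.e i)) m ∈ c.J) :
    c.ann.mkQ m = ∑ i ∈ s, ev (χ (c.e i)) m • c.ann.mkQ (c.δ i) := by
  simp only [← map_smul, ← map_sum]
  rw [← sub_eq_zero, ← map_sub, Submodule.mkQ_apply, Submodule.Quotient.mk_eq_zero, mem_ann]
  intro f hf
  have := c.sub_sum_mem m s hs f hf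
  rw [map_sub, map_sum]
  simpa only [map_smul, smul_eq_mul] using this

theorem exists_tensorMk_eq_sum (t : M ⊗[k] M) : ∃ s : Finset ι, ∀ s', s ⊆ s' →
    tensorMk c.ann c.ann t = ∑ i ∈ s', ∑ j ∈ s',
      tensorEval (ev (χ (c.e i))) (ev (χ (c.e j))) t •
        (c.ann.mkQ (c.δ i) ⊗ₜ[k] c.ann.mkQ (c.δ j)) := by
  classical
  induction t using TensorProduct.induction_on with
  | zero => exact ⟨∅, fun s' _ => by simp⟩
  | tmul m n =>
    refine ⟨(c.finite m).toFinset ∪ (c.finite n).toFinset, fun s' hs' => ?_⟩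
    have hm := c.mkQ_eq_sum m s' fun i hi => by
      by_contra h
      exact hi (hs' (Finset.mem_union_left _ (by simpa using h)))
    have hn := c.mkQ_eq_sum n s' fun i hi => by
      by_contra h
      exact hi (hs' (Finset.mem_union_right _ (by simpa using h)))
    change c.ann.mkQ m ⊗ₜ[k] c.ann.mkQ n = _
    rw [hm, hn, TensorProduct.sum_tmul]
    refine Finset.sum_congr rfl fun i _ => ?_
    rw [TensorProduct.tmul_sum]
    refine Finset.sum_congr rfl fun j _ => ?_
    rw [TensorProduct.smul_tmul_smul, tensorEval_tmul]
  | add t t' ht ht' =>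
    obtain ⟨s, hs⟩ := ht
    obtain ⟨s', hs'⟩ := ht'
    refine ⟨s ∪ s', fun s'' h => ?_⟩
    rw [map_add, hs s'' (Finset.union_subset_left h), hs' s'' (Finset.union_subset_right h)]
    simp only [map_add, add_smul, Finset.sum_add_distrib]

theorem tensorMk_eq_zero {t : M ⊗[k] M}
    (ht : ∀ i j, tensorEval (ev (χ (c.e i))) (ev (χ (c.e j))) t ∈ c.J) :
    tensorMk c.ann c.ann t = 0 := by
  obtain ⟨s, hs⟩ := c.exists_tensorMk_eq_sum t
  rw [hs s subset_rfl]
  refine Finset.sum_eq_zero fun i _ => Finset.sum_eq_zero fun j _ => ?_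
  rw [TensorProduct.smul_tmul', c.smul_mkQ (ht i j), TensorProduct.zero_tmul]

theorem tensorMk_eq_zero_of_le {P Q : Submodule k M} (hP : c.ann ≤ P) (hQ : c.ann ≤ Q)
    {t : M ⊗[k] M} (ht : ∀ i j, tensorEval (ev (χ (c.e i))) (ev (χ (c.e j))) t ∈ c.J) :
    tensorMk P Q t = 0 := by
  rw [← tensorMk_factor hP hQ, c.tensorMk_eq_zero ht, map_zero]

/-- `t` represents the coproduct of `μ` in the chart `c`. -/
def IsGood (μ : M) (t : M ⊗[k] M) : Prop :=
  ∀ f ∈ c.fns, ∀ g ∈ c.fns, tensorEval (ev f) (ev g) t - ev (f * g) μ ∈ c.J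

theorem exists_isGood (μ : M) : ∃ t, c.IsGood μ t := by
  refine ⟨∑ i ∈ (c.finite μ).toFinset, ev (χ (c.e i)) μ • (c.δ i ⊗ₜ[k] c.δ i),
    fun f hf g hg => ?_⟩
  have h := c.sub_sum_mem μ (c.finite μ).toFinset (fun i hi => by simpa using hi) (f * g)
    (c.mul_mem f hf g hg)
  have := c.J.neg_mem h
  rw [neg_sub] at this
  convert this using 2
  rw [map_sum]
  refine Finset.sum_congr rfl fun i _ => ?_
  rw [map_smul, tensorEval_tmul, c.map_mul, smul_eq_mul]

variable {c}

theorem IsGood.add {μ ν : M} {s t : M ⊗[k] M} (h : c.IsGood μ s) (h' : c.IsGood ν t) :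
    c.IsGood (μ + ν) (s + t) := by
  intro f hf g hg
  have := c.J.add_mem (h f hf g hg) (h' f hf g hg)
  rw [map_add, map_add]
  convert this using 1
  ring

theorem IsGood.smul (a : k) {μ : M} {t : M ⊗[k] M} (h : c.IsGood μ t) : c.IsGood (a • μ) (a • t) := by
  intro f hf g hg
  have := c.J.mul_mem_left a (h f hf g hg)
  rw [map_smul, map_smul, smul_eq_mul, smul_eq_mul, ← mul_sub]
  exact this

theorem IsGood.mono {c' : CoproductChart ev χ ι'} (hf : c'.fns ⊆ c.fns) (hJ : c.J ≤ c'.J) {μ : M}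
    {t : M ⊗[k] M} (h : c.IsGood μ t) : c'.IsGood μ t :=
  fun f hf' g hg' => hJ (h f (hf hf') g (hf hg'))

theorem IsGood.tensorMk_eq {P Q : Submodule k M} (hP : c.ann ≤ P) (hQ : c.ann ≤ Q) {μ : M}
    {s t : M ⊗[k] M} (h : c.IsGood μ s) (h' : c.IsGood μ t) : tensorMk P Q s = tensorMk P Q t := by
  rw [← sub_eq_zero, ← map_sub]
  refine c.tensorMk_eq_zero_of_le hP hQ fun i j => ?_
  have := c.J.sub_mem (h _ (c.e_mem i) _ (c.e_mem j)) (h' _ (c.e_mem i) _ (c.e_mem j))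
  rw [sub_sub_sub_cancel_right] at this
  rwa [map_sub]

end CoproductChart

set_option linter.checkUnivs false in
/-- A space of measures with enough charts. -/
structure CoproductAtlas (ev : A → M →ₗ[k] k) (χ : S → A) where
  𝒞 : Type*
  idx : 𝒞 → Type*
  chart : ∀ c, CoproductChart ev χ (idx c)
  isOpen_ann : ∀ c, IsOpen ((chart c).ann : Set M)
  exists_ann_le : ∀ P : Submodule k M, IsOpen (P : Set M) → ∃ c, (chart c).ann ≤ P
  refine : ∀ c c', ∃ c'', (chart c).fns ⊆ (chart c'').fns ∧ (chart c').fns ⊆ (chart c'').fns ∧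
    (chart c'').J ≤ (chart c).J ∧ (chart c'').J ≤ (chart c').J
  approx : ∀ (f g : A) (I : Ideal k), IsOpen (I : Set k) → ∃ c, (chart c).J ≤ I ∧
    ∃ f' ∈ (chart c).fns, ∃ g' ∈ (chart c).fns, (∀ m, ev f m - ev f' m ∈ I) ∧
      (∀ m, ev g m - ev g' m ∈ I) ∧ ∀ m, ev (f * g) m - ev (f' * g') m ∈ I

namespace CoproductAtlas

variable {ev : A → M →ₗ[k] k} {χ : S → A} (𝒜 : CoproductAtlas ev χ)

/-- A representative in a common refinement of two charts is good in both, and links `s` with `t`.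
-/
theorem tensorMk_eq {c c' : 𝒜.𝒞} {P Q : Submodule k M} (hP : (𝒜.chart c).ann ≤ P)
    (hQ : (𝒜.chart c).ann ≤ Q) (hP' : (𝒜.chart c').ann ≤ P) (hQ' : (𝒜.chart c').ann ≤ Q) {μ : M}
    {s t : M ⊗[k] M} (h : (𝒜.chart c).IsGood μ s) (h' : (𝒜.chart c').IsGood μ t) :
    tensorMk P Q s = tensorMk P Q t := by
  obtain ⟨c'', h1, h2, h3, h4⟩ := 𝒜.refine c c'
  obtain ⟨u, hu⟩ := (𝒜.chart c'').exists_isGood μ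
  rw [h.tensorMk_eq hP hQ (hu.mono h1 h3), h'.tensorMk_eq hP' hQ' (hu.mono h2 h4)]

theorem exists_chart_le (P Q : OpenSub k M) :
    ∃ c, (𝒜.chart c).ann ≤ P.1 ∧ (𝒜.chart c).ann ≤ Q.1 := by
  obtain ⟨c, hc⟩ := 𝒜.exists_ann_le (P.1 ⊓ Q.1) (P.2.inter Q.2)
  exact ⟨c, hc.trans inf_le_left, hc.trans inf_le_right⟩

theorem exists_good (P Q : OpenSub k M) (μ : M) : ∃ (c : 𝒜.𝒞) (t : M ⊗[k] M),
    (𝒜.chart c).ann ≤ P.1 ∧ (𝒜.chart c).ann ≤ Q.1 ∧ (𝒜.chart c).IsGood μ t := by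
  obtain ⟨c, hP, hQ⟩ := 𝒜.exists_chart_le P Q
  obtain ⟨t, ht⟩ := (𝒜.chart c).exists_isGood μ
  exact ⟨c, t, hP, hQ, ht⟩

/-- The component of the coproduct in `M / P ⊗ M / Q`. -/
def component (P Q : OpenSub k M) (μ : M) : (M ⧸ P.1) ⊗[k] (M ⧸ Q.1) :=
  tensorMk P.1 Q.1 (𝒜.exists_good P Q μ).choose_spec.choose

theorem component_eq {P Q : OpenSub k M} {c : 𝒜.𝒞} (hP : (𝒜.chart c).ann ≤ P.1)
    (hQ : (𝒜.chart c).ann ≤ Q.1) {μ : M} {t : M ⊗[k] M} (ht : (𝒜.chart c).IsGood μ t) :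
    𝒜.component P Q μ = tensorMk P.1 Q.1 t :=
  have h := (𝒜.exists_good P Q μ).choose_spec.choose_spec
  𝒜.tensorMk_eq h.1 h.2.1 hP hQ h.2.2 ht

/-- The coproduct. -/
def coproduct : M →ₗ[k] CompletedTensor k M M where
  toFun μ := ⟨fun P Q => 𝒜.component P Q μ, fun P P' Q Q' hP hQ => by
    obtain ⟨c, t, h1, h2, ht⟩ := 𝒜.exists_good P Q μ
    beta_reduce
    rw [𝒜.component_eq h1 h2 ht, 𝒜.component_eq (h1.trans hP) (h2.trans hQ) ht, tensorMk_factor]⟩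
  map_add' μ ν := by
    refine Subtype.ext (funext fun P => funext fun Q => ?_)
    obtain ⟨c, hP, hQ⟩ := 𝒜.exists_chart_le P Q
    obtain ⟨s, hs⟩ := (𝒜.chart c).exists_isGood μ
    obtain ⟨t, ht⟩ := (𝒜.chart c).exists_isGood ν
    change 𝒜.component P Q (μ + ν) = 𝒜.component P Q μ + 𝒜.component P Q ν
    rw [𝒜.component_eq hP hQ hs, 𝒜.component_eq hP hQ ht, 𝒜.component_eq hP hQ (hs.add ht), map_add]
  map_smul' a μ := by
    refine Subtype.ext (funext fun P => funext fun Q => ?_)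
    obtain ⟨c, hP, hQ⟩ := 𝒜.exists_chart_le P Q
    obtain ⟨s, hs⟩ := (𝒜.chart c).exists_isGood μ
    change 𝒜.component P Q (a • μ) = a • 𝒜.component P Q μ
    rw [𝒜.component_eq hP hQ hs, 𝒜.component_eq hP hQ (hs.smul a), map_smul]

theorem coproduct_apply (μ : M) (P Q : OpenSub k M) :
    (𝒜.coproduct μ).1 P Q = 𝒜.component P Q μ := rfl

/-- If `ν - μ` is in the annihilator of a chart, then `0` represents the coproduct of `ν - μ` there;
so each component is constant on cosets of an open submodule. -/
theorem continuous_coproduct {ι : Type*} {p : ι → Prop} {B : ι → Submodule k M}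
    (hM : IsBasisOfOpenSubmodules p B) : Continuous 𝒜.coproduct := by
  refine continuous_iInf_rng.2 fun P => continuous_iInf_rng.2 fun Q => continuous_induced_rng.2 ?_
  refine @IsLocallyConstant.continuous _ _ _ ⊥ _ ((IsLocallyConstant.iff_eventually_eq _).2
    fun μ => ?_)
  obtain ⟨c, hP, hQ⟩ := 𝒜.exists_chart_le P Q
  obtain ⟨i, hi, hB⟩ := hM.isOpen_iff.1 (𝒜.isOpen_ann c)
  refine (hM.2 μ).mem_iff.2 ⟨i, hi, fun ν hν => ?_⟩
  obtain ⟨t, ht⟩ := (𝒜.chart c).exists_isGood μ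
  have h0 : (𝒜.chart c).IsGood (ν - μ) 0 := fun f hf g hg => by
    rw [map_zero, zero_sub]
    exact Submodule.neg_mem _ ((𝒜.chart c).mem_ann.1 (hB hν) _ ((𝒜.chart c).mul_mem f hf g hg))
  have h1 := h0.add ht
  rw [sub_add_cancel, zero_add] at h1
  change 𝒜.component P Q ν = 𝒜.component P Q μ
  rw [𝒜.component_eq hP hQ h1, 𝒜.component_eq hP hQ ht]

theorem tensorEval_sub_mem {I : Ideal k} {α α' β β' : M →ₗ[k] k} (hα : ∀ m, α m - α' m ∈ I)
    (hβ : ∀ m, β m - β' m ∈ I) (t : M ⊗[k] M) : tensorEval α β t - tensorEval α' β' t ∈ I := by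
  induction t using TensorProduct.induction_on with
  | zero => simp
  | tmul m n =>
    rw [tensorEval_tmul, tensorEval_tmul]
    have := I.add_mem (I.mul_mem_left (α m) (hβ n)) (I.mul_mem_right (β' n) (hα m))
    convert this using 1
    ring
  | add s t hs ht =>
    have := I.add_mem hs ht
    rw [map_add, map_add]
    convert this using 1
    ring

/-- Modulo `I`, the functions `f`, `g` and their product may be replaced by functions of one chart,
where a good representative has the required values. -/
theorem isCoproduct_coproduct {ι : Type*} {p : ι → Prop} {B : ι → Submodule k M}
    (hM : IsBasisOfOpenSubmodules p B) : IsCoproduct ev 𝒜.coproduct := by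
  refine ⟨𝒜.continuous_coproduct hM, fun μ f g I hI => ?_⟩
  obtain ⟨c, hJ, f', hf', g', hg', h1, h2, h3⟩ := 𝒜.approx f g I hI
  have hle : ∀ {f f' : A}, f' ∈ (𝒜.chart c).fns → (∀ m, ev f m - ev f' m ∈ I) →
      (𝒜.chart c).ann ≤ Submodule.comap (ev f) I := by
    intro f f' hf' h m hm
    have := I.add_mem (h m) (hJ ((𝒜.chart c).mem_ann.1 hm f' hf'))
    rwa [sub_add_cancel] at this
  let P : OpenSub k M := ⟨(𝒜.chart c).ann, 𝒜.isOpen_ann c⟩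
  refine ⟨P, P, hle hf' h1, hle hg' h2, ?_⟩
  obtain ⟨t, ht⟩ := (𝒜.chart c).exists_isGood μ
  rw [coproduct_apply, 𝒜.component_eq (P := P) (Q := P) le_rfl le_rfl ht, tensorValueMod_tensorMk,
    Ideal.Quotient.eq]
  have := I.sub_mem (I.add_mem (tensorEval_sub_mem h1 h2 t) (hJ (ht f' hf' g' hg'))) (h3 μ)
  convert this using 1
  ring

/-- The components at the annihilators of charts determine the others, and there a difference with
zero values on all pairs `(e i, e j)` vanishes by separation. -/
theorem eq_of_isTensorValue (𝒜 : CoproductAtlas ev χ) {z z' : CompletedTensor k M M} {a : S → S → k}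
    (h : ∀ U V, IsTensorValue (ev (χ U)) (ev (χ V)) z (a U V))
    (h' : ∀ U V, IsTensorValue (ev (χ U)) (ev (χ V)) z' (a U V)) : z = z' := by
  refine Subtype.ext (funext fun P => funext fun Q => ?_)
  obtain ⟨c, hP, hQ⟩ := 𝒜.exists_chart_le P Q
  let R : OpenSub k M := ⟨(𝒜.chart c).ann, 𝒜.isOpen_ann c⟩
  rw [← z.2 R P R Q hP hQ, ← z'.2 R P R Q hP hQ]
  congr 1
  rw [← sub_eq_zero]
  obtain ⟨t, ht⟩ := tensorMk_surjective R.1 R.1 (z.1 R R - z'.1 R R)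
  rw [← ht]
  refine (𝒜.chart c).tensorMk_eq_zero fun i j => ?_
  have hi := (𝒜.chart c).ann_le ((𝒜.chart c).e_mem i)
  have hj := (𝒜.chart c).ann_le ((𝒜.chart c).e_mem j)
  rw [← Ideal.Quotient.eq_zero_iff_mem, ← tensorValueMod_tensorMk _ _ _ R.1 R.1 hi hj, ht, map_sub,
    (h _ _).eq (𝒜.chart c).isOpen_J R R hi hj, (h' _ _).eq (𝒜.chart c).isOpen_J R R hi hj, sub_self]

/-- The transposition property at two characteristic functions. No chart is involved, so it also
applies to the strong dual. -/
theorem coproductFormula_of_isCoproduct [Min S] (hχ : ∀ U V, χ (U ⊓ V) = χ U * χ V)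
    {Δ : M →ₗ[k] CompletedTensor k M M} (h : IsCoproduct ev Δ) :
    CoproductFormula (fun U => ev (χ U)) Δ := by
  intro μ U V
  beta_reduce
  rw [hχ]
  exact h.2 μ (χ U) (χ V)

/-- The formula on sets alone determines the map, by separation; since every coproduct satisfies the
formula, both uniqueness statements follow. -/
theorem exists_coproduct (𝒜 : CoproductAtlas ev χ) [Min S]
    (hχ : ∀ U V, χ (U ⊓ V) = χ U * χ V) {ι : Type*} {p : ι → Prop} {B : ι → Submodule k M} (hM : IsBasisOfOpenSubmodules p B) :
    ∃ Δ : M →ₗ[k] CompletedTensor k M M, IsCoproduct ev Δ ∧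
      (∀ Δ', IsCoproduct ev Δ' → Δ' = Δ) ∧ CoproductFormula (fun U => ev (χ U)) Δ ∧
      (∀ Δ', CoproductFormula (fun U => ev (χ U)) Δ' → Δ' = Δ) := by
  have h := 𝒜.isCoproduct_coproduct hM
  have h1 := coproductFormula_of_isCoproduct hχ h
  have h2 : ∀ Δ', CoproductFormula (fun U => ev (χ U)) Δ' → Δ' = 𝒜.coproduct := fun Δ' h' =>
    LinearMap.ext fun μ => 𝒜.eq_of_isTensorValue (a := fun U V => ev (χ (U ⊓ V)) μ)
      (fun U V => h' μ U V) fun U V => h1 μ U V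
  exact ⟨_, h, fun Δ' h' => h2 Δ' (coproductFormula_of_isCoproduct hχ h'), h1, h2⟩

end CoproductAtlas

end Coproduct

/-! ### Uniform measures -/

section Limits

variable {k : Type*} [CommRing k]
variable {L : Type*} [AddCommGroup L] [Module k L] [TopologicalSpace L]

/-- A basis of open submodules of a directed limit. -/
theorem isBasisOfOpenSubmodules_of_directed {ι : Type*} [Nonempty ι] {T : ι → Type*}
    [∀ i, AddCommGroup (T i)] [∀ i, Module k (T i)] [∀ i, TopologicalSpace (T i)]
    (u : ∀ i, L →ₗ[k] T i)
    (ht : ‹TopologicalSpace L› = ⨅ i, TopologicalSpace.induced (u i) inferInstance)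
    (hd : ∀ i j, ∃ l, (∃ v : T l → T i, Continuous v ∧ ⇑(u i) = v ∘ u l) ∧
      ∃ v : T l → T j, Continuous v ∧ ⇑(u j) = v ∘ u l)
    {κ : ι → Type*} {p : ∀ i, κ i → Prop} {B : ∀ i, κ i → Submodule k (T i)}
    (hb : ∀ i, IsBasisOfOpenSubmodules (p i) (B i)) :
    IsBasisOfOpenSubmodules (fun x : (i : ι) × κ i => p x.1 x.2)
      (fun x => (B x.1 x.2).comap (u x.1)) := by
  constructor
  · rintro ⟨i, a⟩ ha
    refine ((hb i).1 a ha).preimage ?_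
    rw [continuous_iff_le_induced, ht]
    exact iInf_le _ i
  · intro μ
    have e : 𝓝 μ = ⨅ i, Filter.comap (u i) (𝓝 (u i μ)) := by
      rw [ht, nhds_iInf]
      exact iInf_congr fun i => nhds_induced _ _
    rw [e]
    have h := Filter.hasBasis_iInf_of_directed' (l := fun i => Filter.comap (u i) (𝓝 (u i μ)))
      (s := fun i a => u i ⁻¹' {ν | ν - u i μ ∈ B i a}) (p := p)
      (fun i => ((hb i).2 (u i μ)).comap (u i)) ?_
    · refine h.congr (fun _ => Iff.rfl) ?_
      rintro ⟨i, a⟩ -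
      ext ν
      simp
    · have hle : ∀ {i l}, (∃ v : T l → T i, Continuous v ∧ ⇑(u i) = v ∘ u l) →
          Filter.comap (u l) (𝓝 (u l μ)) ≤ Filter.comap (u i) (𝓝 (u i μ)) := by
        rintro i l ⟨v, hv, h⟩
        rw [h, ← Filter.comap_comap]
        exact Filter.comap_mono (hv.tendsto _).le_comap
      intro i j
      obtain ⟨l, h1, h2⟩ := hd i j
      exact ⟨l, hle h1, hle h2⟩

end Limits

section Uniform

theorem tdSpace_of_discreteTopology (Y : Type*) [TopologicalSpace Y] [DiscreteTopology Y] :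
    TDSpace Y := by
  have : ParacompactSpace Y := by
    refine ⟨fun α s _ hs => ⟨Y, fun y => {y}, fun _ => isOpen_discrete _, ?_, ?_, fun y => ?_⟩⟩
    · exact Set.iUnion_of_singleton Y
    · exact fun y => ⟨{y}, by simp, (Set.finite_singleton y).subset fun z hz => by
        simpa using hz⟩
    · obtain ⟨a, ha⟩ := Set.iUnion_eq_univ_iff.1 hs y
      exact ⟨a, by simpa using ha⟩
  exact { clopen_basis := by
            refine isTopologicalBasis_of_isOpen_of_nhds (fun U hU => hU.2) fun y U hy _ =>
              ⟨{y}, isClopen_discrete _, rfl, by simpa using hy⟩ }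

variable {X : Type*} [TopologicalSpace X]
variable {k : Type*} [CommRing k] [UniformSpace k] [IsUniformAddGroup k] [IsTopologicalRing k]
  [BaseRing k]
variable {Θ : TDUniformity X}

variable (k Θ) in
/-- The inclusion of the uniformly continuous functions into all continuous functions. -/
def unifIncl : CUnif k Θ →ₗ[k] C(X, k) := (unifSubmodule k Θ).subtype

variable (Θ) in
/-- The uniformly continuous functions with values in `I`. -/
def unifValuesIn (I : Ideal k) : Submodule k (CUnif k Θ) :=
  (valuesIn k Set.univ I).comap (unifIncl k Θ)

theorem mem_unifValuesIn {I : Ideal k} {f : CUnif k Θ} :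
    f ∈ unifValuesIn Θ I ↔ ∀ x, f.1 x ∈ I := by
  simp only [unifValuesIn, Submodule.mem_comap]
  exact ⟨fun h x => h x trivial, fun h x _ => h x⟩

variable (k Θ) in
theorem isBasisOfOpenSubmodules_cUnif :
    IsBasisOfOpenSubmodules (L := CUnif k Θ) (fun I : Ideal k => IsOpen (I : Set k))
      (fun I => unifValuesIn Θ I) := by
  have h := isBasisOfOpenSubmodules_linearTopology (L := CUnif k Θ)
    (S := {N : Submodule k (CUnif k Θ) | ∃ I : Ideal k, IsOpen (I : Set k) ∧
      ∀ f : CUnif k Θ, f ∈ N ↔ ∀ x, f.1 x ∈ I}) rfl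
    ⟨unifValuesIn Θ ⊤, ⊤, isOpen_top_ideal, fun _ => mem_unifValuesIn⟩ ?_
  · refine h.reindex ?_ fun I hI => ⟨unifValuesIn Θ I, ⟨I, hI, fun _ => mem_unifValuesIn⟩, le_rfl⟩
    rintro N ⟨I, hI, hN⟩
    exact ⟨I, hI, fun f hf => (hN f).2 (mem_unifValuesIn.1 hf)⟩
  · rintro N ⟨I, hI, hN⟩ N' ⟨I', hI', hN'⟩
    refine ⟨unifValuesIn Θ (I ⊓ I'), ⟨_, isOpen_inf hI hI', fun _ => mem_unifValuesIn⟩,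
      fun f hf => ?_⟩
    rw [mem_unifValuesIn] at hf
    exact ⟨(hN f).2 fun x => (hf x).1, (hN' f).2 fun x => (hf x).2⟩

/-- The function on a discrete quotient which takes the values of `f` at chosen points of the
fibres. -/
def sample (D : DiscreteQuotient X) (f : X → k) : C(D, k) :=
  ⟨fun d => f (Quotient.out d), continuous_of_discreteTopology⟩

theorem sub_sample_mem {D : DiscreteQuotient X} {I : Ideal k} {f : X → k} (h : IsConstMod D I f)
    (x : X) : f x - sample D f (D.proj x) ∈ I := h.sub_out_mem x

/-- `f` is the pull-back of `g`, modulo `I`. -/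
def IsApprox (I : Ideal k) (f : X → k) (D : DiscreteQuotient X) (g : C(D, k)) : Prop :=
  ∀ x, f x - g (D.proj x) ∈ I

theorem exists_isApprox (f : CUnif k Θ) {I : Ideal k} (hI : IsOpen (I : Set k)) :
    ∃ (D : Θ.radii) (g : C(D.1, k)), IsApprox I f.1 D.1 g := by
  obtain ⟨D, hD, h⟩ := f.2 I hI
  exact ⟨⟨D, hD⟩, sample D f.1, fun x => sub_sample_mem (D := D) (I := I) h x⟩

theorem dUnif_eval_trans (μ : DUnif k Θ) {D E : Θ.radii} (h : E.1 ≤ D.1) (g : C(D.1, k)) :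
    WkDual.eval (g.comp (transC h)) (μ.1 E) = WkDual.eval g (μ.1 D) := by
  rw [← μ.2 D E h]
  rfl

theorem eval_add_apply {M : Type*} [AddCommGroup M] [Module k M] [TopologicalSpace M]
    (μ : WkDual k M) (f g : M) : WkDual.eval (f + g) μ = WkDual.eval f μ + WkDual.eval g μ :=
  map_add (show M →L[k] k from μ) f g

theorem eval_sub_apply {M : Type*} [AddCommGroup M] [Module k M] [TopologicalSpace M]
    (μ : WkDual k M) (f g : M) : WkDual.eval (f - g) μ = WkDual.eval f μ - WkDual.eval g μ :=
  map_sub (show M →L[k] k from μ) f g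

theorem eval_smul_apply {M : Type*} [AddCommGroup M] [Module k M] [TopologicalSpace M]
    (μ : WkDual k M) (c : k) (f : M) : WkDual.eval (c • f) μ = c * WkDual.eval f μ :=
  map_smul (show M →L[k] k from μ) c f

/-- Modulo `I`, `f` is pulled back from some radius, where `μ` can be evaluated; compatibility of
`μ` with push-forward compares two radii over a common refinement. -/
theorem exists_unifIntegral (μ : DUnif k Θ) :
    ∃ φ : CUnif k Θ →ₗ[k] k, ∀ {I : Ideal k}, IsOpen (I : Set k) → ∀ {f : CUnif k Θ} {a : k},
      (∃ (D : Θ.radii) (g : C(D.1, k)), IsApprox I f.1 D.1 g ∧ a = WkDual.eval g (μ.1 D)) →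
        φ f - a ∈ I := by
  refine exists_linearMap_of_approx (fun I (f : CUnif k Θ) a =>
    ∃ (D : Θ.radii) (g : C(D.1, k)), IsApprox I f.1 D.1 g ∧ a = WkDual.eval g (μ.1 D)) ?_ ?_ ?_ ?_ ?_
  · intro I hI f
    obtain ⟨D, g, h⟩ := exists_isApprox f hI
    exact ⟨_, D, g, h, rfl⟩
  · rintro I J hI hIJ f a ⟨D, g, h, ha⟩
    exact ⟨D, g, fun x => hIJ (h x), ha⟩
  · rintro I hI f f' a a' ⟨D, g, h, rfl⟩ ⟨D', g', h', rfl⟩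
    obtain ⟨E, hE, hD, hD'⟩ := Θ.cofiltered D.1 D.2 D'.1 D'.2
    refine ⟨⟨E, hE⟩, g.comp (transC hD) + g'.comp (transC hD'), fun x => ?_, ?_⟩
    · have := I.add_mem (h x) (h' x)
      rw [sub_add_sub_comm] at this
      exact this
    · rw [eval_add_apply, dUnif_eval_trans μ (E := ⟨E, hE⟩) hD,
        dUnif_eval_trans μ (E := ⟨E, hE⟩) hD']
  · rintro I hI c f a ⟨D, g, h, rfl⟩
    refine ⟨D, c • g, fun x => ?_, (eval_smul_apply _ _ _).symm⟩
    have := I.mul_mem_left c (h x)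
    rwa [mul_sub] at this
  · rintro I hI a ⟨D, g, h, rfl⟩
    refine wkEval_mem_of_valuesIn _ hI fun d => ?_
    obtain ⟨x, rfl⟩ := D.1.proj_surjective d
    have h1 : (0 : k) - g (D.1.proj x) ∈ I := h x
    rwa [zero_sub, neg_mem_iff] at h1

theorem isApprox_pullUnif (I : Ideal k) (D : Θ.radii) (g : C(D.1, k)) :
    IsApprox I (pullUnif D g).1 D.1 g := fun x => by
  change g (D.1.proj x) - g (D.1.proj x) ∈ I
  rw [sub_self]
  exact I.zero_mem

variable (k Θ) in
theorem exists_unifIntegration : ∃ B : DUnif k Θ →ₗ[k] CUnif k Θ →ₗ[k] k, IsUnifIntegration B ∧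
    ∀ {I : Ideal k}, IsOpen (I : Set k) → ∀ (μ : DUnif k Θ) {f : CUnif k Θ} {D : Θ.radii}
      {g : C(D.1, k)}, IsApprox I f.1 D.1 g → B μ f - WkDual.eval g (μ.1 D) ∈ I := by
  choose φ hφ using exists_unifIntegral (k := k) (Θ := Θ)
  have hφ' : ∀ {I : Ideal k}, IsOpen (I : Set k) → ∀ (μ : DUnif k Θ) {f : CUnif k Θ} {D : Θ.radii}
      {g : C(D.1, k)}, IsApprox I f.1 D.1 g → φ μ f - WkDual.eval g (μ.1 D) ∈ I :=
    fun hI μ f D g h => hφ μ hI ⟨D, g, h, rfl⟩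
  let B : DUnif k Θ →ₗ[k] CUnif k Θ →ₗ[k] k :=
    { toFun := φ
      map_add' := fun μ ν => LinearMap.ext fun f => eq_of_forall_sub_mem fun I hI => by
        obtain ⟨D, g, h⟩ := exists_isApprox f hI
        have := I.sub_mem (hφ' hI (μ + ν) h) (I.add_mem (hφ' hI μ h) (hφ' hI ν h))
        have e : WkDual.eval g ((μ + ν).1 D) = WkDual.eval g (μ.1 D) + WkDual.eval g (ν.1 D) := rfl
        rw [e] at this
        rw [LinearMap.add_apply]
        convert this using 1
        ring
      map_smul' := fun c μ => LinearMap.ext fun f => eq_of_forall_sub_mem fun I hI => by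
        obtain ⟨D, g, h⟩ := exists_isApprox f hI
        have := I.sub_mem (hφ' hI (c • μ) h) (I.mul_mem_left c (hφ' hI μ h))
        have e : WkDual.eval g ((c • μ).1 D) = c * WkDual.eval g (μ.1 D) := rfl
        rw [e] at this
        rw [LinearMap.smul_apply, RingHom.id_apply, smul_eq_mul]
        convert this using 1
        ring }
  refine ⟨B, ⟨fun μ => ?_, fun μ D g => ?_⟩, hφ'⟩
  · refine (isBasisOfOpenSubmodules_cUnif k Θ).continuous (isBasisOfOpenSubmodules_self k) (B μ)
      fun I hI => ⟨I, hI, fun f hf => ?_⟩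
    obtain ⟨D, hD⟩ := Θ.nonempty
    have h : IsApprox I f.1 D (0 : C(D, k)) := fun x => by
      rw [ContinuousMap.zero_apply, sub_zero]
      exact mem_unifValuesIn.1 hf x
    have h1 := hφ' hI μ (D := ⟨D, hD⟩) h
    have e : WkDual.eval (0 : C(D, k)) (μ.1 ⟨D, hD⟩) = 0 :=
      map_zero (show C(D, k) →L[k] k from μ.1 ⟨D, hD⟩)
    rwa [e, sub_zero] at h1
  · exact eq_of_forall_sub_mem fun I hI => hφ' hI μ (isApprox_pullUnif I D g)

/-- Functions pulled back from radii are uniformly dense, and both pairings are continuous in the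
function. -/
theorem IsUnifIntegration.unique {B B' : DUnif k Θ →ₗ[k] CUnif k Θ →ₗ[k] k}
    (h : IsUnifIntegration B) (h' : IsUnifIntegration B') : B = B' := by
  refine LinearMap.ext fun μ => LinearMap.ext fun f => eq_of_forall_sub_mem fun I hI => ?_
  obtain ⟨J, hJ, hle⟩ := (isBasisOfOpenSubmodules_cUnif k Θ).exists_le
    (isBasisOfOpenSubmodules_self k) (h.1 μ) hI
  obtain ⟨J', hJ', hle'⟩ := (isBasisOfOpenSubmodules_cUnif k Θ).exists_le
    (isBasisOfOpenSubmodules_self k) (h'.1 μ) hI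
  obtain ⟨D, g, hg⟩ := exists_isApprox f (isOpen_inf hJ hJ')
  have h1 : B μ (f - pullUnif D g) ∈ I := hle (mem_unifValuesIn.2 fun x => (hg x).1)
  have h2 : B' μ (f - pullUnif D g) ∈ I := hle' (mem_unifValuesIn.2 fun x => (hg x).2)
  rw [map_sub, h.2] at h1
  rw [map_sub, h'.2] at h2
  have := I.sub_mem h1 h2
  rwa [sub_sub_sub_cancel_right] at this

variable (k Θ) in
theorem existsUnique_unifIntegration :
    ∃! B : DUnif k Θ →ₗ[k] CUnif k Θ →ₗ[k] k, IsUnifIntegration B := by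
  obtain ⟨B, hB, -⟩ := exists_unifIntegration k Θ
  exact ⟨B, hB, fun B' hB' => hB'.unique hB⟩

variable {B : DUnif k Θ →ₗ[k] CUnif k Θ →ₗ[k] k}

theorem IsUnifIntegration.sub_mem (hB : IsUnifIntegration B) {I : Ideal k}
    (hI : IsOpen (I : Set k)) (μ : DUnif k Θ) {f : CUnif k Θ} {D : Θ.radii} {g : C(D.1, k)}
    (h : IsApprox I f.1 D.1 g) : B μ f - WkDual.eval g (μ.1 D) ∈ I := by
  obtain ⟨B', hB', h'⟩ := exists_unifIntegration k Θ
  rw [hB.unique hB']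
  exact h' hI μ h

theorem IsUnifIntegration.mem_of_valuesIn (hB : IsUnifIntegration B) {I : Ideal k}
    (hI : IsOpen (I : Set k)) (μ : DUnif k Θ) {f : CUnif k Θ} (hf : ∀ x, f.1 x ∈ I) :
    B μ f ∈ I := by
  obtain ⟨D, g, hg⟩ := exists_isApprox f hI
  have h1 := hB.sub_mem hI μ hg
  have h2 : WkDual.eval g (μ.1 D) ∈ I := wkEval_mem_of_valuesIn _ hI fun d => by
    obtain ⟨x, rfl⟩ := D.1.proj_surjective d
    have := I.sub_mem (hf x) (hg x)
    rwa [sub_sub_cancel] at this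
  have := I.add_mem h1 h2
  rwa [sub_add_cancel] at this

/-- The inverse image of a subset of a radius. -/
def unifPreimage (D : Θ.radii) (V : Clopens D.1) : UnifSets Θ :=
  ⟨D.1.proj ⁻¹' (V : Set D.1), D.1, D.2, V, rfl⟩

/-- Every subset of a discrete space is clopen. -/
def clopenOfSet {Y : Type*} [TopologicalSpace Y] [DiscreteTopology Y] (V : Set Y) : Clopens Y :=
  ⟨V, isClopen_discrete V⟩

theorem exists_eq_unifPreimage {U : UnifSets Θ} {D : DiscreteQuotient X} (hD : D ∈ Θ.radii)
    (hU : IsMeasurableOfRadius D U.1) : ∃ V : Clopens D, U = unifPreimage ⟨D, hD⟩ V := by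
  obtain ⟨V, hV⟩ := hU
  exact ⟨clopenOfSet V, Subtype.ext hV⟩

theorem chiUnif_unifPreimage (D : Θ.radii) (V : Clopens D.1) :
    chiUnif k (unifPreimage D V) = pullUnif D (chi k V) := by
  apply Subtype.ext
  ext x
  change chi k ⟨D.1.proj ⁻¹' (V : Set D.1), _⟩ x = chi k V (D.1.proj x)
  rw [chi_apply, chi_apply]
  rfl

theorem IsUnifIntegration.apply_chiUnif (hB : IsUnifIntegration B) (μ : DUnif k Θ) (D : Θ.radii)
    (V : Clopens D.1) : B μ (chiUnif k (unifPreimage D V)) = acsSetFunction (μ.1 D) V := by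
  rw [chiUnif_unifPreimage, hB.2]
  rfl

theorem IsUnifIntegration.unifSetFunction_unifPreimage (hB : IsUnifIntegration B) (μ : DUnif k Θ) (D : Θ.radii)
    (V : Clopens D.1) : unifSetFunction B μ (unifPreimage D V) = acsSetFunction (μ.1 D) V :=
  hB.apply_chiUnif μ D V

theorem IsUnifIntegration.unifSetFunction_injective (hB : IsUnifIntegration B) :
    Function.Injective (unifSetFunction B) := by
  rw [injective_iff_map_eq_zero]
  intro μ hμ
  refine Subtype.ext (funext fun D => acsSetFunction_injective (funext fun V => ?_))
  rw [← hB.unifSetFunction_unifPreimage, hμ]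
  exact (congrFun (map_zero acsSetFunction) V).symm

/-- Sets of radius `D` are the preimages of subsets of the discrete space `D`, so this is the
additivity of the component of `μ` at `D`. -/
theorem IsUnifIntegration.isUnifMeasure (hB : IsUnifIntegration B) (μ : DUnif k Θ) :
    IsUnifMeasure (TDMeasure.unifSetFunction B μ) := by
  intro D hD F hF hd U hU
  choose V hV using fun W : F => exists_eq_unifPreimage hD (hF W.1 W.2)
  have hU' : U = unifPreimage ⟨D, hD⟩ (clopenOfSet (⋃ W, (V W : Set D))) := by
    apply Subtype.ext
    change U.1 = D.proj ⁻¹' (⋃ W, (V W : Set D))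
    rw [hU, Set.preimage_iUnion, Set.biUnion_eq_iUnion]
    refine Set.iUnion_congr fun W => ?_
    conv_lhs => rw [hV W]
    rfl
  have h := (isAcsMeasure_acsSetFunction (μ.1 ⟨D, hD⟩)).hasSum (V := V)
    (U := clopenOfSet (⋃ W, (V W : Set D))) (fun W W' hne => ?_) rfl
  · rw [hU', hB.unifSetFunction_unifPreimage]
    refine h.congr_fun fun W => ?_
    rw [← hB.unifSetFunction_unifPreimage, ← hV W]
  · have h1 := hd W.2 W'.2 fun h => hne (Subtype.ext h)
    refine Set.disjoint_left.2 fun d hx hx' => ?_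
    obtain ⟨x, rfl⟩ := D.proj_surjective d
    exact Set.disjoint_left.1 h1 (show x ∈ W.1.1 by rw [hV W]; exact hx)
      (show x ∈ W'.1.1 by rw [hV W']; exact hx')

theorem unifPreimage_injective (D : Θ.radii) :
    Function.Injective (unifPreimage (Θ := Θ) D) := by
  intro V V' h
  refine SetLike.coe_injective (Set.preimage_injective.2 D.1.proj_surjective ?_)
  exact congrArg Subtype.val h

theorem IsUnifMeasure.isAcsMeasure {m : UnifSets Θ → k} (hm : IsUnifMeasure m) (D : Θ.radii) :
    IsAcsMeasure fun V : Clopens D.1 => m (unifPreimage D V) := by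
  intro F hF U hU
  have h := hm D.1 D.2 (unifPreimage D '' F) ?_ ?_ (unifPreimage D U) ?_
  · exact ((Equiv.Set.image _ F (unifPreimage_injective D)).hasSum_iff
      (f := fun V : unifPreimage D '' F => m V.1)).2 h
  · rintro _ ⟨V, _, rfl⟩
    exact ⟨V, rfl⟩
  · rintro _ ⟨V, hV, rfl⟩ _ ⟨V', hV', rfl⟩ hne
    exact (hF hV hV' fun h => hne (congrArg _ h)).preimage D.1.proj
  · rw [Set.biUnion_image]
    change D.1.proj ⁻¹' (U : Set D.1) = _
    rw [hU, Set.preimage_iUnion₂]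
    rfl

/-- On the sets of one radius, `m` is an unconditionally additive set function on a discrete space
and comes from a functional; compatibility between radii is checked on set functions, which
determine functionals. -/
theorem IsUnifIntegration.range_unifSetFunction (hB : IsUnifIntegration B) :
    Set.range (TDMeasure.unifSetFunction B) = {m | IsUnifMeasure m} := by
  ext m
  constructor
  · rintro ⟨μ, rfl⟩
    exact hB.isUnifMeasure μ
  · intro (hm : IsUnifMeasure m)
    have hD : ∀ D : Θ.radii, ∃ μ : DAcs D.1 k, acsSetFunction μ =
        fun V : Clopens D.1 => m (unifPreimage D V) := fun D =>
      have := tdSpace_of_discreteTopology D.1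
      (hm.isAcsMeasure D).exists_functional
    choose μ hμ using hD
    refine ⟨⟨μ, fun D E h => acsSetFunction_injective (funext fun V => ?_)⟩, funext fun U => ?_⟩
    · have e : (chi k V).comp (transC h) =
          chi k (clopenOfSet (DiscreteQuotient.ofLE h ⁻¹' (V : Set D.1))) := rfl
      change WkDual.eval ((chi k V).comp (transC h)) (μ E) = _
      rw [e]
      refine (congrFun (hμ E) _).trans ((congrArg m (Subtype.ext ?_)).trans (congrFun (hμ D) V).symm)
      change E.1.proj ⁻¹' (DiscreteQuotient.ofLE h ⁻¹' (V : Set D.1)) = D.1.proj ⁻¹' (V : Set D.1)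
      rw [← Set.preimage_comp, DiscreteQuotient.ofLE_comp_proj]
    · obtain ⟨D, hD, hU⟩ := U.2
      obtain ⟨V, rfl⟩ := exists_eq_unifPreimage hD hU
      rw [hB.unifSetFunction_unifPreimage]
      exact congrFun (hμ ⟨D, hD⟩) V

theorem isProperQuotient_bot (Y : Type*) [TopologicalSpace Y] [DiscreteTopology Y] :
    IsProperQuotient (⊥ : DiscreteQuotient Y) := fun _ =>
  (Set.Subsingleton.finite fun _ hx _ hy =>
    DiscreteQuotient.proj_bot_injective (hx.trans hy.symm)).isCompact

theorem mem_unifNhd {D : DiscreteQuotient X} {J : Ideal k} {μ : DUnif k Θ} :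
    μ ∈ unifNhd B D J ↔ ∀ U : UnifSets Θ, IsMeasurableOfRadius D U.1 → B μ (chiUnif k U) ∈ J := by
  simp only [unifNhd, Submodule.mem_iInf, Submodule.mem_comap, Subtype.forall]
  rfl

theorem IsUnifIntegration.isBasisOfOpenSubmodules (hB : IsUnifIntegration B) :
    IsBasisOfOpenSubmodules
      (fun p : DiscreteQuotient X × Ideal k => p.1 ∈ Θ.radii ∧ IsOpen (p.2 : Set k))
      (fun p => unifNhd B p.1 p.2) := by
  have : Nonempty Θ.radii := Θ.nonempty.to_subtype
  have hb : ∀ D : Θ.radii, IsBasisOfOpenSubmodules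
      (fun p : DiscreteQuotient D.1 × Ideal k => IsProperQuotient p.1 ∧ IsOpen (p.2 : Set k))
      (fun p => acsNhd p.1 p.2) := fun D =>
    have := tdSpace_of_discreteTopology D.1
    isBasisOfOpenSubmodules_acsNhd D.1 k
  have h := isBasisOfOpenSubmodules_of_directed (L := DUnif k Θ)
    (fun D : Θ.radii => (LinearMap.proj D).comp (DUnif k Θ).subtype) ?_ ?_ hb
  · refine h.reindex ?_ ?_
    · rintro ⟨D, R, J⟩ ⟨-, hJ⟩
      -- The members of any partition `R` of `D` pull back to sets of radius `D`.
      refine ⟨(D.1, J), ⟨D.2, hJ⟩, fun μ hμ => (Submodule.mem_iInf _).2 fun e => ?_⟩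
      have h1 := mem_unifNhd.1 hμ (unifPreimage D (fibre R e)) ⟨_, rfl⟩
      rw [hB.apply_chiUnif] at h1
      exact h1
    · rintro ⟨D, J⟩ ⟨hD, hJ⟩
      -- For the partition of `D` into points, values in `J` on the points force values in `J` on
      -- all subsets of `D`, infinite ones included.
      refine ⟨⟨⟨D, hD⟩, ⊥, J⟩, ⟨isProperQuotient_bot D, hJ⟩, fun μ hμ => ?_⟩
      refine mem_unifNhd.2 fun U hU => ?_
      obtain ⟨V, rfl⟩ := exists_eq_unifPreimage hD hU
      rw [hB.apply_chiUnif]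
      have h0 := homMod_eq_zero_of_isConstMod (φ := wkReduce ⟨J, hJ⟩ (μ.1 ⟨D, hD⟩)) (D := ⊥)
        (fun d => (Submodule.Quotient.mk_eq_zero J).2 ((Submodule.mem_iInf _).1 hμ d))
        (f := chi k V) (fun x y hxy => by
          rw [DiscreteQuotient.proj_bot_injective hxy, sub_self]
          exact J.zero_mem)
      exact (Submodule.Quotient.mk_eq_zero J).1 h0
  · change TopologicalSpace.induced _ (⨅ D, TopologicalSpace.induced _ _) = _
    rw [induced_iInf]
    refine iInf_congr fun D => ?_
    rw [induced_compose]
    rfl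
  · intro D D'
    obtain ⟨E, hE, h1, h2⟩ := Θ.cofiltered D.1 D.2 D'.1 D'.2
    have h : ∀ {D : Θ.radii} (hD : E ≤ D.1), ∃ v : DAcs E k → DAcs D.1 k, Continuous v ∧
        (fun μ : DUnif k Θ => μ.1 D) = v ∘ fun μ : DUnif k Θ => μ.1 ⟨E, hE⟩ := fun {D} hD => by
      refine ⟨_, wkDual_continuous_transpose (pullback (transC hD)), ?_⟩
      funext μ
      exact (μ.2 D ⟨E, hE⟩ hD).symm
    exact ⟨⟨E, hE⟩, h h1, h h2⟩

/-! ### Maps between the spaces of measures -/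

variable (k Θ) in
theorem continuous_inc : Continuous (inc k Θ) :=
  Continuous.subtype_mk (continuous_pi fun _ => wkDual_continuous_transpose _) _

theorem IsUnifIntegration.apply_inc (hB : IsUnifIntegration B) (μ : DAcs X k) (f : CUnif k Θ) :
    B (inc k Θ μ) f = WkDual.eval f.1 μ := by
  refine eq_of_forall_sub_mem fun I hI => ?_
  obtain ⟨D, g, hg⟩ := exists_isApprox f hI
  have h1 := hB.sub_mem hI (inc k Θ μ) hg
  have h2 : WkDual.eval (f.1 - g.comp (projC D.1)) μ ∈ I := wkEval_mem_of_valuesIn _ hI hg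
  rw [eval_sub_apply] at h2
  have e : WkDual.eval g ((inc k Θ μ).1 D) = WkDual.eval (g.comp (projC D.1)) μ := rfl
  rw [e] at h1
  have := I.sub_mem h1 h2
  rwa [sub_sub_sub_cancel_right] at this

/-- Around each point of `C` some fibre of a radius stays inside `C`; compactness and common
refinement make one radius work for all points. -/
theorem exists_radius_compactOpens (Θ : TDUniformity X) {C : Set X} (hC : IsCompact C)
    (hC' : IsOpen C) : ∃ D ∈ Θ.radii, IsMeasurableOfRadius D C := by
  obtain ⟨D, hD, h⟩ : ∃ D ∈ Θ.radii, ∀ x ∈ C, ∀ y, D.proj y = D.proj x → y ∈ C := by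
    refine hC.induction_on (p := fun s => ∃ D ∈ Θ.radii, ∀ x ∈ s, ∀ y, D.proj y = D.proj x → y ∈ C)
      ?_ ?_ ?_ ?_
    · obtain ⟨D, hD⟩ := Θ.nonempty
      exact ⟨D, hD, by simp⟩
    · rintro s t hst ⟨D, hD, h⟩
      exact ⟨D, hD, fun x hx => h x (hst hx)⟩
    · rintro s t ⟨D, hD, h⟩ ⟨D', hD', h'⟩
      obtain ⟨E, hE, h1, h2⟩ := Θ.cofiltered D hD D' hD'
      refine ⟨E, hE, ?_⟩
      rintro x (hx | hx) y hy
      · exact h x hx y (proj_eq_of_le h1 hy)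
      · exact h' x hx y (proj_eq_of_le h2 hy)
    · intro x hx
      obtain ⟨_, ⟨D, hD, d, rfl⟩, hxd, hdC⟩ := Θ.neat.exists_subset_of_mem_open hx hC'
      refine ⟨D.proj ⁻¹' {d}, mem_nhdsWithin_of_mem_nhds ((D.isOpen_preimage _).mem_nhds hxd), D, hD,
        fun y hy z hz => hdC (hz.trans hy)⟩
  refine ⟨D, hD, D.proj '' C, Set.Subset.antisymm (Set.subset_preimage_image _ _) ?_⟩
  rintro y ⟨x, hx, hxy⟩
  exact h x hx y hxy.symm

theorem exists_radius_finset (Θ : TDUniformity X) (F : Finset (CompactOpens X)) :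
    ∃ D ∈ Θ.radii, ∀ C ∈ F, IsMeasurableOfRadius D (C : Set X) := by
  classical
  induction F using Finset.induction_on with
  | empty =>
    obtain ⟨D, hD⟩ := Θ.nonempty
    exact ⟨D, hD, by simp⟩
  | insert C F _ ih =>
    obtain ⟨D, hD, h⟩ := ih
    obtain ⟨D', hD', h'⟩ := exists_radius_compactOpens Θ C.isCompact C.isOpen
    obtain ⟨E, hE, h1, h2⟩ := Θ.cofiltered D hD D' hD'
    refine ⟨E, hE, fun C' hC' => ?_⟩
    rcases Finset.mem_insert.1 hC' with rfl | hC'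
    · exact h'.mono h2
    · exact (h C' hC').mono h1

theorem IsMeasurableOfRadius.mem_iff {D : DiscreteQuotient X} {U : Set X}
    (h : IsMeasurableOfRadius D U) {x y : X} (hxy : D.proj x = D.proj y) : x ∈ U ↔ y ∈ U := by
  obtain ⟨V, rfl⟩ := h
  rw [Set.mem_preimage, Set.mem_preimage, hxy]

variable [TDSpace X]

variable (k Θ) in
-- Modulo `I`, `f` is a step function on finitely many compact open sets and zero elsewhere. A
-- radius that measures these sets does not separate points of one of them from each other's class,
-- and off them `f` is in `I`.
theorem acsSubmodule_le_unifSubmodule : acsSubmodule X k ≤ unifSubmodule k Θ := by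
  classical
  intro f hf I hI
  obtain ⟨D, s, hD, hs⟩ := exists_isStepMod (⟨f, hf⟩ : CAcs X k) hI
  obtain ⟨E, hE, h⟩ := exists_radius_finset Θ (s.image (compactFibre hD))
  have hx : ∀ x y, E.proj x = E.proj y → D.proj x ∈ s → D.proj y = D.proj x := by
    intro x y hxy hx
    exact ((h _ (Finset.mem_image_of_mem _ hx)).mem_iff hxy).1 rfl
  refine ⟨E, hE, fun x y hxy => ?_⟩
  by_cases h1 : D.proj x ∈ s
  · exact hs.1 x y (hx x y hxy h1).symm
  · have h2 : D.proj y ∉ s := fun h2 => h1 (hx y x hxy.symm h2 ▸ h2)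
    exact I.sub_mem (hs.2 x h1) (hs.2 y h2)

/-- The inclusion of the functions with almost compact support into the uniformly continuous ones. -/
def acsToUnif (f : CAcs X k) : CUnif k Θ := ⟨f.1, acsSubmodule_le_unifSubmodule k Θ f.2⟩

/-- The measure on compact open sets given by a uniform measure. -/
def IsUnifIntegration.toDMeas (hB : IsUnifIntegration B) : DUnif k Θ →ₗ[k] DMeas X k where
  toFun μ := (⟨{ toFun := fun f => B μ (acsToUnif f)
                 map_add' := fun f g => map_add (B μ) (acsToUnif f) (acsToUnif g)
                 map_smul' := fun c f => map_smul (B μ) c (acsToUnif f) },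
    (isBasisOfOpenSubmodules_cAcs X k).continuous (isBasisOfOpenSubmodules_self k)
      { toFun := fun f => B μ (acsToUnif f)
        map_add' := fun f g => map_add (B μ) (acsToUnif f) (acsToUnif g)
        map_smul' := fun c f => map_smul (B μ) c (acsToUnif f) }
      fun I hI => ⟨I, hI, fun _ hf => hB.mem_of_valuesIn hI μ (mem_acsValuesIn.1 hf)⟩⟩ :
      CAcs X k →L[k] k)
  map_add' μ ν := WkDual.ext fun f => congrArg (fun φ => φ (acsToUnif f)) (map_add B μ ν)
  map_smul' c μ := WkDual.ext fun f => congrArg (fun φ => φ (acsToUnif f)) (map_smul B c μ)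

theorem IsUnifIntegration.eval_toDMeas (hB : IsUnifIntegration B) (μ : DUnif k Θ) (f : CAcs X k) :
    WkDual.eval f (hB.toDMeas μ) = B μ (acsToUnif f) := rfl

theorem IsUnifIntegration.continuous_toDMeas (hB : IsUnifIntegration B) :
    Continuous hB.toDMeas := by
  refine hB.isBasisOfOpenSubmodules.continuous (isBasisOfOpenSubmodules_measNhd X k) _ ?_
  rintro ⟨F, I⟩ hI
  obtain ⟨D, hD, h⟩ := exists_radius_finset Θ F
  refine ⟨(D, I), ⟨hD, hI⟩, fun μ hμ => ?_⟩
  simp only [measNhd, Submodule.mem_iInf, Submodule.mem_comap]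
  intro C hC
  exact mem_unifNhd.1 hμ ⟨C, D, hD, h C hC⟩ (h C hC)

end Uniform

/-! ### Charts for the spaces of measures -/

section Charts

variable {X : Type*} [TopologicalSpace X]
variable {k : Type*} [CommRing k] [UniformSpace k] [IsUniformAddGroup k] [IsTopologicalRing k]
  [BaseRing k]

variable (k) in
/-- The Dirac measure at `x`. -/
def dirac (x : X) : DAcs X k := ContinuousMap.evalCLM k x

theorem eval_dirac (x : X) (f : C(X, k)) : WkDual.eval f (dirac k x) = f x := rfl

variable (k) in
/-- The Dirac measure at `x`, on the functions with almost compact support. -/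
def diracAcs (x : X) : DMeas X k :=
  (⟨{ toFun := fun f => f.1 x
      map_add' := fun _ _ => rfl
      map_smul' := fun _ _ => rfl },
    (isBasisOfOpenSubmodules_cAcs X k).continuous (isBasisOfOpenSubmodules_self k)
      { toFun := fun f => f.1 x
        map_add' := fun _ _ => rfl
        map_smul' := fun _ _ => rfl }
      fun I hI => ⟨I, hI, fun _ hf => mem_acsValuesIn.1 hf x⟩⟩ : CAcs X k →L[k] k)

theorem eval_diracAcs (x : X) (f : CAcs X k) : WkDual.eval f (diracAcs k x) = f.1 x := rfl

theorem mul_sub_mul_mem {I : Ideal k} {a a' b b' : k} (ha : a - a' ∈ I) (hb : b - b' ∈ I) :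
    a * b - a' * b' ∈ I := by
  have := I.add_mem (I.mul_mem_left a hb) (I.mul_mem_right b' ha)
  convert this using 1
  ring

theorem chi_fibre_out (D : DiscreteQuotient X) [DecidableEq D] (d e : D) :
    chi k (fibre D d) (Quotient.out e) = if e = d then 1 else 0 := by
  split_ifs with h
  · exact chi_of_mem (mem_fibre.2 ((proj_out D e).trans h))
  · exact chi_of_notMem (mt mem_fibre.1 fun h' => h ((proj_out D e).symm.trans h'))

theorem sub_sum_ite_mem {ι : Type*} [DecidableEq ι] {J : Ideal k} (a : ι → k) {s : Finset ι}
    (hs : ∀ i ∉ s, a i ∈ J) (j : ι) : a j - ∑ i ∈ s, a i * (if i = j then 1 else 0) ∈ J := by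
  simp only [mul_ite, mul_one, mul_zero, Finset.sum_ite_eq']
  split_ifs with h
  · rw [sub_self]
    exact J.zero_mem
  · rw [sub_zero]
    exact hs j h

/-- Subtracting the Dirac combination leaves a functional whose values on all fibres lie in `J`; its
reduction modulo `J` then kills every function constant modulo `J` on the fibres. -/
theorem sub_sum_dirac_mem {D : DiscreteQuotient X} {J : Ideal k} (hJ : IsOpen (J : Set k))
    (μ : DAcs X k) {s : Finset D} (hs : ∀ d ∉ s, WkDual.eval (chi k (fibre D d)) μ ∈ J)
    {f : C(X, k)} (hf : IsConstMod D J f) :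
    WkDual.eval f μ - ∑ d ∈ s, WkDual.eval (chi k (fibre D d)) μ * f (Quotient.out d) ∈ J := by
  classical
  have e : ∀ g : C(X, k), WkDual.eval g (μ - ∑ d ∈ s, WkDual.eval (chi k (fibre D d)) μ •
      dirac k (Quotient.out d)) =
      WkDual.eval g μ - ∑ d ∈ s, WkDual.eval (chi k (fibre D d)) μ * g (Quotient.out d) := by
    intro g
    rw [map_sub, map_sum]
    simp only [map_smul, eval_dirac, smul_eq_mul]
  rw [← e]
  generalize hν : μ - ∑ d ∈ s, WkDual.eval (chi k (fibre D d)) μ • dirac k (Quotient.out d) = ν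
    at e ⊢
  refine (Submodule.Quotient.mk_eq_zero J).1 (homMod_eq_zero_of_isConstMod (Q := ⟨J, hJ⟩)
    (φ := wkReduce ⟨J, hJ⟩ ν) (fun d => (Submodule.Quotient.mk_eq_zero J).2 ?_) hf)
  change WkDual.eval (chi k (fibre D d)) ν ∈ J
  rw [e]
  simp only [chi_fibre_out]
  exact sub_sum_ite_mem (fun d => WkDual.eval (chi k (fibre D d)) μ) hs d

/-- The chart of a partition and an open ideal. -/
def acsChart (D : DiscreteQuotient X) {J : Ideal k} (hJ : IsOpen (J : Set k)) :
    CoproductChart (fun f : C(X, k) => WkDual.eval (k := k) f) (chi k) D where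
  J := J
  isOpen_J := hJ
  -- Constancy is exact rather than modulo `J`: when charts are refined, `J` shrinks while the set
  -- of functions must grow.
  fns := {f | IsConstMod D (⊥ : Ideal k) f}
  mul_mem _ hf _ hg := hf.mul hg
  e := fibre D
  e_mem := isConstMod_chi_fibre D ⊥
  δ d := dirac k (Quotient.out d)
  map_mul _ _ _ := rfl
  finite μ := (isAcsMeasure_acsSetFunction μ).finite_fibre D hJ
  sub_sum_mem μ _ hs _ hf := sub_sum_dirac_mem hJ μ hs (hf.mono le_rfl bot_le)

theorem ann_acsChart (D : DiscreteQuotient X) {J : Ideal k} (hJ : IsOpen (J : Set k)) :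
    (acsChart D hJ).ann = acsNhd D J := by
  ext μ
  rw [CoproductChart.mem_ann]
  constructor
  · exact fun h => (Submodule.mem_iInf _).2 fun d => h _ (isConstMod_chi_fibre D ⊥ d)
  · intro h f hf
    have := sub_sum_dirac_mem hJ μ (s := ∅) (fun d _ => (Submodule.mem_iInf _).1 h d)
      (hf.mono le_rfl bot_le)
    rwa [Finset.sum_empty, sub_zero] at this

theorem isConstMod_sample (D : DiscreteQuotient X) (I : Ideal k) (f : X → k) :
    IsConstMod D I ((sample D f).comp (projC D)) := fun x y h => by
  change sample D f (D.proj x) - sample D f (D.proj y) ∈ I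
  rw [h, sub_self]
  exact I.zero_mem

/-! ### The atlases of the two weak duals. -/

section

variable [TDSpace X]

variable (X k) in
/-- The atlas of the space of measures with almost compact support. -/
def acsAtlas : CoproductAtlas (fun f : C(X, k) => WkDual.eval (k := k) f) (chi k) where
  𝒞 := {p : DiscreteQuotient X × Ideal k // IsProperQuotient p.1 ∧ IsOpen (p.2 : Set k)}
  idx p := p.1.1
  chart p := acsChart p.1.1 p.2.2
  isOpen_ann p := by
    rw [ann_acsChart]
    exact (isBasisOfOpenSubmodules_acsNhd X k).1 p.1 p.2
  exists_ann_le P hP := by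
    obtain ⟨p, hp, h⟩ := (isBasisOfOpenSubmodules_acsNhd X k).isOpen_iff.1 hP
    exact ⟨⟨p, hp⟩, (ann_acsChart _ _).trans_le h⟩
  refine p q := ⟨⟨(p.1.1 ⊓ q.1.1, p.1.2 ⊓ q.1.2), p.2.1.of_le inf_le_left, isOpen_inf p.2.2 q.2.2⟩,
    fun _ hf => IsConstMod.mono hf inf_le_left le_rfl,
    fun _ hf => IsConstMod.mono hf inf_le_right le_rfl, inf_le_left, inf_le_right⟩
  approx f g I hI := by
    obtain ⟨E, hE⟩ := exists_properQuotient X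
    let D := levelQuotient f hI ⊓ levelQuotient g hI ⊓ E
    have hf : IsConstMod D I f :=
      (isConstMod_levelQuotient f hI).mono (inf_le_left.trans inf_le_left) le_rfl
    have hg : IsConstMod D I g :=
      (isConstMod_levelQuotient g hI).mono (inf_le_left.trans inf_le_right) le_rfl
    refine ⟨⟨(D, I), hE.of_le inf_le_right, hI⟩, le_rfl, _, isConstMod_sample D ⊥ f, _,
      isConstMod_sample D ⊥ g, fun μ => ?_, fun μ => ?_, fun μ => ?_⟩
    · rw [← eval_sub_apply]
      exact wkEval_mem_of_valuesIn _ hI fun x => sub_sample_mem hf x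
    · rw [← eval_sub_apply]
      exact wkEval_mem_of_valuesIn _ hI fun x => sub_sample_mem hg x
    · rw [← eval_sub_apply]
      exact wkEval_mem_of_valuesIn _ hI fun x =>
        mul_sub_mul_mem (sub_sample_mem hf x) (sub_sample_mem hg x)

theorem IsStepMod.mono {D E : DiscreteQuotient X} {s : Finset D} {t : Finset E} {I J : Ideal k}
    {f : X → k} (h : IsStepMod D s I f) (hE : E ≤ D) (hst : ∀ x, D.proj x ∈ s → E.proj x ∈ t)
    (hI : I ≤ J) : IsStepMod E t J f :=
  ⟨h.1.mono hE hI, fun x hx => hI (h.2 x (mt (hst x) hx))⟩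

theorem isStepMod_chi_fibre {D : DiscreteQuotient X} {s : Finset D} (I : Ideal k) {d : D}
    (hd : d ∈ s) : IsStepMod D s I (chi k (fibre D d)) :=
  ⟨isConstMod_chi_fibre D I d, fun x hx => by
    rw [chi_of_notMem (mt mem_fibre.1 fun h => hx (h ▸ hd))]
    exact I.zero_mem⟩

theorem IsStepMod.sub_sum_dirac_mem {D : DiscreteQuotient X} (hD : IsProperQuotient D)
    {s : Finset D} {J : Ideal k} (hJ : IsOpen (J : Set k)) (μ : DMeas X k) {t : Finset s}
    (ht : ∀ d ∉ t, WkDual.eval (chiAcs k (compactFibre hD d.1)) μ ∈ J) {f : CAcs X k}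
    (hf : IsStepMod D s J f.1) :
    WkDual.eval f μ -
      ∑ d ∈ t, WkDual.eval (chiAcs k (compactFibre hD d.1)) μ * f.1 (Quotient.out d.1) ∈ J := by
  classical
  have e : ∀ g : CAcs X k, WkDual.eval g (μ - ∑ d ∈ t,
      WkDual.eval (chiAcs k (compactFibre hD d.1)) μ • diracAcs k (Quotient.out d.1)) =
      WkDual.eval g μ -
        ∑ d ∈ t, WkDual.eval (chiAcs k (compactFibre hD d.1)) μ * g.1 (Quotient.out d.1) := by
    intro g
    rw [map_sub, map_sum]
    simp only [map_smul, eval_diracAcs, smul_eq_mul]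
  rw [← e]
  refine hf.eval_mem hD hJ fun d hd => ?_
  rw [e]
  have h : ∀ i : s, (chiAcs k (compactFibre hD d)).1 (Quotient.out i.1) =
      if i = ⟨d, hd⟩ then 1 else 0 := fun i =>
    (chi_fibre_out D d i.1).trans (if_congr
      ⟨fun h => Subtype.ext h, fun h => congrArg Subtype.val h⟩ rfl rfl)
  simp only [h]
  exact sub_sum_ite_mem (fun d : s => WkDual.eval (chiAcs k (compactFibre hD d.1)) μ) ht ⟨d, hd⟩

/-- The chart of a finite set of members of a partition and an open ideal. -/
def measChart {D : DiscreteQuotient X} (hD : IsProperQuotient D) (s : Finset D) {J : Ideal k}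
    (hJ : IsOpen (J : Set k)) :
    CoproductChart (fun f : CAcs X k => WkDual.eval (k := k) f) (chiAcs k) s where
  J := J
  isOpen_J := hJ
  fns := {f | IsStepMod D s (⊥ : Ideal k) f.1}
  mul_mem _ hf g hg := ⟨hf.1.mul hg.1, fun x hx => Ideal.mul_mem_right (g.1 x) _ (hf.2 x hx)⟩
  e d := compactFibre hD d.1
  e_mem d := isStepMod_chi_fibre ⊥ d.2
  δ d := diracAcs k (Quotient.out d.1)
  map_mul _ _ _ := rfl
  finite _ := Set.toFinite _
  sub_sum_mem μ _ ht _ hf := IsStepMod.sub_sum_dirac_mem hD hJ μ ht (hf.mono le_rfl (fun _ => id) bot_le)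

theorem isOpen_ann_measChart {D : DiscreteQuotient X} (hD : IsProperQuotient D) (s : Finset D)
    {J : Ideal k} (hJ : IsOpen (J : Set k)) : IsOpen ((measChart hD s hJ).ann : Set (DMeas X k)) := by
  classical
  refine (isBasisOfOpenSubmodules_measNhd X k).isOpen_iff.2 ⟨(s.image (compactFibre hD), J), hJ,
    fun μ hμ => (CoproductChart.mem_ann _).2 fun f hf => ?_⟩
  simp only [measNhd, Submodule.mem_iInf, Submodule.mem_comap] at hμ
  exact (hf.mono le_rfl (fun _ => id) bot_le).eval_mem hD hJ fun d hd =>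
    hμ _ (Finset.mem_image_of_mem _ hd)

theorem exists_common_step {D D' : DiscreteQuotient X} (hD : IsProperQuotient D)
    (hD' : IsProperQuotient D') (s : Finset D) (s' : Finset D') :
    ∃ t : Finset (D ⊓ D' : DiscreteQuotient X), (∀ x, D.proj x ∈ s → (D ⊓ D').proj x ∈ t) ∧
      ∀ x, D'.proj x ∈ s' → (D ⊓ D').proj x ∈ t := by
  have h := finite_image_proj (D ⊓ D') ((hD.isCompact_preimage s).union (hD'.isCompact_preimage s'))
  exact ⟨h.toFinset, fun x hx => h.mem_toFinset.2 ⟨x, Or.inl hx, rfl⟩,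
    fun x hx => h.mem_toFinset.2 ⟨x, Or.inr hx, rfl⟩⟩

/-- The partition into `C` and its complement, intersected with a proper partition; `C` meets
finitely many fibres. -/
theorem exists_isStepMod_chiAcs (C : CompactOpens X) : ∃ (D : DiscreteQuotient X) (s : Finset D),
    IsProperQuotient D ∧ IsStepMod D s (⊥ : Ideal k) (chiAcs k C).1 := by
  obtain ⟨E, hE⟩ := exists_properQuotient X
  have h : ∀ x, ∀ᶠ y in 𝓝 x, Setoid.ker (· ∈ (C : Set X)) x y := fun x => by
    filter_upwards [eventually_mem_iff ⟨C.isCompact.isClosed, C.isOpen⟩ x] with y hy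
    exact (propext hy).symm
  have hf := finite_image_proj (quotientOfSetoid _ h ⊓ E) C.isCompact
  refine ⟨quotientOfSetoid _ h ⊓ E, hf.toFinset, hE.of_le inf_le_right, fun x y hxy => ?_,
    fun x hx => ?_⟩
  · have h1 : (x ∈ (C : Set X)) = (y ∈ (C : Set X)) :=
      quotientOfSetoid_proj_eq.1 (proj_eq_of_le inf_le_left hxy)
    have : (chiAcs k C).1 x = (chiAcs k C).1 y := by
      by_cases hx : x ∈ (C : Set X)
      · rw [chiAcs_apply, chiAcs_apply, chi_of_mem (U := compactOpenClopen C) hx,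
          chi_of_mem (U := compactOpenClopen C) (h1 ▸ hx)]
      · rw [chiAcs_apply, chiAcs_apply, chi_of_notMem (U := compactOpenClopen C) hx,
          chi_of_notMem (U := compactOpenClopen C) (h1 ▸ hx)]
    rw [this, sub_self]
    exact Ideal.zero_mem _
  · rw [chiAcs_apply, chi_of_notMem (U := compactOpenClopen C) fun h' =>
      hx (hf.mem_toFinset.2 ⟨x, h', rfl⟩)]
    exact Ideal.zero_mem _

theorem exists_isStepMod_finset (F : Finset (CompactOpens X)) :
    ∃ (D : DiscreteQuotient X) (s : Finset D), IsProperQuotient D ∧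
      ∀ C ∈ F, IsStepMod D s (⊥ : Ideal k) (chiAcs k C).1 := by
  classical
  induction F using Finset.induction_on with
  | empty =>
    obtain ⟨D, hD⟩ := exists_properQuotient X
    exact ⟨D, ∅, hD, by simp⟩
  | insert C F _ ih =>
    obtain ⟨D, s, hD, h⟩ := ih
    obtain ⟨D', s', hD', h'⟩ := exists_isStepMod_chiAcs (k := k) C
    obtain ⟨t, ht, ht'⟩ := exists_common_step hD hD' s s'
    refine ⟨D ⊓ D', t, hD.of_le inf_le_left, fun C' hC' => ?_⟩
    rcases Finset.mem_insert.1 hC' with rfl | hC'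
    · exact h'.mono inf_le_right ht' le_rfl
    · exact (h C' hC').mono inf_le_left ht le_rfl

/-- The step function which takes the values of `f` at chosen points of the fibres in `s`. -/
def sampleAcs {D : DiscreteQuotient X} (hD : IsProperQuotient D) (s : Finset D) (f : CAcs X k) :
    CAcs X k := ∑ d ∈ s, f.1 (Quotient.out d) • chiAcs k (compactFibre hD d)

theorem isStepMod_sampleAcs {D : DiscreteQuotient X} (hD : IsProperQuotient D) (s : Finset D)
    (I : Ideal k) (f : CAcs X k) : IsStepMod D s I (sampleAcs hD s f).1 := by
  have e : (sampleAcs hD s f).1 = ∑ d ∈ s, f.1 (Quotient.out d) • chi k (fibre D d) := by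
    change acsIncl X k (∑ d ∈ s, f.1 (Quotient.out d) • chiAcs k (compactFibre hD d)) = _
    rw [map_sum]
    rfl
  have h : ∀ x, (sampleAcs hD s f).1 x =
      ∑ d ∈ s, f.1 (Quotient.out d) * chi k (fibre D d) x := fun x => by
    rw [e, ContinuousMap.sum_apply]
    rfl
  constructor
  · intro x y hxy
    rw [h, h, ← Finset.sum_sub_distrib]
    refine I.sum_mem fun d _ => ?_
    rw [← mul_sub]
    exact I.mul_mem_left _ (isConstMod_chi_fibre D I d x y hxy)
  · intro x hx
    rw [h]
    exact I.sum_mem fun d hd => I.mul_mem_left _ ((isStepMod_chi_fibre I hd).2 x hx)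

theorem IsStepMod.sub_sampleAcs_mem {D : DiscreteQuotient X} {s : Finset D} {I : Ideal k}
    {f : CAcs X k} (hf : IsStepMod D s I f.1) (hD : IsProperQuotient D) (x : X) :
    f.1 x - (sampleAcs hD s f).1 x ∈ I := mem_acsValuesIn.1 (hf.sub_sum_mem hD) x

variable (X k) in
/-- The atlas of the space of measures. -/
def measAtlas : CoproductAtlas (fun f : CAcs X k => WkDual.eval (k := k) f) (chiAcs k) where
  𝒞 := {p : ((D : DiscreteQuotient X) × Finset D) × Ideal k //
    IsProperQuotient p.1.1 ∧ IsOpen (p.2 : Set k)}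
  idx p := p.1.1.2
  chart p := measChart p.2.1 p.1.1.2 p.2.2
  isOpen_ann p := isOpen_ann_measChart p.2.1 p.1.1.2 p.2.2
  exists_ann_le P hP := by
    obtain ⟨⟨F, I⟩, hI, h⟩ := (isBasisOfOpenSubmodules_measNhd X k).isOpen_iff.1 hP
    obtain ⟨D, s, hD, hs⟩ := exists_isStepMod_finset (k := k) F
    refine ⟨⟨(⟨D, s⟩, I), hD, hI⟩, fun μ hμ => h ?_⟩
    simp only [measNhd, Submodule.mem_iInf, Submodule.mem_comap]
    exact fun C hC => (CoproductChart.mem_ann _).1 hμ _ (hs C hC)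
  refine p q := by
    obtain ⟨t, ht, ht'⟩ := exists_common_step p.2.1 q.2.1 p.1.1.2 q.1.1.2
    exact ⟨⟨(⟨_, t⟩, p.1.2 ⊓ q.1.2), p.2.1.of_le inf_le_left, isOpen_inf p.2.2 q.2.2⟩,
      fun _ hf => IsStepMod.mono hf inf_le_left ht le_rfl,
      fun _ hf => IsStepMod.mono hf inf_le_right ht' le_rfl, inf_le_left, inf_le_right⟩
  approx f g I hI := by
    obtain ⟨D, s, hD, hf⟩ := exists_isStepMod f hI
    obtain ⟨D', s', hD', hg⟩ := exists_isStepMod g hI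
    obtain ⟨t, ht, ht'⟩ := exists_common_step hD hD' s s'
    have hE := hD.of_le (E := D ⊓ D') inf_le_left
    replace hf := hf.mono inf_le_left ht le_rfl
    replace hg := hg.mono inf_le_right ht' le_rfl
    refine ⟨⟨(⟨_, t⟩, I), hE, hI⟩, le_rfl, _, isStepMod_sampleAcs hE t ⊥ f, _,
      isStepMod_sampleAcs hE t ⊥ g, fun μ => ?_, fun μ => ?_, fun μ => ?_⟩
    · rw [← eval_sub_apply]
      exact eval_mem_of_acsValuesIn _ hI fun x => hf.sub_sampleAcs_mem hE x
    · rw [← eval_sub_apply]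
      exact eval_mem_of_acsValuesIn _ hI fun x => hg.sub_sampleAcs_mem hE x
    · rw [← eval_sub_apply]
      exact eval_mem_of_acsValuesIn _ hI fun x =>
        mul_sub_mul_mem (hf.sub_sampleAcs_mem hE x) (hg.sub_sampleAcs_mem hE x)

theorem chiAcs_inf (C C' : CompactOpens X) :
    chiAcs k (C ⊓ C') = chiAcs k C * chiAcs k C' :=
  Subtype.ext (chi_inf (compactOpenClopen C) (compactOpenClopen C'))

end

/-! ### The atlas of the uniform measures. -/

variable {Θ : TDUniformity X} {B : DUnif k Θ →ₗ[k] CUnif k Θ →ₗ[k] k}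

theorem IsConstMod.eq_pullUnif {D : Θ.radii} {f : CUnif k Θ}
    (hf : IsConstMod D.1 (⊥ : Ideal k) f.1) : f = pullUnif D (sample D.1 f.1) :=
  Subtype.ext (ContinuousMap.ext fun x => sub_eq_zero.1 (hf.sub_out_mem x))

theorem IsUnifIntegration.apply_of_isConstMod (hB : IsUnifIntegration B) (μ : DUnif k Θ)
    {D : Θ.radii} {f : CUnif k Θ} (hf : IsConstMod D.1 (⊥ : Ideal k) f.1) :
    B μ f = WkDual.eval (sample D.1 f.1) (μ.1 D) := by
  conv_lhs => rw [hf.eq_pullUnif]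
  exact hB.2 μ D _

theorem isConstMod_bot {Y : Type*} [TopologicalSpace Y] [DiscreteTopology Y] (I : Ideal k)
    (f : Y → k) : IsConstMod (⊥ : DiscreteQuotient Y) I f := fun x y h => by
  rw [DiscreteQuotient.proj_bot_injective h, sub_self]
  exact I.zero_mem

theorem isConstMod_chiUnif (D : Θ.radii) (V : Clopens D.1) :
    IsConstMod D.1 (⊥ : Ideal k) (chiUnif k (unifPreimage D V)).1 := fun x y h => by
  rw [chiUnif_unifPreimage]
  change chi k V (D.1.proj x) - chi k V (D.1.proj y) ∈ _
  rw [h, sub_self]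
  exact Ideal.zero_mem _

/-- The chart of a radius and an open ideal. -/
def IsUnifIntegration.chart (hB : IsUnifIntegration B) (D : Θ.radii) {J : Ideal k}
    (hJ : IsOpen (J : Set k)) :
    CoproductChart (fun f : CUnif k Θ => B.flip f) (chiUnif k) (⊥ : DiscreteQuotient D.1) where
  J := J
  isOpen_J := hJ
  fns := {f | IsConstMod D.1 (⊥ : Ideal k) f.1}
  mul_mem _ hf _ hg := hf.mul hg
  e d := unifPreimage D (fibre ⊥ d)
  e_mem d := isConstMod_chiUnif D _
  -- The indices are classes of the finest partition of `D`: the inner `Quotient.out` returns to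
  -- `D`, the outer one picks a point of the fibre in `X`.
  δ d := inc k Θ (dirac k (Quotient.out (Quotient.out d)))
  map_mul f g d := by
    simp only [LinearMap.flip_apply, hB.apply_inc]
    rfl
  finite μ := by
    simp only [LinearMap.flip_apply, hB.apply_chiUnif]
    exact (isAcsMeasure_acsSetFunction (μ.1 D)).finite_fibre ⊥ hJ
  sub_sum_mem μ s hs f hf := by
    simp only [LinearMap.flip_apply, hB.apply_chiUnif, hB.apply_inc] at hs ⊢
    rw [hB.apply_of_isConstMod μ hf]
    exact sub_sum_dirac_mem hJ (μ.1 D) hs (isConstMod_bot J _)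

theorem IsUnifIntegration.ann_chart (hB : IsUnifIntegration B) (D : Θ.radii) {J : Ideal k}
    (hJ : IsOpen (J : Set k)) : (hB.chart D hJ).ann = unifNhd B D.1 J := by
  ext μ
  rw [CoproductChart.mem_ann, mem_unifNhd]
  constructor
  · intro h U hU
    obtain ⟨V, rfl⟩ := exists_eq_unifPreimage D.2 hU
    exact h _ (isConstMod_chiUnif D V)
  · intro h f hf
    have := (hB.chart D hJ).sub_sum_mem μ ∅ (fun d _ => h (unifPreimage D (fibre ⊥ d)) ⟨_, rfl⟩) f hf
    rwa [Finset.sum_empty, sub_zero] at this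

/-- The atlas of the space of uniform measures. -/
def IsUnifIntegration.atlas (hB : IsUnifIntegration B) :
    CoproductAtlas (fun f : CUnif k Θ => B.flip f) (chiUnif k) where
  𝒞 := {p : DiscreteQuotient X × Ideal k // p.1 ∈ Θ.radii ∧ IsOpen (p.2 : Set k)}
  idx p := (⊥ : DiscreteQuotient p.1.1)
  chart p := hB.chart ⟨p.1.1, p.2.1⟩ p.2.2
  isOpen_ann p := by
    rw [hB.ann_chart]
    exact hB.isBasisOfOpenSubmodules.1 p.1 p.2
  exists_ann_le P hP := by
    obtain ⟨p, hp, h⟩ := hB.isBasisOfOpenSubmodules.isOpen_iff.1 hP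
    exact ⟨⟨p, hp⟩, (hB.ann_chart _ _).trans_le h⟩
  refine p q := by
    obtain ⟨E, hE, h, h'⟩ := Θ.cofiltered p.1.1 p.2.1 q.1.1 q.2.1
    exact ⟨⟨(E, p.1.2 ⊓ q.1.2), hE, isOpen_inf p.2.2 q.2.2⟩,
      fun _ hf => IsConstMod.mono hf h le_rfl,
      fun _ hf => IsConstMod.mono hf h' le_rfl, inf_le_left, inf_le_right⟩
  approx f g I hI := by
    obtain ⟨D, hD, hf⟩ := f.2 I hI
    obtain ⟨D', hD', hg⟩ := g.2 I hI
    obtain ⟨E, hE, h, h'⟩ := Θ.cofiltered D hD D' hD'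
    replace hf := IsConstMod.mono hf h le_rfl
    replace hg := IsConstMod.mono hg h' le_rfl
    refine ⟨⟨(E, I), hE, hI⟩, le_rfl, pullUnif ⟨E, hE⟩ (sample E f.1), isConstMod_sample E ⊥ f.1,
      pullUnif ⟨E, hE⟩ (sample E g.1), isConstMod_sample E ⊥ g.1, fun μ => ?_, fun μ => ?_,
      fun μ => ?_⟩
    · simp only [LinearMap.flip_apply]
      rw [← map_sub]
      exact hB.mem_of_valuesIn hI μ fun x => sub_sample_mem hf x
    · simp only [LinearMap.flip_apply]
      rw [← map_sub]
      exact hB.mem_of_valuesIn hI μ fun x => sub_sample_mem hg x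
    · simp only [LinearMap.flip_apply]
      rw [← map_sub]
      exact hB.mem_of_valuesIn hI μ fun x =>
        mul_sub_mul_mem (sub_sample_mem hf x) (sub_sample_mem hg x)

theorem chiUnif_inf (U V : UnifSets Θ) : chiUnif k (U ⊓ V) = chiUnif k U * chiUnif k V :=
  Subtype.ext (chi_inf (⟨U.1, U.isClopen⟩ : Clopens X) ⟨V.1, V.isClopen⟩)

end Charts

/-! ### The diagonal -/

section Diagonal

variable {X : Type*} [TopologicalSpace X]
variable {k : Type*} [CommRing k] [UniformSpace k] [IsUniformAddGroup k] [IsTopologicalRing k]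
  [BaseRing k]

variable (X k) in
/-- The linear combinations of characteristic functions of clopen boxes. -/
def boxSpan : Submodule k C(X × X, k) :=
  Submodule.span k (Set.range fun p : Clopens X × Clopens X => chi k (p.1 ×ˢ p.2))

theorem chi_prod_mem_boxSpan (U V : Clopens X) : chi k (U ×ˢ V) ∈ boxSpan X k :=
  Submodule.subset_span ⟨(U, V), rfl⟩

/-- An intersection of boxes is a box. Closure under products is what lets finite unions of boxes be
handled by inclusion-exclusion. -/
theorem mul_mem_boxSpan {f g : C(X × X, k)} (hf : f ∈ boxSpan X k) (hg : g ∈ boxSpan X k) :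
    f * g ∈ boxSpan X k := by
  have h := Submodule.mul_mem_mul hf hg
  rw [boxSpan, Submodule.span_mul_span] at h
  refine Submodule.span_mono ?_ h
  rintro _ ⟨_, ⟨⟨U, V⟩, rfl⟩, _, ⟨⟨U', V'⟩, rfl⟩, rfl⟩
  refine ⟨(U ⊓ U', V ⊓ V'), ?_⟩
  beta_reduce
  rw [← chi_inf]
  congr 1
  exact SetLike.coe_injective Set.prod_inter_prod.symm

theorem chi_sup (U V : Clopens X) : chi k (U ⊔ V) = chi k U + chi k V - chi k U * chi k V := by
  ext x
  rw [ContinuousMap.sub_apply, ContinuousMap.add_apply, ContinuousMap.mul_apply]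
  by_cases h : x ∈ (U : Set X)
  · rw [chi_of_mem h, chi_of_mem (U := U ⊔ V) (Or.inl h), one_mul, add_sub_cancel_right]
  · by_cases h' : x ∈ (V : Set X)
    · rw [chi_of_notMem h, chi_of_mem h', chi_of_mem (U := U ⊔ V) (Or.inr h'), zero_mul, zero_add,
        sub_zero]
    · rw [chi_of_notMem h, chi_of_notMem h', chi_of_notMem (U := U ⊔ V) fun h1 => h1.elim h h',
        zero_mul, zero_add, sub_zero]

theorem chi_bot : chi k (⊥ : Clopens X) = 0 :=
  ContinuousMap.ext fun _ => chi_of_notMem fun h => h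

variable [TDSpace X]

variable (k) in
-- Boxes inside `W` cover `K`, and the characteristic function of a finite union of boxes is a
-- combination of boxes.
theorem exists_chi_mem_boxSpan (W : Clopens (X × X)) {K : Set (X × X)} (hK : IsCompact K)
    (hKW : K ⊆ W) : ∃ Z : Clopens (X × X), K ⊆ Z ∧ (Z : Set (X × X)) ⊆ W ∧
      chi k Z ∈ boxSpan X k := by
  refine hK.induction_on (p := fun s => ∃ Z : Clopens (X × X), s ⊆ Z ∧ (Z : Set (X × X)) ⊆ W ∧
    chi k Z ∈ boxSpan X k) ⟨⊥, by simp, by simp, ?_⟩ ?_ ?_ ?_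
  · rw [chi_bot]
    exact Submodule.zero_mem _
  · rintro s t hst ⟨Z, h, h'⟩
    exact ⟨Z, hst.trans h, h'⟩
  · rintro s t ⟨Z, h, hW, hZ⟩ ⟨Z', h', hW', hZ'⟩
    refine ⟨Z ⊔ Z', Set.union_subset_union h h', Set.union_subset hW hW', ?_⟩
    rw [chi_sup]
    exact Submodule.sub_mem _ (Submodule.add_mem _ hZ hZ') (mul_mem_boxSpan hZ hZ')
  · rintro ⟨x, y⟩ hxy
    obtain ⟨A, A', hA, hA', hx, hy, h⟩ := isOpen_prod_iff.1 W.isClopen.2 x y (hKW hxy)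
    obtain ⟨U, hU, hxU, hUA⟩ := (TDSpace.clopen_basis (X := X)).exists_subset_of_mem_open hx hA
    obtain ⟨V, hV, hyV, hVA⟩ := (TDSpace.clopen_basis (X := X)).exists_subset_of_mem_open hy hA'
    exact ⟨U ×ˢ V, mem_nhdsWithin_of_mem_nhds ((hU.2.prod hV.2).mem_nhds ⟨hxU, hyV⟩),
      (⟨U, hU⟩ : Clopens X) ×ˢ (⟨V, hV⟩ : Clopens X), subset_rfl, (Set.prod_mono hUA hVA).trans h,
      chi_prod_mem_boxSpan _ _⟩

/-- A functional on `C(X × X, k)` is determined by its values on clopen boxes. -/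
theorem stDual_prod_ext {μ ν : DAcsStrong (X × X) k}
    (h : ∀ U V : Clopens X, acsSetFunctionStrong μ (U ×ˢ V) = acsSetFunctionStrong ν (U ×ˢ V)) :
    μ = ν := by
  suffices H : ∀ φ : C(X × X, k) →L[k] k, (∀ U V : Clopens X, φ (chi k (U ×ˢ V)) = 0) →
      ∀ W : Clopens (X × X), φ (chi k W) = 0 by
    refine acsSetFunctionStrong_injective (funext fun W => sub_eq_zero.1 ?_)
    exact H ((show C(X × X, k) →L[k] k from μ) - (show C(X × X, k) →L[k] k from ν))
      (fun U V => sub_eq_zero.2 (h U V)) W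
  intro φ hφ W
  refine eq_of_forall_sub_mem fun I hI => ?_
  rw [sub_zero]
  -- By continuity `φ` modulo `I` sees only a compact set `K`, on which `W` can be replaced by a
  -- finite union `Z` of boxes; `φ` vanishes on the characteristic function of `Z`.
  obtain ⟨⟨K, J⟩, ⟨hK, -⟩, hle⟩ := (isBasisOfOpenSubmodules_continuousMap (X × X) k).exists_le
    (isBasisOfOpenSubmodules_self k) (u := (φ : C(X × X, k) →ₗ[k] k)) φ.continuous hI
  obtain ⟨Z, hKZ, hZW, hZ⟩ := exists_chi_mem_boxSpan k W (hK.inter_right W.isClopen.1)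
    Set.inter_subset_right
  have h0 : boxSpan X k ≤ LinearMap.ker (φ : C(X × X, k) →ₗ[k] k) :=
    Submodule.span_le.2 (by rintro _ ⟨⟨U, V⟩, rfl⟩; exact hφ U V)
  have h1 : chi k W - chi k Z ∈ valuesIn k K J := by
    intro x hx
    rw [ContinuousMap.sub_apply]
    by_cases hxW : x ∈ (W : Set (X × X))
    · rw [chi_of_mem hxW, chi_of_mem (hKZ ⟨hx, hxW⟩), sub_self]
      exact J.zero_mem
    · rw [chi_of_notMem hxW, chi_of_notMem fun h => hxW (hZW h), sub_self]
      exact J.zero_mem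
  have h2 : φ (chi k W - chi k Z) ∈ I := hle h1
  have h3 : φ (chi k Z) = 0 := h0 hZ
  rwa [map_sub, h3, sub_zero] at h2

theorem acsSetFunctionStrong_diag (μ : DAcsStrong X k) (U V : Clopens X) :
    acsSetFunctionStrong (StDual.transpose (pullback (diagC X)) μ) (U ×ˢ V) =
      acsSetFunctionStrong μ (U ⊓ V) := by
  have e : (chi k (U ×ˢ V)).comp (diagC X) = chi k (U ⊓ V) := by
    ext x
    rfl
  change StDual.eval ((chi k (U ×ˢ V)).comp (diagC X)) μ = _
  rw [e]
  rfl

theorem eq_diag_iff (μ : DAcsStrong X k) (ν : DAcsStrong (X × X) k) :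
    ν = StDual.transpose (pullback (diagC X)) μ ↔
      ∀ U V : Clopens X, acsSetFunctionStrong ν (U ×ˢ V) = acsSetFunctionStrong μ (U ⊓ V) := by
  constructor
  · rintro rfl U V
    exact acsSetFunctionStrong_diag μ U V
  · intro h
    exact stDual_prod_ext fun U V => (h U V).trans (acsSetFunctionStrong_diag μ U V).symm

end Diagonal

end TDMeasure

end

theorem proposition5p1 {k : Type*} [CommRing k] [UniformSpace k] [IsUniformAddGroup k]
    [IsTopologicalRing k] [TDMeasure.BaseRing k]
    {X : Type*} [TopologicalSpace X] [TDMeasure.TDSpace X] :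
    -- density of `k[Σ(X)]` in `C(X, k)`
    DenseRange (TDMeasure.clopenAlgebraMap X k) ∧
    -- measures with almost compact support
    ((Function.Bijective (TDMeasure.WkDual.toLim k C(X, k)) ∧
        Function.Bijective (TDMeasure.StDual.toLim k C(X, k))) ∧
      (Function.Injective (TDMeasure.acsSetFunction (X := X) (k := k)) ∧
        Set.range (TDMeasure.acsSetFunction (X := X) (k := k)) =
          {m | TDMeasure.IsAcsMeasure m}) ∧
      (Function.Injective (TDMeasure.acsSetFunctionStrong (X := X) (k := k)) ∧
        Set.range (TDMeasure.acsSetFunctionStrong (X := X) (k := k)) =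
          {m | TDMeasure.IsAcsMeasure m}) ∧
      TDMeasure.HasNaiveCanonicalTopology k (TDMeasure.DAcsStrong X k) ∧
      TDMeasure.IsBasisOfOpenSubmodules
        (fun p : DiscreteQuotient X × Ideal k =>
          TDMeasure.IsProperQuotient p.1 ∧ IsOpen (p.2 : Set k))
        (fun p => TDMeasure.acsNhd p.1 p.2) ∧
      (∃ Δ : TDMeasure.DAcs X k →ₗ[k]
          TDMeasure.CompletedTensor k (TDMeasure.DAcs X k) (TDMeasure.DAcs X k),
        TDMeasure.IsCoproduct (fun f : C(X, k) => TDMeasure.WkDual.eval f) Δ ∧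
        (∀ Δ', TDMeasure.IsCoproduct (fun f : C(X, k) => TDMeasure.WkDual.eval f) Δ' → Δ' = Δ) ∧
        TDMeasure.CoproductFormula
          (fun U : Clopens X => TDMeasure.WkDual.eval (TDMeasure.chi k U)) Δ ∧
        (∀ Δ', TDMeasure.CoproductFormula
          (fun U : Clopens X => TDMeasure.WkDual.eval (TDMeasure.chi k U)) Δ' → Δ' = Δ)) ∧
      Continuous (TDMeasure.StDual.transpose (TDMeasure.pullback (k := k) (TDMeasure.diagC X))) ∧
      (∀ (μ : TDMeasure.DAcsStrong X k) (ν : TDMeasure.DAcsStrong (X × X) k),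
        ν = TDMeasure.StDual.transpose (TDMeasure.pullback (TDMeasure.diagC X)) μ ↔
          ∀ U V : Clopens X, TDMeasure.acsSetFunctionStrong ν (U ×ˢ V) =
            TDMeasure.acsSetFunctionStrong μ (U ⊓ V)) ∧
      (∀ Δ : TDMeasure.DAcsStrong X k →ₗ[k]
          TDMeasure.CompletedTensor k (TDMeasure.DAcsStrong X k) (TDMeasure.DAcsStrong X k),
        TDMeasure.IsCoproduct (fun f : C(X, k) => TDMeasure.StDual.eval f) Δ →
        TDMeasure.CoproductFormula
          (fun U : Clopens X => TDMeasure.StDual.eval (TDMeasure.chi k U)) Δ)) ∧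
    -- measures
    ((Function.Bijective (TDMeasure.WkDual.toLim k (TDMeasure.CAcs X k)) ∧
        Function.Bijective (TDMeasure.StDual.toLim k (TDMeasure.CAcs X k))) ∧
      (Function.Injective (TDMeasure.measSetFunction (X := X) (k := k)) ∧
        Set.range (TDMeasure.measSetFunction (X := X) (k := k)) =
          {m | TDMeasure.IsFinAddMeasure m}) ∧
      (Function.Injective (TDMeasure.measSetFunctionStrong (X := X) (k := k)) ∧
        Set.range (TDMeasure.measSetFunctionStrong (X := X) (k := k)) =
          {m | TDMeasure.IsFinAddMeasure m}) ∧
      (∃ Δ : TDMeasure.DMeas X k →ₗ[k]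
          TDMeasure.CompletedTensor k (TDMeasure.DMeas X k) (TDMeasure.DMeas X k),
        TDMeasure.IsCoproduct (fun f : TDMeasure.CAcs X k => TDMeasure.WkDual.eval f) Δ ∧
        (∀ Δ', TDMeasure.IsCoproduct
          (fun f : TDMeasure.CAcs X k => TDMeasure.WkDual.eval f) Δ' → Δ' = Δ) ∧
        TDMeasure.CoproductFormula
          (fun C : CompactOpens X => TDMeasure.WkDual.eval (TDMeasure.chiAcs k C)) Δ ∧
        (∀ Δ', TDMeasure.CoproductFormula
          (fun C : CompactOpens X => TDMeasure.WkDual.eval (TDMeasure.chiAcs k C)) Δ' → Δ' = Δ)) ∧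
      TDMeasure.IsBasisOfOpenSubmodules
        (fun p : Finset (CompactOpens X) × Ideal k => IsOpen (p.2 : Set k))
        (fun p => TDMeasure.measNhd p.1 p.2) ∧
      TDMeasure.HasNaiveCanonicalTopology k (TDMeasure.DMeasStrong X k)) ∧
    -- uniform measures, with their integration pairing `B`
    ∀ Θ : TDMeasure.TDUniformity X,
      (∃! B : TDMeasure.DUnif k Θ →ₗ[k] TDMeasure.CUnif k Θ →ₗ[k] k,
        TDMeasure.IsUnifIntegration B) ∧
      ∀ B : TDMeasure.DUnif k Θ →ₗ[k] TDMeasure.CUnif k Θ →ₗ[k] k,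
        TDMeasure.IsUnifIntegration B →
        (∀ D ∈ Θ.radii, Function.Bijective (TDMeasure.WkDual.toLim k C(D, k))) ∧
        (Function.Injective (TDMeasure.unifSetFunction B) ∧
          Set.range (TDMeasure.unifSetFunction B) = {m | TDMeasure.IsUnifMeasure m}) ∧
        (∃ Δ : TDMeasure.DUnif k Θ →ₗ[k]
            TDMeasure.CompletedTensor k (TDMeasure.DUnif k Θ) (TDMeasure.DUnif k Θ),
          TDMeasure.IsCoproduct (fun f : TDMeasure.CUnif k Θ => B.flip f) Δ ∧
          (∀ Δ', TDMeasure.IsCoproduct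
            (fun f : TDMeasure.CUnif k Θ => B.flip f) Δ' → Δ' = Δ) ∧
          TDMeasure.CoproductFormula
            (fun U : TDMeasure.UnifSets Θ => B.flip (TDMeasure.chiUnif k U)) Δ ∧
          (∀ Δ', TDMeasure.CoproductFormula
            (fun U : TDMeasure.UnifSets Θ => B.flip (TDMeasure.chiUnif k U)) Δ' → Δ' = Δ)) ∧
        TDMeasure.IsBasisOfOpenSubmodules
          (fun p : DiscreteQuotient X × Ideal k => p.1 ∈ Θ.radii ∧ IsOpen (p.2 : Set k))
          (fun p => TDMeasure.unifNhd B p.1 p.2) ∧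
        -- the maps between the three spaces of measures
        Continuous (TDMeasure.inc k Θ) ∧
        (∀ (μ : TDMeasure.DAcs X k) (f : TDMeasure.CUnif k Θ),
          B (TDMeasure.inc k Θ μ) f = TDMeasure.WkDual.eval f.1 μ) ∧
        (∀ (μ : TDMeasure.DAcs X k) (U : TDMeasure.UnifSets Θ),
          TDMeasure.unifSetFunction B (TDMeasure.inc k Θ μ) U =
            TDMeasure.acsSetFunction μ ⟨U.1, U.isClopen⟩) ∧
        ∃ hle : TDMeasure.acsSubmodule X k ≤ TDMeasure.unifSubmodule k Θ,
          ∃ j : TDMeasure.DUnif k Θ →ₗ[k] TDMeasure.DMeas X k, Continuous j ∧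
            (∀ (μ : TDMeasure.DUnif k Θ) (f : TDMeasure.CAcs X k),
              TDMeasure.WkDual.eval f (j μ) = B μ ⟨f.1, hle f.2⟩) ∧
            ∀ (μ : TDMeasure.DUnif k Θ) (C : CompactOpens X),
              TDMeasure.measSetFunction (j μ) C =
                B μ ⟨(TDMeasure.chiAcs k C).1, hle (TDMeasure.chiAcs k C).2⟩ := by
  refine ⟨TDMeasure.denseRange_clopenAlgebraMap X k,
    ⟨⟨TDMeasure.wkDual_continuousMap_toLim_bijective X k, TDMeasure.stDual_toLim_bijective
        (TDMeasure.isBasisOfOpenSubmodules_continuousMap X k).isLinearlyTopologized⟩,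
      ⟨TDMeasure.acsSetFunction_injective, TDMeasure.range_acsSetFunction⟩,
      ⟨TDMeasure.acsSetFunctionStrong_injective, TDMeasure.range_acsSetFunctionStrong⟩,
      TDMeasure.hasNaiveCanonicalTopology_dAcsStrong X k,
      TDMeasure.isBasisOfOpenSubmodules_acsNhd X k,
      (TDMeasure.acsAtlas X k).exists_coproduct TDMeasure.chi_inf
        (TDMeasure.isBasisOfOpenSubmodules_acsNhd X k),
      TDMeasure.stDual_continuous_transpose _, TDMeasure.eq_diag_iff,
      fun _ => TDMeasure.CoproductAtlas.coproductFormula_of_isCoproduct TDMeasure.chi_inf⟩,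
    ⟨⟨TDMeasure.wkDual_cAcs_toLim_bijective X k, TDMeasure.stDual_toLim_bijective
        (TDMeasure.isBasisOfOpenSubmodules_cAcs X k).isLinearlyTopologized⟩,
      ⟨TDMeasure.measSetFunction_injective, TDMeasure.range_measSetFunction⟩,
      ⟨TDMeasure.measSetFunctionStrong_injective, TDMeasure.range_measSetFunctionStrong⟩,
      (TDMeasure.measAtlas X k).exists_coproduct TDMeasure.chiAcs_inf
        (TDMeasure.isBasisOfOpenSubmodules_measNhd X k),
      TDMeasure.isBasisOfOpenSubmodules_measNhd X k,
      TDMeasure.hasNaiveCanonicalTopology_dMeasStrong X k⟩,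
    fun Θ => ⟨TDMeasure.existsUnique_unifIntegration k Θ, fun B hB => ⟨fun D _ => ?_,
      ⟨TDMeasure.IsUnifIntegration.unifSetFunction_injective hB,
        TDMeasure.IsUnifIntegration.range_unifSetFunction hB⟩,
      (TDMeasure.IsUnifIntegration.atlas hB).exists_coproduct TDMeasure.chiUnif_inf
        (TDMeasure.IsUnifIntegration.isBasisOfOpenSubmodules hB),
      TDMeasure.IsUnifIntegration.isBasisOfOpenSubmodules hB, TDMeasure.continuous_inc k Θ,
      TDMeasure.IsUnifIntegration.apply_inc hB,
      fun μ U => TDMeasure.IsUnifIntegration.apply_inc hB μ (TDMeasure.chiUnif k U),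
      TDMeasure.acsSubmodule_le_unifSubmodule k Θ, TDMeasure.IsUnifIntegration.toDMeas hB,
      TDMeasure.IsUnifIntegration.continuous_toDMeas hB,
      TDMeasure.IsUnifIntegration.eval_toDMeas hB,
      fun μ C => TDMeasure.IsUnifIntegration.eval_toDMeas hB μ (TDMeasure.chiAcs k C)⟩⟩⟩
  -- A radius is a discrete space, hence itself a td-space.
  have := TDMeasure.tdSpace_of_discreteTopology D
  exact TDMeasure.wkDual_continuousMap_toLim_bijective D k
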